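/- **Theorem.** There are a random access machine (RAM) $P$ and a constant $C$ such that the following holds for all integers $n\ge 0$ and $k\ge 1$ and every $k$-DNF $D$ on the variables $x_1,\dots,x_n$: on input $D$, the machine $P$ outputs every model of $D$ exactly once, outputs nothing else, and halts; its precomputation takes time at most $C(n+1)$, and its delay is at most $C\,k^{3/2}\,2^{2k}$. In short: the models of a $k$-DNF on $n$ variables can be enumerated with $O(n)$ precomputation and $O(k^{3/2}2^{2k})$ delay; in particular the delay is bounded by a constant when $k$ is fixed. Here a *term* is a finite set of literals whose variables are pairwise different, a *$k$-DNF* is a finite set of terms with at most $k$ literals each, and a *model* of $D$ is an assignment $\alpha:\{x_1,\dots,x_n\}\to\{0,1\}$ satisfying all literals of at least one term of $D$. The *precomputation* lasts from the start until the first output (until the halt if $D$ has no model); the *delay* is the largest time between two consecutive outputs, or between the last output and the halt. *Input.* The input is a sequence of natural numbers: $n$, the number of terms, and then the terms of $D$ in an arbitrary order without repetition, each given by its number of literals followed by the index and the sign of each of its literals, in ascending order of the variables. *Machine.* Registers hold natural numbers and are initially $0$. The instructions are loading constants, indirect loads and stores, random access to the entries of the (read-only) input, reading the length of the input, addition, truncated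 subtraction and multiplication, a conditional jump on zero, and $\mathtt{Output}(i,j)$, which outputs the sequence of the contents of the registers $R_i,R_{i+1},\dots,R_j$ ($i$ and $j$ are read from registers); a model is output as $\alpha(x_1)\cdots\alpha(x_n)$. Every instruction takes one unit of time, except that an arithmetic instruction takes time linear in the size of its operands counted in machine words, namely $1+\lfloor (|a|+|b|)/w\rfloor$, where $|a|,|b|$ are the bit lengths of the operands and $w$ is the number of bits of the larger of the input length and the largest input entry. -/

import Mathlib

/-! ### Terms, DNF formulas and their models -/

/-- A literal over the variables `x_0, …, x_{n-1}`: `(i, true)` is `x_i`, `(i, false)` is `¬ x_i`. -/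
abbrev Literal (n : ℕ) := Fin n × Bool

/-- A term: a finite set of literals, any two of which have different variables. -/
@[ext] structure DNFTerm (n : ℕ) where
  lits : Finset (Literal n)
  consistent : ∀ l ∈ lits, ∀ l' ∈ lits, l.1 = l'.1 → l = l'

/-- A formula in disjunctive normal form: a finite set of terms. -/
abbrev DNF (n : ℕ) := Finset (DNFTerm n)

/-- The assignment `α` satisfies every literal of the term `T`. -/
def DNFTerm.Sat {n : ℕ} (T : DNFTerm n) (α : Fin n → Bool) : Prop :=
  ∀ l ∈ T.lits, α l.1 = l.2

/-- The set of models of `D`: the assignments of all `n` variables satisfying some term of `D`. -/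
def DNF.models {n : ℕ} (D : DNF n) : Set (Fin n → Bool) :=
  {α | ∃ T ∈ D, T.Sat α}

/-- All terms have at most `k` literals. -/
def DNF.IsKDNF {n : ℕ} (D : DNF n) (k : ℕ) : Prop :=
  ∀ T ∈ D, T.lits.card ≤ k

/-! ### How a formula is presented to a machine, and how a model is written -/

/-- `ls` lists the literals of `T` in ascending order of their variables. -/
def DNFTerm.IsListing {n : ℕ} (T : DNFTerm n) (ls : List (Literal n)) : Prop :=
  ls.Pairwise (fun a b => a.1 < b.1) ∧ ∀ l, l ∈ ls ↔ l ∈ T.lits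

/-- `F` lists the terms of `D`, in an arbitrary order and without repetition. -/
def DNF.IsListing {n : ℕ} (D : DNF n) (F : List (List (Literal n))) : Prop :=
  ∃ ts : List (DNFTerm n), ts.Nodup ∧ (∀ T, T ∈ ts ↔ T ∈ D) ∧
    List.Forall₂ DNFTerm.IsListing ts F

/-- A term is written as its number of literals, followed by two numbers for each literal:
the index of its variable and its sign. -/
def encodeTerm {n : ℕ} (ls : List (Literal n)) : List ℕ :=
  ls.length :: ls.flatMap (fun l => [(l.1 : ℕ), l.2.toNat])

/-- A formula is written as its number of variables, its number of terms, and its terms. -/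
def encodeDNF {n : ℕ} (F : List (List (Literal n))) : List ℕ :=
  n :: F.length :: F.flatMap encodeTerm

/-- An assignment is written as the sequence of its values `α(x_0) ⋯ α(x_{n-1})`. -/
def encodeAssignment {n : ℕ} (α : Fin n → Bool) : List ℕ :=
  List.ofFn (fun i => (α i).toNat)

/-! ### Random access machines with an output instruction -/

namespace RAM

/-- The arithmetic operations; `sub` is truncated, since registers hold natural numbers. -/
inductive ArithOp
  | add
  | sub
  | mul

def ArithOp.eval : ArithOp → ℕ → ℕ → ℕ
  | .add, a, b => a + b
  | .sub, a, b => a - b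
  | .mul, a, b => a * b

/-- The instructions, where `R_i` is the content of register `i` and `x` the input. -/
inductive Instr
  /-- `R_d := c` -/
  | const (d c : ℕ)
  /-- `R_d := R_{R_s}` -/
  | load (d s : ℕ)
  /-- `R_{R_d} := R_s` -/
  | store (d s : ℕ)
  /-- `R_d := x_{R_s}`, which is `0` beyond the end of the input -/
  | input (d s : ℕ)
  /-- `R_d := |x|`, the number of entries of the input -/
  | inputLength (d : ℕ)
  /-- `R_d := R_a op R_b` -/
  | arith (op : ArithOp) (d a b : ℕ)
  /-- go to instruction `l` if `R_a = 0`, and to the next instruction otherwise -/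
  | jumpZero (a l : ℕ)
  /-- `Output(R_a, R_b)`: output the contents of the registers numbered `R_a, R_a + 1, …, R_b` -/
  | output (a b : ℕ)

abbrev Program := List Instr

/-- A state of the computation: the program counter, the registers, the time elapsed so far, and
the words output so far, in chronological order, each with the time at which it was output. -/
structure State where
  pc : ℕ
  reg : ℕ → ℕ
  clock : ℕ
  log : List (ℕ × List ℕ)

/-- Initially all registers hold `0`; the input is read through its own instructions. -/
def State.init : State := ⟨0, fun _ => 0, 0, []⟩

/-- The number of bits of a machine word on the input `x`: enough to write the length of `x`
and every entry of `x`. -/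
def wordLength (x : List ℕ) : ℕ := Nat.size (max x.length (x.foldr max 0))

/-- The time taken by one instruction: linear in the size of the operands, counted in machine
words, for an arithmetic instruction, and one for all others. -/
def Instr.cost (x : List ℕ) (R : ℕ → ℕ) : Instr → ℕ
  | .arith _ _ a b => 1 + (Nat.size (R a) + Nat.size (R b)) / wordLength x
  | _ => 1

/-- The registers after one instruction. -/
def Instr.effect (x : List ℕ) (R : ℕ → ℕ) : Instr → (ℕ → ℕ)
  | .const d c => Function.update R d c
  | .load d s => Function.update R d (R (R s))
  | .store d s => Function.update R (R d) (R s)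
  | .input d s => Function.update R d (x.getD (R s) 0)
  | .inputLength d => Function.update R d x.length
  | .arith op d a b => Function.update R d (op.eval (R a) (R b))
  | .jumpZero _ _ => R
  | .output _ _ => R

/-- The number of the instruction to be executed after the one numbered `pc`. -/
def Instr.nextPc (R : ℕ → ℕ) (pc : ℕ) : Instr → ℕ
  | .jumpZero a l => if R a = 0 then l else pc + 1
  | _ => pc + 1

/-- The word that one instruction outputs, if any. -/
def Instr.emit (R : ℕ → ℕ) : Instr → Option (List ℕ)
  | .output a b => some ((List.range' (R a) (R b + 1 - R a)).map R)
  | _ => none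

/-- One step of the program `P` on the input `x`. The machine has halted when the program counter
points outside the program; a halted machine does not change any more. -/
def step (P : Program) (x : List ℕ) (s : State) : State :=
  match P[s.pc]? with
  | none => s
  | some I =>
    { pc := I.nextPc s.reg s.pc
      reg := I.effect x s.reg
      clock := s.clock + I.cost x s.reg
      log := s.log ++ (I.emit s.reg).toList.map (fun y => (s.clock + I.cost x s.reg, y)) }

/-- The state after `N` steps of `P` on the input `x`. -/
def run (P : Program) (x : List ℕ) (N : ℕ) : State := (step P x)^[N] State.init

/-- On the input `x`, the program `P` halts after having output every word of `S` exactly once and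
no other word. The first output (or the halt, if there is no output) comes after time at most `p`,
and the time between two consecutive outputs, and between the last output and the halt, is at
most `d`. -/
def EnumeratesWithin (P : Program) (x : List ℕ) (S : Set (List ℕ)) (p d : ℝ) : Prop :=
  ∃ N : ℕ, ∃ s : State, s = run P x N ∧ P.length ≤ s.pc ∧
    (s.log.map Prod.snd).Nodup ∧ (∀ y, y ∈ s.log.map Prod.snd ↔ y ∈ S) ∧
    (∀ t ∈ (s.log.map Prod.fst ++ [s.clock]).head?, (t : ℝ) ≤ p) ∧
    (s.log.map Prod.fst ++ [s.clock]).IsChain (fun t t' => (t' : ℝ) ≤ (t : ℝ) + d)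

end RAM

/-!
The machine runs two enumerations side by side and interleaves their outputs.

* Let `T` be the first term. Its models are the `2 ^ (n - |T|)` assignments of the free variables, the
  variables that do not occur in `T`. They are enumerated by a loopless Gray code with focus pointers
  (`gray_visits`): from one model to the next, a constant number of instructions. To set up its tables
  takes time `O(n)`, after which the first word is output. This is all of the precomputation.
* The other models, which falsify `T`, are found by a depth-first search over all assignments, which
  carries along, for each prefix of an assignment, the list without repetitions of what the prefix
  leaves of the terms. What is left of a term is a suffix of it, so it is represented by a node of a
  trie of suffixes, which is built while the input is read; a restriction then follows one pointer, and
  repetitions are detected through marks in the nodes (`wp_checkMark`). The head of the list always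
  belongs to `T`. At a leaf, each term is either satisfied or falsified, so that the list tells at once
  whether the assignment is to be output (`ListFor.one_lt_length_iff`).

The search may spend a long time without output, and the Gray code pays for it. Let `κ` be the maximal
length of the terms read so far. After each `16 * 2 ^ (|T| + κ)` units of work on the input or on the
search, one word of the Gray code is output; after the search, the rest of the Gray code follows. A unit
of work takes time `O(k)`: to read a term takes `O(k)` instructions, to process a list element `O(1)`
instructions, of which only those on the work counter and its limit concern more than `O(1)` machine
words, namely `O(k)` bits. So the delay is `O(k * 2 ^ (2 * k))`.

It must be shown that the Gray code does not come to its end too early. The work on the input consists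
of one unit for each term `l`, which costs at most the fraction `1 / (16 * 2 ^ (|T| + |l|))` of a word.
As `∑ 2 ^ (-|l|) ≤ 2 ^ n` over any set of terms (`sum_weight_le`), reading costs at most the
`16`-th part of all words (`Ctx.readCost_le`). A prefix that leaves `m` variables unassigned has a list
of at most `numTm m κ + 1` elements, one more than the number of terms with at most `κ` literals over
`m` variables. Summed over the tree of all assignments these are at most `2 ^ (n + κ + 2)` elements for
either value of the variable that is assigned next, in total `2 ^ (n + κ + 3)` (`treeTm_le`, `work_le`),
which cost half of all words. The accounts are kept by the potential `Φ` of the invariant `Inv`.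

The program is written in a small structured language (`Stmt`), whose big-step semantics `Exec` charges
time and checks the deadlines for the outputs. `Exec.enumerates` transfers the result to the compiled
program, and `wp` is the weakest precondition calculus in which the program is verified.
-/

set_option linter.constructorNameAsVariable false

namespace KDNF

open RAM

/-! ### A structured language over the random access machine -/

/-- The named scalar registers of the enumeration program. They occupy the registers below `64` of
the machine; the registers from `64` on form a separate memory.

Throughout the computation, `va` and `ve` hold the first and the last address of the assignment of
the Gray code, `vb` and `vbe` those of the assignment of the search; `ps` the address of the list of
the free variables, `fo` of the focus pointers, `st` of the stack of the search, `bs` and `be` of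
the tables of the beginnings and the ends of lists, `l0` of the list of all terms, `dead` and `root`
of the nodes for falsified and for satisfied terms; `sz` is the size of a node, `hp` the first
address behind the trie, `tl` the length of the first term, `nf` the number of free variables, `rm`
the maximal length of the terms read so far, `bud` the work to be done between two words of the Gray
code, and `cnt` the work done since the last one. -/
inductive Var
  | zero | one | n | rem | va | ve | ps | fo | vb | vbe | st | bs | be | l0 | dead | root | sz | hp
  | tl | nf | bud | rm | cnt
  | ta | tb | tj | tt | tv | ty
  | i | j | e | a | t | t1 | y | p | q | s | u | var | len | ip | lp | d | b | lo | hi | nb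
  | top | sp | go
deriving DecidableEq

/-- The machine register of a variable; register `0` is left free for unconditional jumps. -/
def Var.idx (a : Var) : ℕ := a.ctorIdx + 1

theorem Var.idx_injective : Function.Injective Var.idx := fun a b h => by
  rw [← Var.ofNat_ctorIdx a, ← Var.ofNat_ctorIdx b]
  exact congrArg _ (Nat.succ_injective h)

theorem Var.idx_lt (a : Var) : a.idx < 64 := by cases a <;> decide

theorem Var.idx_ne_zero (a : Var) : a.idx ≠ 0 := Nat.succ_ne_zero _

/-- Elementary operations: the machine instructions other than jumps, on named registers. The flag
of an arithmetic operation tells whether its operands may exceed a constant number of words. -/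
inductive Op
  | const (d : Var) (c : ℕ)
  | load (d s : Var)
  | store (d s : Var)
  | input (d s : Var)
  | arith (wide : Bool) (o : ArithOp) (d a b : Var)
  | output (a b : Var)

/-- The machine instruction for an operation. -/
def Op.instr : Op → Instr
  | .const d c => .const d.idx c
  | .load d s => .load d.idx s.idx
  | .store d s => .store d.idx s.idx
  | .input d s => .input d.idx s.idx
  | .arith _ o d a b => .arith o d.idx a.idx b.idx
  | .output a b => .output a.idx b.idx

/-- Structured programs. -/
inductive Stmt
  | skip
  | op (o : Op)
  | seq (s t : Stmt)
  /-- run `s` if the register `a` is zero, and `t` otherwise -/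
  | ifz (a : Var) (s t : Stmt)
  /-- run `s` as long as the register `a` is nonzero -/
  | loop (a : Var) (s : Stmt)

infixr:60 " ;; " => Stmt.seq

namespace Stmt

/-- Operations as programs; the plain arithmetic operations are narrow. -/
abbrev const (d : Var) (c : ℕ) : Stmt := .op (.const d c)
abbrev load (d s : Var) : Stmt := .op (.load d s)
abbrev store (d s : Var) : Stmt := .op (.store d s)
abbrev input (d s : Var) : Stmt := .op (.input d s)
abbrev output (a b : Var) : Stmt := .op (.output a b)
abbrev add (d a b : Var) : Stmt := .op (.arith false .add d a b)
abbrev sub (d a b : Var) : Stmt := .op (.arith false .sub d a b)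
abbrev wideAdd (d a b : Var) : Stmt := .op (.arith true .add d a b)
abbrev wideSub (d a b : Var) : Stmt := .op (.arith true .sub d a b)

/-- The number of machine instructions of the compiled program. -/
def size : Stmt → ℕ
  | skip => 0
  | op _ => 1
  | seq s t => s.size + t.size
  | ifz _ s t => t.size + s.size + 3
  | loop _ s => s.size + 3

/-- The machine code of a structured program that starts at position `b`. An unconditional jump is
a jump on register `0`, which holds zero. -/
def compile : ℕ → Stmt → Program
  | _, skip => []
  | _, op o => [o.instr]
  | b, seq s t => compile b s ++ compile (b + s.size) t
  | b, ifz a s t =>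
      .jumpZero a.idx (b + t.size + 3) :: (compile (b + 1) t ++
        (.const 0 0 :: .jumpZero 0 (b + t.size + 3 + s.size) :: compile (b + t.size + 3) s))
  | b, loop a s =>
      .jumpZero a.idx (b + s.size + 3) :: (compile (b + 1) s ++
        [.const 0 0, .jumpZero 0 b])

theorem length_compile (s : Stmt) (b : ℕ) : (compile b s).length = s.size := by
  induction s generalizing b with
  | skip => rfl
  | op o => rfl
  | seq s t hs ht => simp [compile, size, hs, ht]
  | ifz a s t hs ht => simp [compile, size, hs, ht]; omega
  | loop a s hs => simp [compile, size, hs]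

end Stmt

/-- A state of a structured program: the named registers, the memory (the registers from `64` on),
an upper bound `gap` for the time elapsed since the last output (or since the start, if there was no
output), in units of `17` machine steps, and the words output so far. -/
structure Cfg where
  v : Var → ℕ
  m : ℕ → ℕ
  gap : ℕ
  words : List (List ℕ)

/-- Let `c` units of time pass. -/
def Cfg.wait (σ : Cfg) (c : ℕ) : Cfg := { σ with gap := σ.gap + c }

/-- The data on which the meaning of a structured program depends: the input, bounds for the
operands of narrow and of wide arithmetic, the time charged for wide arithmetic, and the limits for
the time until the first output and for the time between later outputs. -/
structure Env where
  x : List ℕ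
  narrow : ℕ
  wide : ℕ
  wideCost : ℕ
  first : ℕ
  later : ℕ

/-- The bounds on operands guarantee that `17` times the time charged is at least the time taken. In
the application the narrow operands have at most `8` machine words, so that an operation on two of
them takes time at most `1 + 16`. -/
structure Env.Valid (E : Env) : Prop where
  narrow : ∀ a b, a < E.narrow → b < E.narrow → 1 + (Nat.size a + Nat.size b) / wordLength E.x ≤ 17
  wide : ∀ a b, a < E.wide → b < E.wide →
    1 + (Nat.size a + Nat.size b) / wordLength E.x ≤ 17 * E.wideCost

/-- The condition under which an operation may be executed: addresses lie in the memory, operands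
obey the bounds, and outputs come in time. -/
def Op.Ok (E : Env) (σ : Cfg) : Op → Prop
  | .const _ _ => True
  | .load _ s => 64 ≤ σ.v s
  | .store d _ => 64 ≤ σ.v d
  | .input _ _ => True
  | .arith false _ _ a b => σ.v a < E.narrow ∧ σ.v b < E.narrow
  | .arith true _ _ a b => σ.v a < E.wide ∧ σ.v b < E.wide
  | .output a _ => 64 ≤ σ.v a ∧ σ.gap + 1 ≤ if σ.words = [] then E.first else E.later

/-- The effect of an operation; its time is charged to `gap`, which an output resets. -/
def Op.next (E : Env) (σ : Cfg) : Op → Cfg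
  | .const d c => ⟨Function.update σ.v d c, σ.m, σ.gap + 1, σ.words⟩
  | .load d s => ⟨Function.update σ.v d (σ.m (σ.v s)), σ.m, σ.gap + 1, σ.words⟩
  | .store d s => ⟨σ.v, Function.update σ.m (σ.v d) (σ.v s), σ.gap + 1, σ.words⟩
  | .input d s => ⟨Function.update σ.v d (E.x.getD (σ.v s) 0), σ.m, σ.gap + 1, σ.words⟩
  | .arith false o d a b =>
      ⟨Function.update σ.v d (o.eval (σ.v a) (σ.v b)), σ.m, σ.gap + 1, σ.words⟩
  | .arith true o d a b =>
      ⟨Function.update σ.v d (o.eval (σ.v a) (σ.v b)), σ.m, σ.gap + E.wideCost, σ.words⟩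
  | .output a b =>
      ⟨σ.v, σ.m, 0, σ.words ++ [(List.range' (σ.v a) (σ.v b + 1 - σ.v a)).map σ.m]⟩

/-- Big-step semantics: `s` started in the first state terminates in the second one, within the
limits of `E`. -/
inductive Exec (E : Env) : Stmt → Cfg → Cfg → Prop
  | skip {σ} : Exec E .skip σ σ
  | op {o σ} : Op.Ok E σ o → Exec E (.op o) σ (o.next E σ)
  | seq {s t σ σ' σ''} : Exec E s σ σ' → Exec E t σ' σ'' → Exec E (.seq s t) σ σ''
  | ifz_zero {a s t σ σ'} : σ.v a = 0 → Exec E s (σ.wait 1) σ' → Exec E (.ifz a s t) σ σ'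
  | ifz_pos {a s t σ σ'} : σ.v a ≠ 0 → Exec E t (σ.wait 1) σ' → Exec E (.ifz a s t) σ (σ'.wait 2)
  | loop_zero {a s σ} : σ.v a = 0 → Exec E (.loop a s) σ (σ.wait 1)
  | loop_pos {a s σ σ' σ''} : σ.v a ≠ 0 → Exec E s (σ.wait 1) σ' →
      Exec E (.loop a s) (σ'.wait 2) σ'' → Exec E (.loop a s) σ σ''

/-- The structured state `σ` describes the machine state `s`, and the outputs so far came in time.
-/
structure Sim (E : Env) (σ : Cfg) (s : State) : Prop where
  v : ∀ a : Var, s.reg a.idx = σ.v a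
  m : ∀ a, 64 ≤ a → s.reg a = σ.m a
  words : s.log.map Prod.snd = σ.words
  start : s.log = [] → s.clock ≤ 17 * σ.gap
  last : ∀ t ∈ (s.log.map Prod.fst).getLast?, s.clock ≤ t + 17 * σ.gap
  head : ∀ t ∈ (s.log.map Prod.fst).head?, t ≤ 17 * E.first
  chain : (s.log.map Prod.fst).IsChain (fun t t' => t' ≤ t + 17 * E.later)

/-- Steps without output. -/
theorem Sim.quiet {E : Env} {σ σ' : Cfg} {s s' : State} {c : ℕ} (h : Sim E σ s)
    (hv : ∀ a : Var, s'.reg a.idx = σ'.v a) (hm : ∀ a, 64 ≤ a → s'.reg a = σ'.m a)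
    (hl : s'.log = s.log) (hc : s'.clock ≤ s.clock + 17 * c) (hg : σ.gap + c ≤ σ'.gap)
    (hw : σ'.words = σ.words) : Sim E σ' s' where
  v := hv
  m := hm
  words := by rw [hl, hw, h.words]
  start h0 := by
    have := h.start (hl ▸ h0)
    omega
  last t ht := by
    rw [hl] at ht
    have := h.last t ht
    omega
  head := hl ▸ h.head
  chain := hl ▸ h.chain

/-- A step with output. -/
theorem Sim.loud {E : Env} {σ σ' : Cfg} {s s' : State} {w : List ℕ} (h : Sim E σ s)
    (hv : ∀ a : Var, s'.reg a.idx = σ'.v a) (hm : ∀ a, 64 ≤ a → s'.reg a = σ'.m a)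
    (hl : s'.log = s.log ++ [(s.clock + 1, w)]) (hc : s'.clock = s.clock + 1)
    (hw : σ'.words = σ.words ++ [w])
    (hlim : σ.gap + 1 ≤ if σ.words = [] then E.first else E.later) : Sim E σ' s' where
  v := hv
  m := hm
  words := by simp [hl, hw, h.words]
  start h0 := by simp [hl] at h0
  last t ht := by
    simp [hl] at ht
    omega
  head t ht := by
    rw [hl] at ht
    rcases hs : s.log with _ | ⟨y, ys⟩
    · have h1 := h.start hs
      have h2 : σ.words = [] := by rw [← h.words, hs]; rfl
      rw [if_pos h2] at hlim
      simp [hs] at ht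
      omega
    · have := h.head
      simp [hs] at ht this
      omega
  chain := by
    rw [hl, List.map_append, List.isChain_append]
    refine ⟨h.chain, by simp, fun t ht t' ht' => ?_⟩
    have h1 := h.last t ht
    have h2 : σ.words ≠ [] := by
      rw [← h.words]
      rintro h0
      simp at h0
      simp [h0] at ht
    rw [if_neg h2] at hlim
    simp at ht'
    omega

theorem step_of_getElem? {P : Program} {x : List ℕ} {s : State} {I : Instr}
    (h : P[s.pc]? = some I) :
    step P x s = ⟨I.nextPc s.reg s.pc, I.effect x s.reg, s.clock + I.cost x s.reg,
      s.log ++ (I.emit s.reg).toList.map (fun y => (s.clock + I.cost x s.reg, y))⟩ := by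
  simp [step, h]

theorem update_idx {R : ℕ → ℕ} {v : Var → ℕ} (h : ∀ a : Var, R a.idx = v a) (d : Var) (c : ℕ)
    (a : Var) : Function.update R d.idx c a.idx = Function.update v d c a := by
  by_cases had : a = d
  · subst had; simp
  · rw [Function.update_of_ne had, Function.update_of_ne (fun h => had (Var.idx_injective h)), h]

theorem update_idx_mem {R m : ℕ → ℕ} (h : ∀ a, 64 ≤ a → R a = m a) (d : Var) (c : ℕ)
    (a : ℕ) (ha : 64 ≤ a) : Function.update R d.idx c a = m a := by
  rw [Function.update_of_ne (by have := d.idx_lt; omega), h a ha]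

theorem Sim.op {E : Env} (hE : E.Valid) {σ : Cfg} {s : State} (h : Sim E σ s) {o : Op}
    (ho : o.Ok E σ) {P : Program} (hP : P[s.pc]? = some o.instr) :
    Sim E (o.next E σ) (step P E.x s) ∧ (step P E.x s).pc = s.pc + 1 := by
  rw [step_of_getElem? hP]
  refine ⟨?_, by cases o <;> rfl⟩
  cases o with
  | const d c =>
    exact h.quiet (c := 1) (update_idx h.v d c) (update_idx_mem h.m d c)
      (by simp [Op.instr, Instr.emit])
      (by simp [Op.instr, Instr.cost]) le_rfl rfl
  | load d r =>
    have : s.reg (s.reg r.idx) = σ.m (σ.v r) := by rw [h.v, h.m _ ho]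
    refine h.quiet (c := 1) ?_ ?_ (by simp [Op.instr, Instr.emit])
      (by simp [Op.instr, Instr.cost]) le_rfl rfl
    · simp only [Op.instr, Instr.effect, Op.next, this]
      exact update_idx h.v d _
    · exact update_idx_mem h.m d _
  | input d r =>
    refine h.quiet (c := 1) ?_ ?_ (by simp [Op.instr, Instr.emit])
      (by simp [Op.instr, Instr.cost]) le_rfl rfl
    · simp only [Op.instr, Instr.effect, Op.next, h.v]
      exact update_idx h.v d _
    · exact update_idx_mem h.m d _
  | store d r =>
    have h64 : 64 ≤ σ.v d := ho
    refine h.quiet (c := 1) ?_ ?_ (by simp [Op.instr, Instr.emit])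
      (by simp [Op.instr, Instr.cost]) le_rfl rfl
    · intro a
      have := a.idx_lt
      simp only [Op.instr, Instr.effect, Op.next, h.v]
      rw [Function.update_of_ne (by omega), h.v]
    · intro a ha
      simp only [Op.instr, Instr.effect, Op.next, h.v]
      by_cases hd : a = σ.v d
      · subst hd; simp
      · rw [Function.update_of_ne hd, Function.update_of_ne hd, h.m a ha]
  | arith w f d a b =>
    cases w with
    | false =>
      refine h.quiet (c := 1) ?_ ?_ (by simp [Op.instr, Instr.emit]) ?_ le_rfl rfl
      · simp only [Op.instr, Instr.effect, Op.next, h.v]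
        exact update_idx h.v d _
      · exact update_idx_mem h.m d _
      · have := hE.narrow _ _ ho.1 ho.2
        simp only [Op.instr, Instr.cost, h.v]
        omega
    | true =>
      refine h.quiet (c := E.wideCost) ?_ ?_ (by simp [Op.instr, Instr.emit]) ?_ le_rfl rfl
      · simp only [Op.instr, Instr.effect, Op.next, h.v]
        exact update_idx h.v d _
      · exact update_idx_mem h.m d _
      · have := hE.wide _ _ ho.1 ho.2
        simp only [Op.instr, Instr.cost, h.v]
        omega
  | output a b =>
    have h64 : 64 ≤ σ.v a := ho.1
    refine h.loud (w := (List.range' (σ.v a) (σ.v b + 1 - σ.v a)).map σ.m) h.v h.m ?_ rfl rfl ho.2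
    simp only [Op.instr, Instr.emit, h.v, Instr.cost, Option.toList_some, List.map_cons,
      List.map_nil, List.append_cancel_left_eq, List.cons.injEq, Prod.mk.injEq, true_and, and_true]
    refine List.map_congr_left fun r hr => h.m r ?_
    rw [List.mem_range'_1] at hr
    omega

theorem Sim.jump {E : Env} {σ : Cfg} {s : State} (h : Sim E σ s) {a : Var} {l : ℕ} {P : Program}
    (hP : P[s.pc]? = some (.jumpZero a.idx l)) :
    Sim E (σ.wait 1) (step P E.x s) ∧
      (step P E.x s).pc = if σ.v a = 0 then l else s.pc + 1 := by
  rw [step_of_getElem? hP]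
  refine ⟨h.quiet (c := 1) h.v h.m (by simp [Instr.emit]) (by simp [Instr.cost]) le_rfl rfl, ?_⟩
  simp [Instr.nextPc, h.v]

/-- The two instructions of an unconditional jump. -/
theorem Sim.goto {E : Env} {σ : Cfg} {s : State} (h : Sim E σ s) {l : ℕ} {P : Program}
    (hP : P[s.pc]? = some (.const 0 0)) (hP' : P[s.pc + 1]? = some (.jumpZero 0 l)) :
    Sim E (σ.wait 2) ((step P E.x)^[2] s) ∧ ((step P E.x)^[2] s).pc = l := by
  have h1 := step_of_getElem? (x := E.x) hP
  have hpc : (step P E.x s).pc = s.pc + 1 := by rw [h1]; rfl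
  have h2 := step_of_getElem? (x := E.x) (hpc ▸ hP')
  rw [Function.iterate_succ, Function.iterate_one, Function.comp, h2, h1]
  refine ⟨h.quiet (c := 2) (fun a => ?_) (fun a ha => ?_) ?_ ?_ le_rfl rfl, ?_⟩
  · simp [Instr.effect, Function.update_of_ne a.idx_ne_zero, h.v, Cfg.wait]
  · simp [Instr.effect, Function.update_of_ne (show a ≠ 0 by omega), h.m a ha, Cfg.wait]
  · simp [Instr.emit]
  · simp [Instr.cost]
  · simp [Instr.nextPc, Instr.effect]

theorem prefix_drop_append {P l₁ l₂ : Program} {b : ℕ} (h : l₁ ++ l₂ <+: P.drop b) :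
    l₁ <+: P.drop b ∧ l₂ <+: P.drop (b + l₁.length) := by
  obtain ⟨r, hr⟩ := h
  refine ⟨⟨l₂ ++ r, by rw [← hr, List.append_assoc]⟩, ⟨r, ?_⟩⟩
  rw [← List.drop_drop, ← hr]
  simp

theorem prefix_drop_cons {P l : Program} {b : ℕ} {I : Instr} (h : I :: l <+: P.drop b) :
    P[b]? = some I ∧ l <+: P.drop (b + 1) := by
  refine ⟨?_, (prefix_drop_append (l₁ := [I]) h).2⟩
  obtain ⟨r, hr⟩ := h
  rw [← Nat.add_zero b, ← List.getElem?_drop, ← hr]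
  rfl

/-- The compiled code does what the big-step semantics says. -/
theorem Exec.sound {E : Env} (hE : E.Valid) {c : Stmt} {σ σ' : Cfg}
    (h : Exec E c σ σ') {P : Program}
    {s : State} (hP : c.compile s.pc <+: P.drop s.pc) (hs : Sim E σ s) :
    ∃ N, Sim E σ' ((step P E.x)^[N] s) ∧ ((step P E.x)^[N] s).pc = s.pc + c.size := by
  induction h generalizing s with
  | skip => exact ⟨0, hs, rfl⟩
  | op ho =>
    obtain ⟨h1, h2⟩ := hs.op hE ho (prefix_drop_cons hP).1
    exact ⟨1, h1, h2⟩
  | @seq c₁ c₂ σ σ' σ'' _ _ ih1 ih2 =>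
    obtain ⟨p1, p2⟩ := prefix_drop_append hP
    rw [Stmt.length_compile] at p2
    obtain ⟨N1, s1, e1⟩ := ih1 p1 hs
    rw [← e1] at p2
    obtain ⟨N2, s2, e2⟩ := ih2 p2 s1
    refine ⟨N2 + N1, ?_, ?_⟩
    · rwa [Function.iterate_add_apply]
    · rw [Function.iterate_add_apply, e2, e1]
      simp [Stmt.size, add_assoc]
  | @ifz_zero a c₁ c₂ σ σ' h0 _ ih =>
    obtain ⟨p1, p2⟩ := prefix_drop_cons hP
    have p3 := (prefix_drop_append p2).2
    rw [Stmt.length_compile] at p3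
    have p4 := (prefix_drop_cons (prefix_drop_cons p3).2).2
    obtain ⟨s1, e1⟩ := hs.jump p1
    rw [if_pos h0] at e1
    obtain ⟨N, s2, e2⟩ := ih (s := step P E.x s) (by
      rw [e1]; convert p4 using 2; omega) s1
    refine ⟨N + 1, s2, ?_⟩
    rw [Function.iterate_succ_apply, e2, e1]
    simp [Stmt.size]; omega
  | @ifz_pos a c₁ c₂ σ σ' h0 _ ih =>
    obtain ⟨p1, p2⟩ := prefix_drop_cons hP
    obtain ⟨p2, p3⟩ := prefix_drop_append p2
    rw [Stmt.length_compile] at p3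
    obtain ⟨p3, p4⟩ := prefix_drop_cons p3
    have p4 := (prefix_drop_cons p4).1
    obtain ⟨s1, e1⟩ := hs.jump p1
    rw [if_neg h0] at e1
    obtain ⟨N, s2, e2⟩ := ih (s := step P E.x s) (by rw [e1]; exact p2) s1
    rw [e1] at e2
    obtain ⟨s3, e3⟩ := s2.goto (by rw [e2]; exact p3) (by rw [e2]; exact p4)
    refine ⟨2 + (N + 1), ?_, ?_⟩
    · rwa [Function.iterate_add_apply]
    · rw [Function.iterate_add_apply _ 2, Function.iterate_succ_apply _ N, e3]
      simp [Stmt.size]; omega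
  | @loop_zero a c σ h0 =>
    obtain ⟨p1, -⟩ := prefix_drop_cons hP
    obtain ⟨s1, e1⟩ := hs.jump p1
    rw [if_pos h0] at e1
    exact ⟨1, s1, e1⟩
  | @loop_pos a c σ σ' σ'' h0 _ _ ih1 ih2 =>
    obtain ⟨p1, p2⟩ := prefix_drop_cons hP
    obtain ⟨p2, p3⟩ := prefix_drop_append p2
    rw [Stmt.length_compile] at p3
    obtain ⟨p3, p4⟩ := prefix_drop_cons p3
    have p4 := (prefix_drop_cons p4).1
    obtain ⟨s1, e1⟩ := hs.jump p1
    rw [if_neg h0] at e1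
    obtain ⟨N, s2, e2⟩ := ih1 (s := step P E.x s) (by rw [e1]; exact p2) s1
    rw [e1] at e2
    obtain ⟨s3, e3⟩ := s2.goto (by rw [e2]; exact p3) (by rw [e2]; exact p4)
    obtain ⟨N', s4, e4⟩ := ih2 (by rw [e3]; exact hP) s3
    refine ⟨N' + (2 + (N + 1)), ?_, ?_⟩
    · rwa [Function.iterate_add_apply _ N', Function.iterate_add_apply _ 2,
        Function.iterate_succ_apply]
    · rw [Function.iterate_add_apply _ N', Function.iterate_add_apply _ 2,
        Function.iterate_succ_apply _ N, e4, e3]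

/-- The initial state. -/
def Cfg.init : Cfg := ⟨fun _ => 0, fun _ => 0, 0, []⟩

/-- A structured program that terminates within its limits yields an enumeration. -/
theorem Exec.enumerates {E : Env} (hE : E.Valid) {c : Stmt} {σ : Cfg} (h : Exec E c Cfg.init σ)
    {S : Set (List ℕ)} (hnd : σ.words.Nodup) (hS : ∀ y, y ∈ σ.words ↔ y ∈ S)
    (hgap : σ.gap ≤ if σ.words = [] then E.first else E.later) {p d : ℝ}
    (hp : ((17 * E.first : ℕ) : ℝ) ≤ p) (hd : ((17 * E.later : ℕ) : ℝ) ≤ d) :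
    EnumeratesWithin (c.compile 0) E.x S p d := by
  have h0 : Sim E Cfg.init State.init :=
    ⟨fun _ => rfl, fun _ _ => rfl, rfl, fun _ => Nat.zero_le _, by simp [State.init],
      by simp [State.init], by simp [State.init]⟩
  obtain ⟨N, s1, e1⟩ := h.sound hE (P := c.compile 0) (s := State.init) (List.prefix_refl _) h0
  refine ⟨N, _, rfl, ?_, ?_, ?_, ?_, ?_⟩
  · rw [run, e1, Stmt.length_compile]
    exact Nat.le_add_left _ _
  · rw [run, s1.words]; exact hnd
  · rw [run, s1.words]; exact hS
  · intro t ht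
    refine le_trans ?_ hp
    rw [Nat.cast_le]
    rw [run] at ht
    rcases hl : ((step (c.compile 0) E.x)^[N] State.init).log with _ | ⟨y, ys⟩
    · have h1 := s1.start hl
      have h2 : σ.words = [] := by rw [← s1.words, hl]; rfl
      rw [if_pos h2] at hgap
      simp [hl] at ht
      omega
    · have := s1.head
      simp [hl] at ht this
      omega
  · have key : (((step (c.compile 0) E.x)^[N] State.init).log.map Prod.fst ++
        [((step (c.compile 0) E.x)^[N] State.init).clock]).IsChain
          (fun t t' => t' ≤ t + 17 * E.later) := by
      rw [List.isChain_append]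
      refine ⟨s1.chain, by simp, fun t ht t' ht' => ?_⟩
      have h1 := s1.last t ht
      have h2 : σ.words ≠ [] := by
        rw [← s1.words]
        rintro h0
        simp at h0
        simp [h0] at ht
      rw [if_neg h2] at hgap
      simp at ht'
      omega
    simp only [bind_pure_comp, List.map_eq_map, run]
    refine (List.isChain_map _).2 (key.imp fun t t' htt => ?_)
    calc (t' : ℝ) ≤ ((t + 17 * E.later : ℕ) : ℝ) := Nat.cast_le.2 htt
      _ ≤ t + d := by push_cast at hd ⊢; linarith

/-! ### Weakest preconditions -/

/-- Started in `σ`, the program `c` terminates within its limits, and then `Q` holds. -/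
def wp (E : Env) (c : Stmt) (Q : Cfg → Prop) (σ : Cfg) : Prop := ∃ σ', Exec E c σ σ' ∧ Q σ'

section
variable {E : Env} {Q R : Cfg → Prop} {σ : Cfg}

theorem wp.mono {c : Stmt} (h : wp E c Q σ) (hQR : ∀ σ', Q σ' → R σ') : wp E c R σ :=
  let ⟨σ', h1, h2⟩ := h
  ⟨σ', h1, hQR _ h2⟩

theorem wp_skip (h : Q σ) : wp E .skip Q σ := ⟨_, .skip, h⟩

theorem wp_op {o : Op} (ho : o.Ok E σ) (h : Q (o.next E σ)) : wp E (.op o) Q σ := ⟨_, .op ho, h⟩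

theorem wp_seq {c c' : Stmt} (h : wp E c (wp E c' Q) σ) : wp E (c ;; c') Q σ :=
  let ⟨_, h1, _, h2, h3⟩ := h
  ⟨_, .seq h1 h2, h3⟩

theorem wp_ifz {a : Var} {c c' : Stmt} (h0 : σ.v a = 0 → wp E c Q (σ.wait 1))
    (h1 : σ.v a ≠ 0 → wp E c' (fun σ' => Q (σ'.wait 2)) (σ.wait 1)) : wp E (.ifz a c c') Q σ := by
  by_cases h : σ.v a = 0
  · obtain ⟨_, h2, h3⟩ := h0 h
    exact ⟨_, .ifz_zero h h2, h3⟩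
  · obtain ⟨_, h2, h3⟩ := h1 h
    exact ⟨_, .ifz_pos h h2, h3⟩

theorem wp_loop {a : Var} {c : Stmt} (h0 : σ.v a = 0 → Q (σ.wait 1))
    (h1 : σ.v a ≠ 0 → wp E c (fun σ' => wp E (.loop a c) Q (σ'.wait 2)) (σ.wait 1)) :
    wp E (.loop a c) Q σ := by
  by_cases h : σ.v a = 0
  · exact ⟨_, .loop_zero h, h0 h⟩
  · obtain ⟨_, h2, _, h3, h4⟩ := h1 h
    exact ⟨_, .loop_pos h h2 h3, h4⟩

/-- The rule for loops: `I N` is an invariant, and `N` decreases. -/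
theorem wp_loop_of_invariant {a : Var} {c : Stmt} (I : ℕ → Cfg → Prop)
    (h0 : ∀ N σ, I N σ → σ.v a = 0 → Q (σ.wait 1))
    (h1 : ∀ N σ, I N σ → σ.v a ≠ 0 → ∃ N' < N, wp E c (fun σ' => I N' (σ'.wait 2)) (σ.wait 1))
    {N : ℕ} (h : I N σ) : wp E (.loop a c) Q σ := by
  induction N using Nat.strong_induction_on generalizing σ with
  | _ N ih =>
    refine wp_loop (h0 N σ h) fun ha => ?_
    obtain ⟨N', hN, h2⟩ := h1 N σ h ha
    exact h2.mono fun σ' h3 => ih N' hN h3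

end

/-! ### Loopless Gray code -/

/-- One step of the loopless Gray code with focus pointers: the state consists of the focus pointers
and the current assignment; the bit that is flipped belongs to the variable `ps j`, where `j` is the
first focus pointer. -/
def focusStep (ps : ℕ → ℕ) (s : (ℕ → ℕ) × (ℕ → ℕ)) : (ℕ → ℕ) × (ℕ → ℕ) :=
  let j := s.1 0
  let f := Function.update s.1 0 0
  (Function.update (Function.update f j (f (j + 1))) (j + 1) (j + 1),
    Function.update s.2 (ps j) (1 - s.2 (ps j)))

/-- Behaviour of the focus pointers: the flipped positions follow the ruler sequence, and after
`2 ^ m - 1` steps the first pointer holds what pointer `m` held before. -/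
theorem focus_pointers (ps : ℕ → ℕ) (m : ℕ) (s : (ℕ → ℕ) × (ℕ → ℕ)) (hs : ∀ i < m, s.1 i = i) :
    (((focusStep ps)^[2 ^ m - 1] s).1 0 = s.1 m ∧
      (∀ i, 1 ≤ i → i ≤ m → ((focusStep ps)^[2 ^ m - 1] s).1 i = i) ∧
      ∀ i, m < i → ((focusStep ps)^[2 ^ m - 1] s).1 i = s.1 i) ∧
    ∀ i < 2 ^ m - 1, ((focusStep ps)^[i] s).1 0 < m := by
  induction m generalizing s with
  | zero => exact ⟨⟨rfl, fun i h1 h2 => by omega, fun i _ => rfl⟩, fun i hi => by simp at hi⟩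
  | succ m ih =>
    obtain ⟨⟨h0, h1, h2⟩, h3⟩ := ih s (fun i hi => hs i (by omega))
    have hpos : 0 < 2 ^ m := by positivity
    have hm : s.1 m = m := hs m (by omega)
    set s' := (focusStep ps)^[2 ^ m - 1] s with hs'
    have e : (focusStep ps)^[2 ^ m] s = focusStep ps s' := by
      rw [hs', ← Function.iterate_succ_apply' (focusStep ps)]
      congr 1; omega
    have f0 : s'.1 0 = m := h0.trans hm
    have g : ∀ i, (focusStep ps s').1 i =
        if i = m + 1 then m + 1 else if i = m then s.1 (m + 1) else if i = 0 then 0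
          else s'.1 i := by
      intro i
      simp only [focusStep, f0, Function.update_apply]
      rw [if_neg (show m + 1 ≠ 0 by omega), h2 (m + 1) (by omega)]
    have g0 : ∀ i < m, (focusStep ps s').1 i = i := by
      intro i hi
      rw [g, if_neg (by omega), if_neg (by omega)]
      split_ifs with h
      · exact h.symm
      · exact h1 i (by omega) (by omega)
    obtain ⟨⟨k0, k1, k2⟩, k3⟩ := ih _ g0
    have e2 : (focusStep ps)^[2 ^ (m + 1) - 1] s =
        (focusStep ps)^[2 ^ m - 1] (focusStep ps s') := by
      rw [← e, ← Function.iterate_add_apply]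
      congr 1; rw [pow_succ]; omega
    refine ⟨⟨?_, ?_, ?_⟩, ?_⟩
    · rw [e2, k0, g, if_neg (by omega), if_pos rfl]
    · intro i hi1 hi2
      rw [e2]
      rcases Nat.lt_or_ge m i with h | h
      · rw [k2 i h, g, if_pos (by omega)]; omega
      · exact k1 i hi1 h
    · intro i hi
      rw [e2, k2 i (by omega), g, if_neg (by omega), if_neg (by omega), if_neg (by omega),
        h2 i (by omega)]
    · intro i hi
      rw [pow_succ] at hi
      rcases lt_trichotomy i (2 ^ m - 1) with h | h | h
      · exact (h3 i h).trans (by omega)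
      · rw [h, ← hs', f0]; omega
      · have : (focusStep ps)^[i] s = (focusStep ps)^[i - 2 ^ m] (focusStep ps s') := by
          rw [← e, ← Function.iterate_add_apply]
          congr 1; omega
        rw [this]
        exact (k3 _ (by omega)).trans (by omega)

/-- In `2 ^ m - 1` steps the Gray code visits, without repetition, all assignments that differ from
the initial one only in the first `m` free variables. -/
theorem gray_visits (ps : ℕ → ℕ) (m : ℕ) (hps : ∀ i < m, ∀ j < m, ps i = ps j → i = j)
    (s : (ℕ → ℕ) × (ℕ → ℕ)) (hs : ∀ i < m, s.1 i = i) (hb : ∀ i < m, s.2 (ps i) ≤ 1) :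
    (∀ i < 2 ^ m, (∀ a, (∀ j < m, ps j ≠ a) → ((focusStep ps)^[i] s).2 a = s.2 a) ∧
      ∀ j < m, ((focusStep ps)^[i] s).2 (ps j) ≤ 1) ∧
    (∀ β : ℕ → ℕ, (∀ a, (∀ j < m, ps j ≠ a) → β a = s.2 a) → (∀ j < m, β (ps j) ≤ 1) →
      ∃ i < 2 ^ m, ((focusStep ps)^[i] s).2 = β) ∧
    ∀ i < 2 ^ m, ∀ j < 2 ^ m, ((focusStep ps)^[i] s).2 = ((focusStep ps)^[j] s).2 → i = j := by
  induction m generalizing s with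
  | zero =>
    refine ⟨fun i hi => ?_, fun β h _ => ⟨0, by simp, ?_⟩,
      fun i hi j hj _ => by simp at hi hj; omega⟩
    · have : i = 0 := by simpa using hi
      subst this
      exact ⟨fun _ _ => rfl, fun j hj => by omega⟩
    · funext a
      exact (h a (fun j hj => by omega)).symm
  | succ m ih =>
    have hps' : ∀ i < m, ∀ j < m, ps i = ps j → i = j :=
      fun i hi j hj => hps i (by omega) j (by omega)
    have hne : ∀ j < m, ps j ≠ ps m := fun j hj h => by
      have := hps j (by omega) m (by omega) h
      omega
    have hs0 : ∀ i < m, s.1 i = i := fun i hi => hs i (by omega)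
    obtain ⟨⟨h0, h1, -⟩, -⟩ := focus_pointers ps m s hs0
    obtain ⟨a1, a2, a3⟩ := ih hps' s hs0 (fun i hi => hb i (by omega))
    have hpos : 0 < 2 ^ m := by positivity
    obtain ⟨b1, b2⟩ := a1 (2 ^ m - 1) (by omega)
    set s' := (focusStep ps)^[2 ^ m - 1] s with hs'
    have f0 : s'.1 0 = m := h0.trans (hs m (by omega))
    have e : (focusStep ps)^[2 ^ m] s = focusStep ps s' := by
      rw [hs', ← Function.iterate_succ_apply' (focusStep ps)]
      congr 1; omega
    set s'' := focusStep ps s' with hs''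
    have g0 : ∀ i < m, s''.1 i = i := by
      intro i hi
      rw [hs'']
      simp only [focusStep, f0, Function.update_apply]
      rw [if_neg (by omega), if_neg (by omega)]
      split_ifs with h
      · exact h.symm
      · exact h1 i (by omega) (by omega)
    have g1 : s''.2 = Function.update s'.2 (ps m) (1 - s.2 (ps m)) := by
      rw [hs'']
      simp only [focusStep, f0]
      rw [b1 (ps m) hne]
    have g2 : ∀ i < m, s''.2 (ps i) ≤ 1 := by
      intro i hi
      rw [g1, Function.update_of_ne (hne i hi)]
      exact b2 i hi
    obtain ⟨c1, c2, c3⟩ := ih hps' s'' g0 g2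
    have hm1 : s.2 (ps m) ≤ 1 := hb m (by omega)
    have shift : ∀ i, 2 ^ m ≤ i → (focusStep ps)^[i] s = (focusStep ps)^[i - 2 ^ m] s'' := by
      intro i hi
      rw [← e, ← Function.iterate_add_apply]
      congr 1; omega
    have first : ∀ i < 2 ^ m, ((focusStep ps)^[i] s).2 (ps m) = s.2 (ps m) :=
      fun i hi => (a1 i hi).1 _ hne
    have second : ∀ i < 2 ^ m, ((focusStep ps)^[i] s'').2 (ps m) = 1 - s.2 (ps m) := by
      intro i hi
      rw [(c1 i hi).1 _ hne, g1, Function.update_self]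
    refine ⟨fun i hi => ?_, fun β hβ1 hβ2 => ?_, fun i hi j hj hij => ?_⟩
    · rw [pow_succ] at hi
      rcases Nat.lt_or_ge i (2 ^ m) with h | h
      · refine ⟨fun a ha => (a1 i h).1 a fun j hj => ha j (by omega), fun j hj => ?_⟩
        rcases Nat.lt_or_ge j m with hjm | hjm
        · exact (a1 i h).2 j hjm
        · have : j = m := by omega
          rw [this, first i h]; exact hm1
      · rw [shift i h]
        refine ⟨fun a ha => ?_, fun j hj => ?_⟩
        · rw [(c1 _ (by omega)).1 a fun j hj => ha j (by omega), g1,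
            Function.update_of_ne (ha m (by omega)).symm, b1 a fun j hj => ha j (by omega)]
        · rcases Nat.lt_or_ge j m with hjm | hjm
          · exact (c1 _ (by omega)).2 j hjm
          · have : j = m := by omega
            rw [this, second _ (by omega)]; omega
    · by_cases h : β (ps m) = s.2 (ps m)
      · obtain ⟨i, hi, h2⟩ := a2 β (fun a ha => by
          by_cases ham : ps m = a
          · rw [← ham, h]
          · refine hβ1 a fun j hj => ?_
            rcases Nat.lt_or_ge j m with hjm | hjm
            · exact ha j hjm
            · have : j = m := by omega
              rwa [this]) (fun j hj => hβ2 j (by omega))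
        exact ⟨i, by rw [pow_succ]; omega, h2⟩
      · obtain ⟨i, hi, h2⟩ := c2 β (fun a ha => by
          rw [g1]
          by_cases ham : ps m = a
          · have := hβ2 m (by omega)
            rw [← ham, Function.update_self]; omega
          · rw [Function.update_of_ne (Ne.symm ham), b1 a ha]
            refine hβ1 a fun j hj => ?_
            rcases Nat.lt_or_ge j m with hjm | hjm
            · exact ha j hjm
            · have : j = m := by omega
              rwa [this]) (fun j hj => hβ2 j (by omega))
        refine ⟨i + 2 ^ m, by rw [pow_succ]; omega, ?_⟩
        rw [shift _ (by omega), Nat.add_sub_cancel, h2]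
    · rw [pow_succ] at hi hj
      have key := congrFun hij (ps m)
      rcases Nat.lt_or_ge i (2 ^ m) with h | h <;> rcases Nat.lt_or_ge j (2 ^ m) with h' | h'
      · exact a3 i h j h' hij
      · rw [first i h, shift j h', second _ (by omega)] at key; omega
      · rw [first j h', shift i h, second _ (by omega)] at key; omega
      · rw [shift i h, shift j h'] at hij
        have := c3 _ (by omega) _ (by omega) hij
        omega

/-! ### Terms as lists of numbers, and their restrictions -/

/-- A term as the machine sees it: the list of the variables and signs of its literals. -/
abbrev Tm := List (ℕ × ℕ)

/-- The literals have variables in `[a, a + m)`, in ascending order, and signs `0` or `1`. -/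
def IsTm (a m : ℕ) (l : Tm) : Prop :=
  l.Pairwise (fun x y => x.1 < y.1) ∧ ∀ x ∈ l, a ≤ x.1 ∧ x.1 < a + m ∧ x.2 ≤ 1

/-- What remains of a term (`none` if it is falsified) when the variable `d`, which precedes all
others, gets the value `b`. -/
def restrict (d b : ℕ) : Option Tm → Option Tm
  | none => none
  | some [] => some []
  | some (x :: l) => if x.1 = d then (if x.2 = b then some l else none) else some (x :: l)

open Classical in
/-- What remains of the term `l` (`none` if it is falsified) when the first variables get the values
in `p`. -/
noncomputable def restrictAll (p : List ℕ) (l : Tm) : Option Tm :=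
  if ∀ x ∈ l, x.1 < p.length → p.getD x.1 0 = x.2 then
    some (l.filter fun x => p.length ≤ x.1) else none

theorem restrictAll_nil (l : Tm) : restrictAll [] l = some l := by
  simp [restrictAll]

/-- Terms can be restricted variable by variable. -/
theorem restrictAll_concat {n : ℕ} {l : Tm} (hl : IsTm 0 n l) (p : List ℕ) (b : ℕ) :
    restrictAll (p ++ [b]) l = restrict p.length b (restrictAll p l) := by
  classical
  have key : (∀ x ∈ l, x.1 < (p ++ [b]).length → (p ++ [b]).getD x.1 0 = x.2) ↔
      (∀ x ∈ l, x.1 < p.length → p.getD x.1 0 = x.2) ∧ ∀ x ∈ l, x.1 = p.length → b = x.2 := by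
    constructor
    · intro h
      refine ⟨fun x hx hlt => ?_, fun x hx he => ?_⟩
      · have := h x hx (by simp; omega)
        rwa [List.getD_append _ _ _ _ hlt] at this
      · have := h x hx (by simp; omega)
        rw [he] at this
        simpa [List.getD_append_right] using this
    · rintro ⟨h1, h2⟩ x hx hlt
      simp only [List.length_append, List.length_singleton] at hlt
      rcases Nat.lt_succ_iff_lt_or_eq.1 hlt with h | h
      · rw [List.getD_append _ _ _ _ h]; exact h1 x hx h
      · rw [h]
        simpa [List.getD_append_right] using h2 x hx h
  unfold restrictAll
  by_cases h1 : ∀ x ∈ l, x.1 < p.length → p.getD x.1 0 = x.2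
  · rw [if_pos h1]
    have hsort : (l.filter fun x => p.length ≤ x.1).Pairwise (fun x y => x.1 < y.1) :=
      hl.1.sublist List.filter_sublist
    have hmem : ∀ x, x ∈ (l.filter fun x => p.length ≤ x.1) ↔ x ∈ l ∧ p.length ≤ x.1 := by
      simp
    have hff : (l.filter fun x => (p ++ [b]).length ≤ x.1) =
        (l.filter fun x => p.length ≤ x.1).filter fun x => p.length + 1 ≤ x.1 := by
      rw [List.filter_filter]
      refine List.filter_congr fun x _ => ?_
      simp; omega
    rw [hff]
    rcases hf : l.filter fun x => p.length ≤ x.1 with _ | ⟨y, r⟩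
    · rw [hf] at hmem
      have : ∀ x ∈ l, x.1 = p.length → b = x.2 := fun x hx he =>
        absurd ((hmem x).2 ⟨hx, he.ge⟩) (by simp)
      rw [if_pos (key.2 ⟨h1, this⟩), hf]
      rfl
    · rw [hf] at hmem hsort
      obtain ⟨hy1, hy2⟩ := (hmem y).1 (by simp)
      have hr : ∀ x ∈ r, p.length + 1 ≤ x.1 := fun x hx => by
        have := (List.pairwise_cons.1 hsort).1 x hx
        omega
      have hr' : (r.filter fun x => p.length + 1 ≤ x.1) = r :=
        List.filter_eq_self.2 fun x hx => by simpa using hr x hx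
      rw [hf]
      simp only [restrict]
      by_cases hyd : y.1 = p.length
      · rw [if_pos hyd, List.filter_cons_of_neg (by simp; omega), hr']
        by_cases hyb : y.2 = b
        · rw [if_pos hyb, if_pos]
          refine key.2 ⟨h1, fun x hx he => ?_⟩
          have := (hmem x).2 ⟨hx, he.ge⟩
          rcases List.mem_cons.1 this with rfl | h
          · exact hyb.symm
          · have := hr x h; omega
        · rw [if_neg hyb, if_neg]
          exact fun h => hyb ((key.1 h).2 y hy1 hyd).symm
      · rw [if_neg hyd, if_pos, List.filter_cons_of_pos (by simp; omega), hr']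
        refine key.2 ⟨h1, fun x hx he => ?_⟩
        have := (hmem x).2 ⟨hx, he.ge⟩
        rcases List.mem_cons.1 this with rfl | h
        · exact absurd he hyd
        · have := hr x h; omega
  · rw [if_neg h1, if_neg fun h => h1 (key.1 h).1]
    rfl

/-- As the literals are in ascending order, a suffix of the term is left. Hence the nodes of the
trie of suffixes represent all restricted terms. -/
theorem restrictAll_suffix {n : ℕ} {l r : Tm} (hl : IsTm 0 n l) {p : List ℕ}
    (h : restrictAll p l = some r) : r <:+ l ∧ IsTm p.length (n - p.length) r := by
  classical
  unfold restrictAll at h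
  split_ifs at h with h1
  obtain rfl := Option.some.inj h
  constructor
  · have hs := hl.1
    clear hl h1 h
    induction l with
    | nil => simp
    | cons x l ih =>
      rw [List.pairwise_cons] at hs
      by_cases hx : p.length ≤ x.1
      · rw [List.filter_eq_self.2]
        intro y hy
        rcases List.mem_cons.1 hy with rfl | hy
        · simpa using hx
        · have := hs.1 y hy
          simp; omega
      · rw [List.filter_cons_of_neg (by simpa using hx)]
        exact (ih hs.2).trans (List.suffix_cons _ _)
  · refine ⟨hl.1.sublist List.filter_sublist, fun x hx => ?_⟩
    rw [List.mem_filter] at hx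
    have := hl.2 x hx.1
    have h2 : p.length ≤ x.1 := by simpa using hx.2
    omega

/-- A full assignment leaves of a term the empty term or nothing, and satisfies it in the first
case. -/
theorem restrictAll_full {n : ℕ} {l : Tm} (hl : IsTm 0 n l) {p : List ℕ} (hp : p.length = n) :
    ((∀ x ∈ l, p.getD x.1 0 = x.2) ∧ restrictAll p l = some []) ∨
      (¬ (∀ x ∈ l, p.getD x.1 0 = x.2) ∧ restrictAll p l = none) := by
  classical
  have h0 : (∀ x ∈ l, x.1 < p.length → p.getD x.1 0 = x.2) ↔ ∀ x ∈ l, p.getD x.1 0 = x.2 :=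
    forall₂_congr fun x hx => by
      have := hl.2 x hx
      exact ⟨fun h => h (by omega), fun h _ => h⟩
  by_cases h : ∀ x ∈ l, p.getD x.1 0 = x.2
  · refine .inl ⟨h, ?_⟩
    rw [restrictAll, if_pos (h0.2 h), List.filter_eq_nil_iff.2]
    intro x hx
    have := hl.2 x hx
    simp; omega
  · refine .inr ⟨h, ?_⟩
    rw [restrictAll, if_neg (h0.not.2 h)]

/-! ### Counting terms -/

/-- All terms with at most `k` literals over the variables `[a, a + m)`. -/
def allTm : ℕ → ℕ → ℕ → List Tm
  | _, 0, _ => [[]]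
  | _, _ + 1, 0 => [[]]
  | a, m + 1, k + 1 => allTm (a + 1) m (k + 1) ++
      ((allTm (a + 1) m k).map ((a, 0) :: ·) ++ (allTm (a + 1) m k).map ((a, 1) :: ·))

/-- The number of terms with at most `k` literals over `m` variables. -/
def numTm : ℕ → ℕ → ℕ
  | 0, _ => 1
  | _ + 1, 0 => 1
  | m + 1, k + 1 => numTm m (k + 1) + 2 * numTm m k

theorem length_allTm (a m k : ℕ) : (allTm a m k).length = numTm m k := by
  induction m generalizing a k with
  | zero => rfl
  | succ m ih =>
    cases k with
    | zero => rfl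
    | succ k => simp [allTm, numTm, ih]; omega

theorem mem_allTm {a m k : ℕ} {l : Tm} (hl : IsTm a m l) (hk : l.length ≤ k) : l ∈ allTm a m k := by
  induction m generalizing a k l with
  | zero =>
    rcases l with _ | ⟨x, l⟩
    · simp [allTm]
    · have := hl.2 x (by simp); omega
  | succ m ih =>
    have low : ∀ l : Tm, l.Pairwise (fun x y => x.1 < y.1) →
        (∀ x ∈ l, a + 1 ≤ x.1 ∧ x.1 < a + (m + 1) ∧ x.2 ≤ 1) → IsTm (a + 1) m l :=
      fun l h1 h2 => ⟨h1, fun x hx => by have := h2 x hx; omega⟩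
    rcases l with _ | ⟨⟨v, s⟩, l⟩
    · cases k with
      | zero => simp [allTm]
      | succ k =>
        simp only [allTm, List.mem_append]
        exact .inl (ih (low [] (by simp) (by simp)) (by simp))
    · cases k with
      | zero => simp at hk
      | succ k =>
        simp only [List.length_cons] at hk
        obtain ⟨h1, h2⟩ := hl
        rw [List.pairwise_cons] at h1
        have hv := h2 (v, s) (by simp)
        have htail : ∀ x ∈ l, a + 1 ≤ x.1 ∧ x.1 < a + (m + 1) ∧ x.2 ≤ 1 := fun x hx => by
          have e1 := h1.1 x hx
          have e2 := h2 x (List.mem_cons_of_mem _ hx)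
          simp only at e1 hv
          omega
        simp only [allTm, List.mem_append, List.mem_map]
        simp only at hv
        by_cases hva : v = a
        · subst hva
          have := ih (low l h1.2 htail) (k := k) (by omega)
          rcases Nat.le_one_iff_eq_zero_or_eq_one.1 hv.2.2 with rfl | rfl
          · exact .inr (.inl ⟨l, this, rfl⟩)
          · exact .inr (.inr ⟨l, this, rfl⟩)
        · refine .inl (ih (low _ (List.pairwise_cons.2 h1) fun x hx => ?_) (by simpa using hk))
          rcases List.mem_cons.1 hx with rfl | hx
          · simp only; omega
          · exact htail x hx

/-- Weighting each term by `2 ^ (-length)`, the terms over `m` variables weigh at most `2 ^ m`. -/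
theorem sum_weight_allTm (a m k : ℕ) :
    ((allTm a m k).map fun l => (1 / 2 : ℚ) ^ l.length).sum ≤ 2 ^ m := by
  induction m generalizing a k with
  | zero => simp [allTm]
  | succ m ih =>
    cases k with
    | zero => simp [allTm]; exact one_le_pow₀ (by norm_num)
    | succ k =>
      have h : ∀ s : ℕ, ((allTm (a + 1) m k).map
          ((fun l : Tm => (1 / 2 : ℚ) ^ l.length) ∘ ((a, s) :: ·))).sum =
            ((allTm (a + 1) m k).map fun l => (1 / 2 : ℚ) ^ l.length).sum / 2 := by
        intro s
        have e : (fun l : Tm => (1 / 2 : ℚ) ^ l.length) ∘ ((a, s) :: ·) =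
            fun l => (1 / 2 : ℚ) ^ l.length * (1 / 2) := funext fun l => pow_succ _ _
        rw [e, List.sum_map_mul_right]
        ring
      simp only [allTm, List.map_append, List.map_map, List.sum_append, h]
      have h1 := ih (a + 1) (k + 1)
      have h2 := ih (a + 1) k
      rw [pow_succ]
      linarith

/-- The same for an arbitrary set of terms: this bounds the cost of reading a formula. -/
theorem sum_weight_le {n : ℕ} {L : List Tm} (hL : L.Nodup) (h : ∀ l ∈ L, IsTm 0 n l) :
    (L.map fun l => (1 / 2 : ℚ) ^ l.length).sum ≤ 2 ^ n := by
  classical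
  obtain ⟨K, hK⟩ : ∃ K, ∀ l ∈ L, l.length ≤ K :=
    ⟨(L.map List.length).sum, fun l hl => List.single_le_sum (by simp) _ (List.mem_map_of_mem hl)⟩
  obtain ⟨L', hp, hs⟩ : L.Subperm (allTm 0 n K) := hL.subperm fun l hl => mem_allTm
    (h l hl) (hK l hl)
  calc (L.map fun l => (1 / 2 : ℚ) ^ l.length).sum
      = (L'.map fun l => (1 / 2 : ℚ) ^ l.length).sum := (hp.map _).sum_eq.symm
    _ ≤ ((allTm 0 n K).map fun l => (1 / 2 : ℚ) ^ l.length).sum :=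
        (hs.map _).sum_le_sum (fun x hx => by
          obtain ⟨l, -, rfl⟩ := List.mem_map.1 hx
          positivity)
    _ ≤ 2 ^ n := sum_weight_allTm _ _ _

theorem length_le_numTm {a m k : ℕ} {L : List (Option Tm)} (hL : L.Nodup)
    (h : ∀ l, some l ∈ L → IsTm a m l ∧ l.length ≤ k) : L.length ≤ numTm m k + 1 := by
  classical
  have : L.Subperm (none :: (allTm a m k).map some) := hL.subperm fun o ho => by
    cases o with
    | none => simp
    | some l => simp [mem_allTm (h l ho).1 (h l ho).2]
  simpa [length_allTm] using this.length_le

/-- The sum of the numbers of terms over all nodes of a binary tree of height `m`, where a node of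
height `i` is charged the terms over `i` variables. -/
def treeTm : ℕ → ℕ → ℕ
  | 0, _ => 1
  | m + 1, k => numTm (m + 1) k + 2 * treeTm m k

theorem treeTm_succ_succ (m k : ℕ) :
    treeTm (m + 1) (k + 1) = treeTm m (k + 1) + 2 * treeTm m k + 2 ^ (m + 1) := by
  induction m with
  | zero => simp [treeTm, numTm]
  | succ m ih =>
    have h1 : treeTm (m + 1 + 1) (k + 1) = numTm (m + 1 + 1) (k + 1) + 2 * treeTm (m + 1) (k + 1) :=
      rfl
    have h2 : treeTm (m + 1) (k + 1) = numTm (m + 1) (k + 1) + 2 * treeTm m (k + 1) := rfl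
    have h3 : treeTm (m + 1) k = numTm (m + 1) k + 2 * treeTm m k := rfl
    have h4 : numTm (m + 1 + 1) (k + 1) = numTm (m + 1) (k + 1) + 2 * numTm (m + 1) k := rfl
    rw [h1, h4, h3, pow_succ]
    omega

/-- The summand `2 ^ (m + 1)` makes the induction work; it also pays for the falsified term in each
list. -/
theorem treeTm_le (m k : ℕ) : treeTm m k + 2 ^ (m + 1) ≤ 2 ^ (m + k + 2) := by
  induction k generalizing m with
  | zero =>
    induction m with
    | zero => simp [treeTm]
    | succ m ih =>
      have h : treeTm (m + 1) 0 = 1 + 2 * treeTm m 0 := rfl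
      have : 0 < 2 ^ m := by positivity
      rw [h]
      simp only [pow_succ, add_zero] at ih ⊢
      suffices treeTm m 0 + 1 ≤ 2 * 2 ^ m by omega
      clear ih h
      induction m with
      | zero => simp [treeTm]
      | succ m ih =>
        have h : treeTm (m + 1) 0 = 1 + 2 * treeTm m 0 := rfl
        have := ih (by positivity)
        rw [h, pow_succ]
        omega
  | succ k ih =>
    cases m with
    | zero =>
      have : 0 < 2 ^ k := by positivity
      simp only [treeTm, pow_succ, pow_zero, zero_add]
      omega
    | succ m =>
      have h1 := treeTm_succ_succ m k
      have h2 : treeTm (m + 1) (k + 1) = numTm (m + 1) (k + 1) + 2 * treeTm m (k + 1) := rfl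
      have h3 := ih m
      have e : 2 ^ (m + 1 + (k + 1) + 2) = 4 * 2 ^ (m + k + 2) := by ring
      have e2 : 2 ^ (m + 1 + 1) = 2 * 2 ^ (m + 1) := by ring
      omega

/-- A bound for the number of list elements inspected below a node of the search tree with `m + 1`
unassigned variables, when one value of the next variable is explored. -/
def work (k : ℕ) : ℕ → ℕ
  | 0 => numTm 1 k + 1
  | m + 1 => numTm (m + 2) k + 1 + 2 * work k m

theorem work_le (k m : ℕ) : work k m ≤ 2 ^ (m + k + 3) := by
  have h : work k m + 1 ≤ treeTm (m + 1) k + 2 ^ (m + 1) := by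
    induction m with
    | zero => simp [work, treeTm]
    | succ m ih =>
      have h : treeTm (m + 1 + 1) k = numTm (m + 2) k + 2 * treeTm (m + 1) k := rfl
      rw [h, work, pow_succ]
      omega
  have h1 := treeTm_le (m + 1) k
  have e : m + 1 + k + 2 = m + k + 3 := by ring
  have e2 : 2 ^ (m + 1 + 1) = 2 * 2 ^ (m + 1) := by ring
  rw [e] at h1
  omega

/-! ### The leaves of the search tree -/

/-- All extensions of the word `p` by `m` bits, in lexicographic order. -/
def leaves (p : List ℕ) : ℕ → List (List ℕ)
  | 0 => [p]
  | m + 1 => leaves (p ++ [0]) m ++ leaves (p ++ [1]) m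

theorem mem_leaves {p q : List ℕ} {m : ℕ} :
    q ∈ leaves p m ↔ ∃ r : List ℕ, r.length = m ∧ (∀ b ∈ r, b ≤ 1) ∧ q = p ++ r := by
  induction m generalizing p with
  | zero => simp [leaves]
  | succ m ih =>
    simp only [leaves, List.mem_append, ih]
    constructor
    · rintro (⟨r, h1, h2, rfl⟩ | ⟨r, h1, h2, rfl⟩)
      · exact ⟨0 :: r, by simp [h1], by simpa using h2, by simp⟩
      · exact ⟨1 :: r, by simp [h1], by simpa using h2, by simp⟩
    · rintro ⟨r, h1, h2, rfl⟩
      rcases r with _ | ⟨b, r⟩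
      · simp at h1
      · simp only [List.mem_cons, forall_eq_or_imp] at h2
        simp only [List.length_cons, Nat.add_right_cancel_iff] at h1
        rcases Nat.le_one_iff_eq_zero_or_eq_one.1 h2.1 with rfl | rfl
        · exact .inl ⟨r, h1, h2.2, by simp⟩
        · exact .inr ⟨r, h1, h2.2, by simp⟩

theorem nodup_leaves (p : List ℕ) (m : ℕ) : (leaves p m).Nodup := by
  induction m generalizing p with
  | zero => simp [leaves]
  | succ m ih =>
    refine (ih _).append (ih _) fun q h0 h1 => ?_
    obtain ⟨r, -, -, rfl⟩ := mem_leaves.1 h0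
    obtain ⟨r', -, -, h⟩ := mem_leaves.1 h1
    simp at h

/-! ### The program -/

namespace Prog
open Stmt

/-- One step of the Gray code, whose first focus pointer is in `tj`, and output of the new word. -/
def grayStep : Stmt :=
  store .fo .zero ;; add .ta .fo .tj ;; add .tb .ta .one ;; load .tt .tb ;; store .ta .tt ;;
  add .tt .tj .one ;; store .tb .tt ;; add .ta .ps .tj ;; load .tv .ta ;; add .ta .va .tv ;;
  load .ty .ta ;; sub .ty .one .ty ;; store .ta .ty ;; output .va .ve

/-- Count one unit of work of the search; if the budget is used up and the Gray code has not come to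
its end, output its next word. -/
def tick : Stmt :=
  wideAdd .cnt .cnt .one ;; wideSub .tt .bud .cnt ;;
  ifz .tt
    (load .tj .fo ;; sub .tt .nf .tj ;; ifz .tt skip (grayStep ;; const .cnt 0))
    skip

/-- Place the tables in the memory, behind each other. -/
def layout : Stmt :=
  const .va 64 ;; add .ps .va .n ;; add .fo .ps .n ;; add .vb .fo .n ;; add .vb .vb .one ;;
  add .st .vb .n ;; add .bs .st .n ;; add .be .bs .n ;; add .be .be .one ;; add .be .be .one ;;
  add .l0 .be .n ;; add .l0 .l0 .one ;; add .dead .l0 .rem ;; const .t 4 ;; add .sz .n .n ;;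
  add .sz .sz .t ;; add .root .dead .sz ;; add .hp .root .sz ;; sub .ve .ps .one ;;
  sub .vbe .st .one

/-- Enter the literals of the first term into the assignment of the Gray code, and flag their
variables. -/
def readFirst : Stmt :=
  const .t 2 ;; input .tl .t ;; const .q 3 ;; add .j .tl .zero ;;
  loop .j
    (input .var .q ;; add .q .q .one ;; input .s .q ;; add .q .q .one ;; add .a .va .var ;;
     store .a .s ;; add .a .vb .var ;; store .a .one ;; sub .j .j .one)

/-- List the variables that are not flagged, and initialize the focus pointers. -/
def initGray : Stmt :=
  const .nf 0 ;; const .i 0 ;; add .e .n .zero ;;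
  loop .e
    (add .a .vb .i ;; load .t .a ;;
     ifz .t
       (add .a .ps .nf ;; store .a .i ;; add .a .fo .nf ;; store .a .nf ;; add .nf .nf .one)
       skip ;;
     add .i .i .one ;; sub .e .e .one) ;;
  add .a .fo .nf ;; store .a .nf

/-- The budget starts with `16 * 2 ^ t`, where `t` is the length of the first term. -/
def initBudget : Stmt :=
  const .bud 16 ;; const .rm 0 ;; const .cnt 0 ;; add .j .tl .zero ;;
  loop .j (wideAdd .bud .bud .bud ;; sub .j .j .one)

/-- Move from the node `u` of the trie to its child for the literal at input position `q`, which is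
created if necessary. A node consists of its variable, its successors for the two values of the
variable, the position of its last occurrence in a list, and a table of its children. -/
def descend : Stmt :=
  input .s .q ;; sub .q .q .one ;; input .var .q ;; sub .q .q .one ;;
  const .t 4 ;; add .a .u .t ;; add .a .a .var ;; add .a .a .var ;; add .a .a .s ;; load .y .a ;;
  ifz .y
    (add .y .hp .zero ;; add .hp .hp .sz ;; store .a .y ;; store .y .var ;;
     add .a .y .one ;; add .a .a .s ;; store .a .u ;;
     const .t 2 ;; add .a .y .t ;; sub .a .a .s ;; store .a .dead)
    skip ;;
  add .u .y .zero ;; sub .j .j .one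

/-- Read one term, raise the budget if it is longer than all terms before, and append its node to
the list of terms. -/
def readTerm : Stmt :=
  input .len .ip ;; add .q .ip .len ;; add .q .q .len ;; add .ip .q .one ;; add .j .len .zero ;;
  add .u .root .zero ;; loop .j descend ;;
  sub .t .len .rm ;;
  loop .t (add .rm .rm .one ;; wideAdd .bud .bud .bud ;; sub .t .t .one) ;;
  store .lp .u ;; add .lp .lp .one ;; sub .rem .rem .one ;; tick

/-- Read all terms; the trie initially consists of the two nodes without variable. -/
def readTerms : Stmt :=
  store .dead .n ;; store .root .n ;; const .ip 2 ;; add .lp .l0 .zero ;; loop .rem readTerm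

/-- Restrict the list element at position `i` by the value `b` of the variable `d`. -/
def restrictNode : Stmt :=
  load .u .i ;; load .var .u ;; sub .t .var .d ;; sub .t1 .d .var ;; add .t .t .t1 ;;
  ifz .t (add .a .u .one ;; add .a .a .b ;; load .u .a) skip

/-- Set `y` to zero if the node `u` occurs in the list that starts at `nb` and ends before `top`.
The node holds the position `p` of its last occurrence in any list, which is trusted only if it lies
in the current list and `u` is found there. -/
def checkMark : Stmt :=
  const .t 3 ;; add .a .u .t ;; load .p .a ;; const .y 1 ;; sub .t .top .p ;;
  ifz .t skip
    (sub .t .nb .p ;;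
     ifz .t
       (load .q .p ;; sub .t .q .u ;; sub .t1 .u .q ;; add .t .t .t1 ;;
        ifz .t (const .y 0) skip)
       skip)

/-- Process one element of the list of terms. -/
def restrictElement : Stmt :=
  restrictNode ;; checkMark ;;
  ifz .y skip (store .top .u ;; store .a .top ;; add .top .top .one) ;;
  add .i .i .one ;; sub .e .hi .i ;; tick

/-- Assign the value `b` to the variable `d`, and compute the list of the restricted terms. -/
def restrictList : Stmt :=
  add .a .vb .d ;; store .a .b ;; add .a .bs .d ;; load .lo .a ;; add .a .a .one ;; load .nb .a ;;
  add .a .be .d ;; load .hi .a ;; add .top .nb .zero ;; add .i .lo .zero ;; sub .e .hi .i ;;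
  loop .e restrictElement ;;
  add .d .d .one ;; add .a .be .d ;; store .a .top ;; add .a .bs .d ;; add .a .a .one ;;
  store .a .top

/-- At a leaf: output the assignment if it falsifies the first term and satisfies another one; then
take the next task from the stack. -/
def leaf : Stmt :=
  load .u .nb ;; sub .t .u .dead ;;
  ifz .t
    (sub .t .top .nb ;; sub .t .t .one ;; ifz .t skip (output .vb .vbe))
    skip ;;
  ifz .sp (const .go 0)
    (sub .sp .sp .one ;; add .a .st .sp ;; load .d .a ;; const .b 1)

/-- The depth-first search through all assignments; the stack holds the variables for which the
value `1` is still to be explored. -/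
def search : Stmt :=
  store .bs .l0 ;; store .be .lp ;; add .a .bs .one ;; store .a .hp ;; const .d 0 ;; const .b 0 ;;
  store .st .zero ;; const .sp 1 ;; add .go .n .zero ;;
  loop .go
    (restrictList ;; sub .t .n .d ;;
     ifz .t leaf (add .a .st .sp ;; store .a .d ;; add .sp .sp .one ;; const .b 0))

/-- Output the remaining words of the Gray code. -/
def finish : Stmt :=
  load .tj .fo ;; sub .tt .nf .tj ;; loop .tt (grayStep ;; load .tj .fo ;; sub .tt .nf .tj)

/-- The whole program. -/
def main : Stmt :=
  const .one 1 ;; const .t 0 ;; input .n .t ;; input .rem .one ;;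
  ifz .rem skip
    (layout ;; readFirst ;; initGray ;; output .va .ve ;;
     initBudget ;; readTerms ;; search ;; finish)

end Prog

theorem wp_seq_iff {E : Env} {Q : Cfg → Prop} {σ : Cfg} {c c' : Stmt} :
    wp E (c ;; c') Q σ ↔ wp E c (wp E c' Q) σ :=
  ⟨fun ⟨_, h, h'⟩ => by cases h with | seq h1 h2 => exact ⟨_, h1, _, h2, h'⟩, wp_seq⟩

theorem wp_op_iff {E : Env} {Q : Cfg → Prop} {σ : Cfg} {o : Op} :
    wp E (.op o) Q σ ↔ o.Ok E σ ∧ Q (o.next E σ) :=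
  ⟨fun ⟨_, h, h'⟩ => by cases h with | op h1 => exact ⟨h1, h'⟩, fun h => wp_op h.1 h.2⟩

theorem wp_skip_iff {E : Env} {Q : Cfg → Prop} {σ : Cfg} : wp E .skip Q σ ↔ Q σ :=
  ⟨fun ⟨_, h, h'⟩ => by cases h with | skip => exact h', wp_skip⟩

theorem wp_ifz_iff {E : Env} {Q : Cfg → Prop} {σ : Cfg} {a : Var} {c c' : Stmt} :
    wp E (.ifz a c c') Q σ ↔ (σ.v a = 0 → wp E c Q (σ.wait 1)) ∧
      (σ.v a ≠ 0 → wp E c' (fun σ' => Q (σ'.wait 2)) (σ.wait 1)) :=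
  ⟨fun ⟨_, h, h'⟩ => by
    cases h with
    | ifz_zero h0 h1 => exact ⟨fun _ => ⟨_, h1, h'⟩, fun hn => absurd h0 hn⟩
    | ifz_pos h0 h1 => exact ⟨fun hz => absurd hz h0, fun _ => ⟨_, h1, h'⟩⟩,
   fun h => wp_ifz h.1 h.2⟩

/-! ### The setting -/

/-- The list of numbers that presents a term. -/
def encTm (l : Tm) : List ℕ := l.length :: l.flatMap fun x => [x.1, x.2]

/-- A nonempty formula, as a list `T :: F'` of terms over `n` variables, and the maximal length `K`
of a term. -/
structure Ctx where
  n : ℕ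
  T : Tm
  F' : List Tm
  K : ℕ
  isTm : ∀ l ∈ T :: F', IsTm 0 n l
  nodup : (T :: F').Nodup
  length_le : ∀ l ∈ T :: F', l.length ≤ K

namespace Ctx
variable (C : Ctx)

/-- All terms. -/
def F : List Tm := C.T :: C.F'

/-- The input. -/
def x : List ℕ := C.n :: C.F.length :: C.F.flatMap encTm

/-- A bound for the number of nodes of the trie. -/
def nodes : ℕ := (C.F.map List.length).sum + 1

/-- The address of the node that stands for falsified terms. -/
def dead : ℕ := 68 + 7 * C.n + C.F.length

/-- The size of a node. -/
def sz : ℕ := 2 * C.n + 4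

/-- A bound for the addresses that are used. -/
def bound : ℕ := C.dead + C.sz * (C.nodes + 2) + (C.n + 2) * (C.nodes + 2)

/-- The final budget for the work between two words of the Gray code. -/
def maxBud : ℕ := 16 * 2 ^ (C.T.length + C.K)

/-- The time that one unit of work may take; the constant is generous. -/
def G : ℕ := 200 * (C.K + 1)

/-- The limits for the computation. Narrow operands have at most `8` machine words; wide ones are
the budget and the counter of the work, of `O(K)` bits. -/
def E : Env where
  x := C.x
  narrow := 2 ^ (8 * wordLength C.x)
  wide := 4 * C.maxBud
  wideCost := C.K + 1
  first := 200 * (C.n + 1)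
  later := C.G * (C.maxBud + 2 * C.K + 10)

/-- The variables that do not occur in the first term. -/
def free : List ℕ := (List.range C.n).filter fun i => i ∉ C.T.map Prod.fst

/-- The number of free variables. -/
def nf : ℕ := C.free.length

/-- The free variable with index `j`. -/
def ps (j : ℕ) : ℕ := C.free.getD j 0

/-- The initial state of the Gray code. -/
def s₀ : (ℕ → ℕ) × (ℕ → ℕ) := (fun i => i, fun i => if (i, 1) ∈ C.T then 1 else 0)

/-- The state of the Gray code after `i` steps. -/
def gray (i : ℕ) : (ℕ → ℕ) × (ℕ → ℕ) := (focusStep C.ps)^[i] C.s₀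

/-- The output word for an assignment. -/
def word (α : ℕ → ℕ) : List ℕ := (List.range C.n).map α

end Ctx

/-- The registers that are constant after the precomputation. The memory consists of the assignment
of the Gray code (`n` cells), the list of free variables (`n`), the focus pointers (`n + 1`), the
assignment of the search (`n`), the stack (`n`), the beginnings (`n + 2`) and the ends (`n + 1`) of
the lists, the list of all terms, the nodes, and the other lists. -/
structure Lay (C : Ctx) (v : Var → ℕ) : Prop where
  zero : v .zero = 0
  one : v .one = 1
  n : v .n = C.n
  va : v .va = 64
  ve : v .ve = 63 + C.n
  ps : v .ps = 64 + C.n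
  fo : v .fo = 64 + 2 * C.n
  vb : v .vb = 65 + 3 * C.n
  vbe : v .vbe = 64 + 4 * C.n
  st : v .st = 65 + 4 * C.n
  bs : v .bs = 65 + 5 * C.n
  be : v .be = 67 + 6 * C.n
  l0 : v .l0 = 68 + 7 * C.n
  dead : v .dead = C.dead
  sz : v .sz = C.sz
  root : v .root = C.dead + C.sz
  tl : v .tl = C.T.length
  nf : v .nf = C.nf

/-- The registers mentioned in `Lay`. -/
def layVars : List Var := [.zero, .one, .n, .va, .ve, .ps, .fo, .vb, .vbe, .st, .bs, .be, .l0,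
  .dead, .sz, .root, .tl, .nf]

theorem Lay.of_eq {C : Ctx} {v v' : Var → ℕ} (h : Lay C v) (hv : ∀ a ∈ layVars, v' a = v a) :
    Lay C v' := by
  simp only [layVars, List.forall_mem_cons, List.not_mem_nil, false_imp_iff, implies_true] at hv
  obtain ⟨h1, h2, h3, h4, h5, h6, h7, h8, h9, h10, h11, h12, h13, h14, h15, h16, h17, h18, -⟩ := hv
  constructor
  · rw [h1, h.zero]
  · rw [h2, h.one]
  · rw [h3, h.n]
  · rw [h4, h.va]
  · rw [h5, h.ve]
  · rw [h6, h.ps]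
  · rw [h7, h.fo]
  · rw [h8, h.vb]
  · rw [h9, h.vbe]
  · rw [h10, h.st]
  · rw [h11, h.bs]
  · rw [h12, h.be]
  · rw [h13, h.l0]
  · rw [h14, h.dead]
  · rw [h15, h.sz]
  · rw [h16, h.root]
  · rw [h17, h.tl]
  · rw [h18, h.nf]

/-- The memory holds the state `s` of the Gray code. -/
structure GrayMem (C : Ctx) (s : (ℕ → ℕ) × (ℕ → ℕ)) (m : ℕ → ℕ) : Prop where
  va : ∀ i < C.n, m (64 + i) = s.2 i
  ps : ∀ j < C.nf, m (64 + C.n + j) = C.ps j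
  fo : ∀ j ≤ C.nf, m (64 + 2 * C.n + j) = s.1 j
  bit : ∀ i, s.2 i ≤ 1

theorem GrayMem.of_eq {C : Ctx} {s : (ℕ → ℕ) × (ℕ → ℕ)} {m m' : ℕ → ℕ} (h : GrayMem C s m)
    (hnf : C.nf ≤ C.n) (hm : ∀ a < 65 + 3 * C.n, m' a = m a) : GrayMem C s m' where
  va i hi := by rw [hm _ (by omega), h.va i hi]
  ps i hi := by rw [hm _ (by omega), h.ps i hi]
  fo i hi := by rw [hm _ (by omega), h.fo i hi]
  bit := h.bit

namespace Ctx
variable (C : Ctx)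

theorem nf_add_length : C.nf + C.T.length = C.n := by
  have hT := C.isTm C.T (by simp)
  have h1 : ((List.range C.n).filter fun i => ¬ i ∉ C.T.map Prod.fst).Perm (C.T.map Prod.fst) := by
    refine (List.perm_ext_iff_of_nodup (List.nodup_range.filter _) ?_).2 fun i => ?_
    · exact List.Pairwise.map _ (fun _ _ h => h.ne) hT.1
    · simp only [List.mem_filter, List.mem_range, decide_eq_true_eq, not_not]
      refine ⟨fun h => h.2, fun h => ⟨?_, h⟩⟩
      obtain ⟨y, hy, rfl⟩ := List.mem_map.1 h
      have := hT.2 y hy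
      omega
  have h2 := List.length_eq_length_filter_add (l := List.range C.n)
    (fun i => decide (i ∉ C.T.map Prod.fst))
  have h3 := h1.length_eq
  simp only [List.length_range, List.length_map] at h2 h3
  rw [nf, free]
  simp only [decide_not, Bool.not_not] at h2 h3 ⊢
  omega

theorem nf_le : C.nf ≤ C.n := by have := C.nf_add_length; omega

theorem ps_mem {j : ℕ} (hj : j < C.nf) : C.ps j ∈ C.free := by
  rw [ps, List.getD_eq_getElem _ _ hj]
  exact List.getElem_mem _

theorem ps_lt {j : ℕ} (hj : j < C.nf) : C.ps j < C.n := by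
  have := C.ps_mem hj
  rw [free, List.mem_filter] at this
  simpa using this.1

theorem ps_inj (i : ℕ) (hi : i < C.nf) (j : ℕ) (hj : j < C.nf) (h : C.ps i = C.ps j) : i = j := by
  rw [ps, ps, List.getD_eq_getElem _ _ hi, List.getD_eq_getElem _ _ hj] at h
  exact (List.Nodup.getElem_inj_iff (List.nodup_range.filter _)).1 h

theorem gray_succ (i : ℕ) : C.gray (i + 1) = focusStep C.ps (C.gray i) :=
  Function.iterate_succ_apply' _ _ _

theorem gray_lt {i : ℕ} (hi : i + 1 < 2 ^ C.nf) : (C.gray i).1 0 < C.nf :=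
  (focus_pointers C.ps C.nf C.s₀ fun _ _ => rfl).2 i (by omega)

/-- At the last word, the first focus pointer signals the end of the Gray code. -/
theorem gray_last : (C.gray (2 ^ C.nf - 1)).1 0 = C.nf :=
  (focus_pointers C.ps C.nf C.s₀ fun _ _ => rfl).1.1

theorem encTm_length (l : Tm) : (encTm l).length = 2 * l.length + 1 := by
  simp [encTm]; omega

theorem wordLength_facts : C.n < 2 ^ wordLength C.x ∧ C.F.length + 2 * C.nodes ≤ 2 ^ wordLength C.x
    ∧ 2 ≤ wordLength C.x := by
  have h1 : C.x.length < 2 ^ wordLength C.x := by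
    rw [← Nat.size_le]; exact Nat.size_le_size (le_max_left _ _)
  have h2 : C.n < 2 ^ wordLength C.x := by
    rw [← Nat.size_le]; exact Nat.size_le_size ((by simp [x] : C.n ≤ _).trans (le_max_right _ _))
  have h3 : C.x.length = 2 + (C.F.length + 2 * (C.nodes - 1)) := by
    have : (C.F.flatMap encTm).length = C.F.length + 2 * (C.F.map List.length).sum := by
      induction C.F with
      | nil => rfl
      | cons l L ih => simp [encTm_length, ih]; omega
    simp [x, this, nodes]; omega
  have h4 : 1 ≤ C.nodes := by simp [nodes]
  refine ⟨h2, by omega, ?_⟩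
  by_contra h
  have : C.F.length ≥ 1 := by simp [F]
  have h5 : 2 ^ wordLength C.x ≤ 2 ^ 1 := Nat.pow_le_pow_right (by omega) (by omega)
  omega

/-- Addresses are narrow operands: they are polynomial in the length of the input and its entries.
-/
theorem bound_lt : 8 * C.bound < C.E.narrow := by
  obtain ⟨h1, h2, h3⟩ := C.wordLength_facts
  set w := wordLength C.x with hw
  have h4 : 2 ^ 2 ≤ 2 ^ w := Nat.pow_le_pow_right (by omega) h3
  have e : C.E.narrow = (2 ^ w) ^ 8 := by
    show 2 ^ (8 * wordLength C.x) = _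
    rw [← hw, mul_comm, pow_mul]
  rw [e]
  set W := 2 ^ w with hW
  have hb : C.bound ≤ 72 * W + (2 * W + 4) * (W + 2) + (W + 2) * (W + 2) := by
    have a1 : C.nodes ≤ W := by omega
    have a2 : C.dead ≤ 72 * W := by simp only [dead]; omega
    have a3 : C.sz * (C.nodes + 2) ≤ (2 * W + 4) * (W + 2) :=
      Nat.mul_le_mul (by simp only [sz]; omega) (by omega)
    have a4 : (C.n + 2) * (C.nodes + 2) ≤ (W + 2) * (W + 2) :=
      Nat.mul_le_mul (by omega) (by omega)
    simp only [bound]; omega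
  have h5 : 4 ≤ W := h4
  have h6 : 16 ≤ W * W := Nat.mul_le_mul h5 h5
  have h7 : W ^ 8 = (W * W) * (W * W) * ((W * W) * (W * W)) := by ring
  have h8 : 256 ≤ (W * W) * (W * W) := Nat.mul_le_mul h6 h6
  have h9 : 256 * ((W * W) * (W * W)) ≤ W ^ 8 := h7 ▸ Nat.mul_le_mul_right _ h8
  have h10 : 16 * (W * W) ≤ (W * W) * (W * W) := Nat.mul_le_mul_right _ h6
  have h11 : 4 * W ≤ W * W := Nat.mul_le_mul_right _ h5
  have h12 : 72 * W + (2 * W + 4) * (W + 2) + (W + 2) * (W + 2) = 3 * (W * W) + 84 * W + 12 := by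
    ring
  omega

theorem valid : C.E.Valid where
  narrow a b ha hb := by
    obtain ⟨-, -, h3⟩ := C.wordLength_facts
    have h1 : Nat.size a ≤ 8 * wordLength C.x := Nat.size_le.2 ha
    have h2 : Nat.size b ≤ 8 * wordLength C.x := Nat.size_le.2 hb
    have : (Nat.size a + Nat.size b) / wordLength C.E.x ≤ 16 :=
      Nat.div_le_of_le_mul (by change _ ≤ wordLength C.x * 16; omega)
    omega
  wide a b ha hb := by
    obtain ⟨-, -, h3⟩ := C.wordLength_facts
    have hK : C.T.length ≤ C.K := C.length_le C.T (by simp)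
    have e : C.E.wide ≤ 2 ^ (2 * C.K + 6) := by
      show 4 * (16 * 2 ^ (C.T.length + C.K)) ≤ _
      have h : 2 ^ (C.T.length + C.K) ≤ 2 ^ (2 * C.K) := Nat.pow_le_pow_right (by omega) (by omega)
      have : 2 ^ (2 * C.K + 6) = 64 * 2 ^ (2 * C.K) := by ring
      omega
    have h1 : Nat.size a ≤ 2 * C.K + 6 := Nat.size_le.2 (ha.trans_le e)
    have h2 : Nat.size b ≤ 2 * C.K + 6 := Nat.size_le.2 (hb.trans_le e)
    have : (Nat.size a + Nat.size b) / wordLength C.E.x ≤ 2 * C.K + 6 :=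
      Nat.div_le_of_le_mul (by
        change _ ≤ wordLength C.x * _
        have := Nat.mul_le_mul_right (2 * C.K + 6) h3
        omega)
    show _ ≤ 17 * (C.K + 1)
    omega

end Ctx

theorem update_var (v : Var → ℕ) (d : Var) (c : ℕ) (a : Var) :
    Function.update v d c a = if a = d then c else v a := Function.update_apply ..

theorem update_mem_of_ne {m : ℕ → ℕ} {d c a : ℕ} (h : a ≠ d) : Function.update m d c a = m a :=
  Function.update_of_ne h ..

theorem word_eq {C : Ctx} {m α : ℕ → ℕ} {a b : ℕ} (hb : b + 1 - a = C.n)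
    (h : ∀ i < C.n, m (a + i) = α i) :
    (List.range' a (b + 1 - a)).map m = C.word α := by
  rw [hb, List.range'_eq_map_range, List.map_map, Ctx.word]
  exact List.map_congr_left fun i hi => h i (List.mem_range.1 hi)

theorem wp_grayStep {C : Ctx} {σ : Cfg} {Q : Cfg → Prop} {s : (ℕ → ℕ) × (ℕ → ℕ)}
    (hL : Lay C σ.v) (hm : GrayMem C s σ.m) (hj : σ.v .tj = s.1 0) (hlt : s.1 0 < C.nf)
    (hw : σ.words ≠ []) (hg : σ.gap + 14 ≤ C.E.later)
    (hQ : ∀ σ', (∀ a ∉ [Var.ta, .tb, .tt, .tv, .ty], σ'.v a = σ.v a) →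
      (∀ a, 65 + 3 * C.n ≤ a → σ'.m a = σ.m a) → GrayMem C (focusStep C.ps s) σ'.m →
      σ'.gap = 0 → σ'.words = σ.words ++ [C.word (focusStep C.ps s).2] → Q σ') :
    wp C.E Prog.grayStep Q σ := by
  have hb := C.bound_lt
  have hb2 : 68 + 7 * C.n ≤ C.bound := by simp only [Ctx.bound, Ctx.dead]; omega
  have hnf := C.nf_le
  set j := s.1 0 with hjd
  have hps : C.ps j < C.n := C.ps_lt hlt
  have e1 : σ.m (64 + 2 * C.n + j + 1) = s.1 (j + 1) := hm.fo (j + 1) (by omega)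
  have e2 : σ.m (64 + C.n + j) = C.ps j := hm.ps j hlt
  have e3 : σ.m (64 + C.ps j) = s.2 (C.ps j) := hm.va _ hps
  set m' := Function.update (Function.update (Function.update (Function.update σ.m (64 + 2 * C.n) 0)
    (64 + 2 * C.n + j) (s.1 (j + 1))) (64 + 2 * C.n + j + 1) (j + 1)) (64 + C.ps j)
    (1 - s.2 (C.ps j)) with hm'
  have hG : GrayMem C (focusStep C.ps s) m' := by
    constructor
    · intro i hi
      simp only [focusStep, ← hjd, hm', Function.update_apply]
      by_cases h : i = C.ps j
      · simp [h]
      · rw [if_neg (by omega), if_neg (by omega), if_neg (by omega), if_neg (by omega), if_neg h,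
          hm.va i hi]
    · intro i hi
      simp (disch := omega) only [hm', update_mem_of_ne, hm.ps i hi]
    · intro i hi
      simp only [focusStep, ← hjd, hm', Function.update_apply]
      rw [if_neg (by omega)]
      refine if_congr (by omega) rfl (if_congr (by omega) ?_ (if_congr (by omega) rfl (hm.fo i hi)))
      rw [if_neg (by omega)]
    · intro i
      simp only [focusStep, Function.update_apply]
      split_ifs
      · omega
      · exact hm.bit i
  have hbit := hm.bit (C.ps j)
  simp (disch := omega) only [Prog.grayStep, wp_seq_iff, wp_op_iff, Op.Ok, Op.next, update_var,
    reduceCtorEq, if_false, if_true, ArithOp.eval, hL.zero, hL.one, hL.fo, hL.ps, hL.va, hL.ve, hj,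
    update_mem_of_ne, e1, e2, e3, hw, ← hm']
  and_intros <;> try omega
  refine hQ _ (fun a ha => ?_) (fun a ha => ?_) hG ?_ ?_
  · simp only [List.mem_cons, List.not_mem_nil, not_or] at ha
    simp only [update_var, ha, if_false]
  · simp (disch := omega) only [hm', update_mem_of_ne]
  · rfl
  · rw [word_eq (by omega) hG.va]

/-- The state of the Gray code and of the accounts, while the search has output the words `Bs` so
far. Here `i + 1` is the number of words that the Gray code has output; the work done between two
of them is paid by the potential `Φ`; and the time since the last output is bounded by the work
`cnt` done since the last output of the Gray code, where `rm` and `T.length` account for the doubling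
of the budget, and `e` is the time that will be charged to the next unit of work. -/
structure Inv (C : Ctx) (Bs : List (List ℕ)) (Φ : ℚ) (e : ℕ) (σ : Cfg) : Prop where
  lay : Lay C σ.v
  gray : ∃ i < 2 ^ C.nf, GrayMem C (C.gray i) σ.m ∧
    σ.words.Perm ((List.range (i + 1)).map (fun j => C.word (C.gray j).2) ++ Bs) ∧
    (i : ℚ) + (σ.v .cnt : ℚ) / (σ.v .bud : ℚ) ≤ Φ ∧ (i + 1 < 2 ^ C.nf → σ.v .cnt < σ.v .bud)
  bud : σ.v .bud = 16 * 2 ^ (C.T.length + σ.v .rm)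
  rm : σ.v .rm ≤ C.K
  gap : σ.gap ≤ C.G * (σ.v .cnt + σ.v .rm + C.T.length + 1) + e

namespace Inv
variable {C : Ctx} {Bs : List (List ℕ)} {Φ : ℚ} {e : ℕ} {σ : Cfg}

theorem words_ne (h : Inv C Bs Φ e σ) : σ.words ≠ [] := by
  obtain ⟨i, -, -, h1, -⟩ := h.gray
  intro h0
  have := h1.length_eq
  simp [h0] at this
  omega

theorem bud_pos (h : Inv C Bs Φ e σ) : 0 < σ.v .bud := by
  rw [h.bud]; positivity

theorem bud_le (h : Inv C Bs Φ e σ) : σ.v .bud ≤ C.maxBud := by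
  rw [h.bud, Ctx.maxBud]
  exact Nat.mul_le_mul_left _ (Nat.pow_le_pow_right (by omega) (by have := h.rm; omega))

/-- Before the last word of the Gray code, the budget bounds `cnt`; at the last word, the potential
does. -/
theorem cnt_le (h : Inv C Bs Φ e σ) (hΦ : Φ ≤ 2 ^ C.nf) : σ.v .cnt ≤ σ.v .bud := by
  obtain ⟨i, hi, -, -, h1, h2⟩ := h.gray
  rcases Nat.lt_or_ge (i + 1) (2 ^ C.nf) with h3 | h3
  · exact (h2 h3).le
  · have h4 : (i : ℚ) + 1 = 2 ^ C.nf := by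
      have : i + 1 = 2 ^ C.nf := by omega
      exact_mod_cast this
    have hb : (0 : ℚ) < σ.v .bud := by exact_mod_cast h.bud_pos
    have : (σ.v .cnt : ℚ) / (σ.v .bud : ℚ) ≤ 1 := by linarith
    rw [div_le_one hb] at this
    exact_mod_cast this

theorem gap_le (h : Inv C Bs Φ e σ) (hΦ : Φ ≤ 2 ^ C.nf) (he : e ≤ C.G) :
    σ.gap + 8 * C.G ≤ C.E.later := by
  have h1 := h.gap
  have h2 := h.cnt_le hΦ
  have h3 := h.bud_le
  have h4 := h.rm
  have hT := C.length_le C.T (by simp)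
  have h5 : C.G * (σ.v .cnt + σ.v .rm + C.T.length + 1) ≤ C.G * (C.maxBud + 2 * C.K + 1) :=
    Nat.mul_le_mul_left _ (by omega)
  have h6 : C.E.later = C.G * (C.maxBud + 2 * C.K + 1) + 9 * C.G := by
    show C.G * (C.maxBud + 2 * C.K + 10) = _
    ring
  omega

/-- The accounts do not change when registers and memory unrelated to them change. -/
theorem of_eq (h : Inv C Bs Φ e σ) {σ' : Cfg} {e' : ℕ}
    (hv : ∀ a ∈ layVars, σ'.v a = σ.v a) (hm : ∀ a < 65 + 3 * C.n, σ'.m a = σ.m a)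
    (hcnt : σ'.v .cnt = σ.v .cnt) (hbud : σ'.v .bud = σ.v .bud) (hrm : σ'.v .rm = σ.v .rm)
    (hw : σ'.words = σ.words) (hg : σ'.gap + e ≤ σ.gap + e') : Inv C Bs Φ e' σ' where
  lay := h.lay.of_eq hv
  gray := by
    obtain ⟨i, hi, h1, h2⟩ := h.gray
    refine ⟨i, hi, h1.of_eq C.nf_le hm, ?_⟩
    rw [hw, hcnt, hbud]
    exact h2
  bud := by rw [hbud, hrm, h.bud]
  rm := by rw [hrm]; exact h.rm
  gap := by
    rw [hcnt, hrm]
    have := h.gap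
    omega

end Inv

theorem Ctx.le_G (C : Ctx) : 200 ≤ C.G ∧ C.G = 200 * C.E.wideCost :=
  ⟨by simp only [Ctx.G]; omega, rfl⟩

/-- One unit of work, paid by `1 / bud` of potential. As long as the potential does not exceed the
number of words, the Gray code has words left whenever the budget is used up, or else it has come to
its end and `cnt` still does not exceed `bud`. -/
theorem wp_tick {C : Ctx} {Bs : List (List ℕ)} {Φ Φ' : ℚ} {e : ℕ} {σ : Cfg} {Q : Cfg → Prop}
    (h : Inv C Bs Φ e σ) (he : e + 40 * C.E.wideCost ≤ C.G) (hΦ : Φ + 1 / (σ.v .bud : ℚ) ≤ Φ')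
    (hΦ' : Φ' ≤ 2 ^ C.nf)
    (hQ : ∀ σ', (∀ a ∉ [Var.ta, .tb, .tt, .tv, .ty, .tj, .cnt], σ'.v a = σ.v a) →
      (∀ a, 65 + 3 * C.n ≤ a → σ'.m a = σ.m a) → Inv C Bs Φ' 0 σ' → Q σ') :
    wp C.E Prog.tick Q σ := by
  have hb0 : (0 : ℚ) < σ.v .bud := by exact_mod_cast h.bud_pos
  have hΦ1 : Φ ≤ Φ' := by
    have : 0 < 1 / (σ.v .bud : ℚ) := by positivity
    linarith
  have hbud := h.bud_le
  have hcnt := h.cnt_le (hΦ1.trans hΦ')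
  have hgap := h.gap_le (hΦ1.trans hΦ') (by omega)
  have hwide : C.E.wide = 4 * C.maxBud := rfl
  have hpos : 0 < C.maxBud := h.bud_pos.trans_le hbud
  have hnar := C.bound_lt
  have hb2 : 68 + 7 * C.n ≤ C.bound := by simp only [Ctx.bound, Ctx.dead]; omega
  obtain ⟨hG1, hG2⟩ := C.le_G
  have hwc : 1 ≤ C.E.wideCost := by omega
  have hL := h.lay
  obtain ⟨i, hi, hm, hw, hpot, hlt⟩ := h.gray
  have hf0 : σ.m (64 + 2 * C.n) = (C.gray i).1 0 := hm.fo 0 (by omega)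
  have hnf := C.nf_le
  have hG3 : C.G * (σ.v .cnt + 1 + σ.v .rm + C.T.length + 1) =
      C.G * (σ.v .cnt + σ.v .rm + C.T.length + 1) + C.G := by ring
  have hgap' := h.gap
  -- the account after a unit of work without output of the Gray code
  have hpot' : (i : ℚ) + ((σ.v .cnt + 1 : ℕ) : ℚ) / (σ.v .bud : ℚ) ≤ Φ' := by
    push_cast
    rw [add_div]; linarith
  have hle : (C.gray i).1 0 ≤ C.nf := by
    rcases Nat.lt_or_ge (i + 1) (2 ^ C.nf) with h1 | h1
    · exact (C.gray_lt h1).le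
    · have : i = 2 ^ C.nf - 1 := by omega
      rw [this, C.gray_last]
  have frame : ∀ a ∉ [Var.ta, .tb, .tt, .tv, .ty, .tj, .cnt], ∀ a' ∈ [Var.ta, .tb, .tt, .tv, .ty,
    .tj, .cnt], a ≠ a' := fun a ha a' ha' haa => ha (haa ▸ ha')
  simp (disch := omega) only [Prog.tick, wp_seq_iff, wp_op_iff, wp_ifz_iff, wp_skip_iff, Op.Ok,
    Op.next, Cfg.wait, update_var, reduceCtorEq, if_false, if_true, ArithOp.eval, hL.one, hL.fo,
    hL.nf, hf0]
  and_intros <;> try omega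
  · intro ht
    and_intros <;> try omega
    · intro ht2
      have hend : ¬ i + 1 < 2 ^ C.nf := fun h1 => by have := C.gray_lt h1; omega
      refine hQ _ (fun a ha => ?_) (fun a ha => rfl) ⟨?_, ⟨i, hi, ?_, hw, ?_, ?_⟩, ?_, ?_, ?_⟩
      · simp only [List.mem_cons, List.not_mem_nil, not_or] at ha
        simp only [update_var, ha, if_false]
      · exact hL.of_eq (by simp [layVars, update_var])
      · exact hm
      · simpa only [update_var, reduceCtorEq, if_false, if_true] using hpot'
      · exact fun h1 => absurd h1 hend
      · simpa only [update_var, reduceCtorEq, if_false, if_true] using h.bud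
      · simpa only [update_var, reduceCtorEq, if_false, if_true] using h.rm
      · simp only [update_var, reduceCtorEq, if_false, if_true]
        omega
    · intro ht2
      have hlt2 : (C.gray i).1 0 < C.nf := by omega
      have hi1 : i + 1 < 2 ^ C.nf := by
        by_contra h1
        have : i = 2 ^ C.nf - 1 := by omega
        rw [this, C.gray_last] at hlt2
        omega
      have hcb : σ.v .bud = σ.v .cnt + 1 := by have := hlt hi1; omega
      refine wp_grayStep (s := C.gray i) (hL.of_eq (by simp [layVars, update_var])) hm ?_ hlt2
        h.words_ne ?_ ?_
      · simp only [update_var, reduceCtorEq, if_false, if_true]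
      · simp only; omega
      · intro σ' hv hm1 hm2 hg1 hw1
        have hv' : ∀ a ∉ [Var.ta, .tb, .tt, .tv, .ty, .tj, .cnt], σ'.v a = σ.v a := by
          intro a ha
          simp only [List.mem_cons, List.not_mem_nil, not_or] at ha
          rw [hv a (by simp [ha])]
          simp only [update_var, ha, if_false]
        simp only [wp_op_iff, Op.Ok, Op.next, true_and]
        refine hQ _ (fun a ha => ?_) (fun a ha => ?_) ⟨?_, ⟨i + 1, hi1, ?_, ?_, ?_, ?_⟩, ?_, ?_, ?_⟩
        · show Function.update σ'.v .cnt 0 a = _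
          rw [update_var, if_neg (frame a ha _ (by simp)), hv' a ha]
        · exact hm1 a ha
        · refine hL.of_eq ?_
          simp only [layVars, update_var]
          simp [hv']
        · rw [C.gray_succ]; exact hm2
        · simp only [hw1, ← C.gray_succ, List.range_succ (n := i + 1), List.map_append]
          have := hw.append_right [C.word (C.gray (i + 1)).2]
          refine this.trans ?_
          simp only [List.append_assoc]
          exact List.perm_append_comm.append_left _
        · simp only [update_var, reduceCtorEq, if_false, if_true]
          rw [← hcb, div_self hb0.ne'] at hpot'
          push_cast
          simpa using hpot'
        · intro _
          simp only [update_var, reduceCtorEq, if_false, if_true]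
          rw [hv' _ (by simp)]; exact h.bud_pos
        · simp only [update_var, reduceCtorEq, if_false]
          rw [hv' _ (by simp), hv' _ (by simp)]; exact h.bud
        · simp only [update_var, reduceCtorEq, if_false]
          rw [hv' _ (by simp)]; exact h.rm
        · simp only [update_var, reduceCtorEq, if_false, if_true, hg1]
          have : C.G * 1 ≤ C.G * (0 + σ'.v .rm + C.T.length + 1) := Nat.mul_le_mul_left _ (by omega)
          omega
  · intro ht
    refine hQ _ (fun a ha => ?_) (fun a ha => rfl) ⟨?_, ⟨i, hi, ?_, hw, ?_, ?_⟩, ?_, ?_, ?_⟩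
    · simp only [List.mem_cons, List.not_mem_nil, not_or] at ha
      simp only [update_var, ha, if_false]
    · exact hL.of_eq (by simp [layVars, update_var])
    · exact hm
    · simpa only [update_var, reduceCtorEq, if_false, if_true] using hpot'
    · simp only [update_var, reduceCtorEq, if_false, if_true]
      omega
    · simpa only [update_var, reduceCtorEq, if_false, if_true] using h.bud
    · simpa only [update_var, reduceCtorEq, if_false, if_true] using h.rm
    · simp only [update_var, reduceCtorEq, if_false, if_true]
      omega

/-! ### The trie in the memory -/

/-- The suffixes of terms that have a node, in the order of their creation. -/
structure IsTrie (C : Ctx) (S : List Tm) : Prop where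
  nodup : S.Nodup
  isTm : ∀ l ∈ S, IsTm 0 C.n l
  closed : ∀ x l, x :: l ∈ S → l ∈ S
  head : S.head? = some []
  length_le : S.length ≤ C.nodes

/-- The address of the node of a term, where `none` stands for falsified terms. -/
def Ctx.ad (C : Ctx) (S : List Tm) : Option Tm → ℕ
  | none => C.dead
  | some l => C.dead + C.sz * (S.idxOf l + 1)

/-- The first address behind the trie. -/
def Ctx.hp (C : Ctx) (S : List Tm) : ℕ := C.dead + C.sz * (S.length + 1)

/-- The term has a node. -/
def HasNode (S : List Tm) (o : Option Tm) : Prop := ∀ l, o = some l → l ∈ S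

theorem HasNode.restrict {C : Ctx} {S : List Tm} (hS : IsTrie C S) {o : Option Tm}
    (h : HasNode S o) (d b : ℕ) : HasNode S (restrict d b o) := by
  intro l hl
  rcases o with _ | (_ | ⟨x, r⟩)
  · simp [KDNF.restrict] at hl
  · simp only [KDNF.restrict, Option.some.injEq] at hl
    exact h l (by rw [hl])
  · simp only [KDNF.restrict] at hl
    split_ifs at hl with h1 h2
    · exact hS.closed x l (h _ (by simp at hl; rw [hl]))
    · exact h l (by rw [← hl])

theorem slot_inj {s i j a b : ℕ} (ha : a < s) (hb : b < s) (h : s * i + a = s * j + b) :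
    i = j ∧ a = b := by
  have h1 : (s * i + a) / s = i := by
    rw [Nat.mul_add_div (by omega), Nat.div_eq_of_lt ha, Nat.add_zero]
  have h2 : (s * j + b) / s = j := by
    rw [Nat.mul_add_div (by omega), Nat.div_eq_of_lt hb, Nat.add_zero]
  have hij : i = j := by rw [← h1, h, h2]
  subst hij
  exact ⟨rfl, by omega⟩

theorem ad_slot (C : Ctx) {S : List Tm} {o : Option Tm} (ho : HasNode S o) :
    ∃ i, i ≤ S.length ∧ C.ad S o = C.dead + C.sz * i := by
  cases o with
  | none => exact ⟨0, by omega, by simp [Ctx.ad]⟩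
  | some l => exact ⟨S.idxOf l + 1, List.idxOf_lt_length_of_mem (ho l rfl), rfl⟩

theorem ad_inj {C : Ctx} {S : List Tm} {o o' : Option Tm} (ho : HasNode S o) (ho' : HasNode S o')
    {a b : ℕ} (ha : a < C.sz) (hb : b < C.sz) (h : C.ad S o + a = C.ad S o' + b) :
    o = o' ∧ a = b := by
  cases o with
  | none =>
    cases o' with
    | none => exact ⟨rfl, by simpa [Ctx.ad] using h⟩
    | some l =>
      simp only [Ctx.ad] at h
      have := slot_inj (i := 0) (j := S.idxOf l + 1) ha hb (by omega)
      omega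
  | some l =>
    cases o' with
    | none =>
      simp only [Ctx.ad] at h
      have := slot_inj (i := S.idxOf l + 1) (j := 0) ha hb (by omega)
      omega
    | some l' =>
      simp only [Ctx.ad] at h
      obtain ⟨h1, h2⟩ := slot_inj (i := S.idxOf l + 1) (j := S.idxOf l' + 1) ha hb (by omega)
      refine ⟨?_, h2⟩
      rw [(List.idxOf_inj (ho l rfl)).1 (by omega : S.idxOf l = S.idxOf l')]

theorem ad_lt_hp {C : Ctx} {S : List Tm} {o : Option Tm} (ho : HasNode S o) {a : ℕ}
    (ha : a < C.sz) : C.dead ≤ C.ad S o ∧ C.ad S o + a < C.hp S := by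
  obtain ⟨i, hi, h⟩ := ad_slot C ho
  have : C.sz * (i + 1) ≤ C.sz * (S.length + 1) := Nat.mul_le_mul_left _ (by omega)
  rw [Nat.mul_add] at this
  rw [h, Ctx.hp]
  omega

/-- The memory holds the nodes of the trie, as far as the search needs them: restriction of terms
amounts to following a pointer. -/
structure Nodes (C : Ctx) (S : List Tm) (m : ℕ → ℕ) : Prop where
  le : ∀ o, HasNode S o → m (C.ad S o) ≤ C.n
  eq : ∀ o, HasNode S o → ∀ d < C.n, m (C.ad S o) = d → ∀ b ≤ 1,
    m (C.ad S o + 1 + b) = C.ad S (restrict d b o)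
  ne : ∀ o, HasNode S o → ∀ d < C.n, m (C.ad S o) ≠ d → ∀ b, restrict d b o = o

theorem four_le_sz (C : Ctx) : 4 ≤ C.sz := by simp only [Ctx.sz]; omega

theorem Nodes.of_eq {C : Ctx} {S : List Tm} {m m' : ℕ → ℕ} (h : Nodes C S m)
    (hm : ∀ a, C.dead ≤ a → a < C.hp S → (∀ o, HasNode S o → a ≠ C.ad S o + 3) → m' a = m a) :
    Nodes C S m' := by
  have h4 := four_le_sz C
  have key : ∀ o, HasNode S o → ∀ c ≤ 2, m' (C.ad S o + c) = m (C.ad S o + c) := by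
    intro o ho c hc
    have := ad_lt_hp (C := C) ho (a := c) (by omega)
    refine hm _ (by omega) this.2 fun o' ho' heq => ?_
    have := ad_inj ho ho' (by omega) (by omega) heq
    omega
  have key0 : ∀ o, HasNode S o → m' (C.ad S o) = m (C.ad S o) := fun o ho => key o ho 0 (by omega)
  refine ⟨fun o ho => ?_, fun o ho d hd h1 b hb => ?_, fun o ho d hd h1 b => ?_⟩
  · rw [key0 o ho]; exact h.le o ho
  · rw [key0 o ho] at h1
    rw [add_assoc, key o ho _ (by omega), ← add_assoc]
    exact h.eq o ho d hd h1 b hb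
  · rw [key0 o ho] at h1
    exact h.ne o ho d hd h1 b

theorem hp_le_bound {C : Ctx} {S : List Tm} (hS : IsTrie C S) :
    C.hp S + (C.n + 2) * (C.nodes + 2) ≤ C.bound ∧ 68 + 7 * C.n ≤ C.dead ∧
      C.dead + C.sz ≤ C.hp S := by
  have h := hS.length_le
  have h1 : C.sz * (S.length + 1) ≤ C.sz * (C.nodes + 2) := Nat.mul_le_mul_left _ (by omega)
  have h2 : C.sz * 1 ≤ C.sz * (S.length + 1) := Nat.mul_le_mul_left _ (by omega)
  refine ⟨?_, ?_, ?_⟩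
  · simp only [Ctx.hp, Ctx.bound]; omega
  · simp only [Ctx.dead]; omega
  · simp only [Ctx.hp]; omega

/-- From address `base` on, the memory holds the addresses of the terms in `N`. -/
def Seg (C : Ctx) (S : List Tm) (m : ℕ → ℕ) (base : ℕ) (N : List (Option Tm)) : Prop :=
  ∀ i (h : i < N.length), m (base + i) = C.ad S N[i]

/-! ### Restriction of one list element -/

theorem wp_restrictNode {C : Ctx} {S : List Tm} (hS : IsTrie C S) {σ : Cfg} {Q : Cfg → Prop}
    {o : Option Tm} {d b : ℕ} (hL : Lay C σ.v) (hN : Nodes C S σ.m) (ho : HasNode S o)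
    (hi : 64 ≤ σ.v .i) (hio : σ.m (σ.v .i) = C.ad S o) (hd : σ.v .d = d) (hdn : d < C.n)
    (hb : σ.v .b = b) (hb1 : b ≤ 1)
    (hQ : ∀ σ', (∀ a ∉ [Var.u, .var, .t, .t1, .a], σ'.v a = σ.v a) → σ'.m = σ.m →
      σ'.gap ≤ σ.gap + 12 → σ'.words = σ.words → σ'.v .u = C.ad S (restrict d b o) → Q σ') :
    wp C.E Prog.restrictNode Q σ := by
  have hnar := C.bound_lt
  obtain ⟨hb1', hb2, hb3⟩ := hp_le_bound hS
  obtain ⟨hA1, hA2⟩ := ad_lt_hp (C := C) ho (a := 3) (by have := four_le_sz C; omega)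
  have hle := hN.le o ho
  simp (disch := omega) only [Prog.restrictNode, wp_seq_iff, wp_op_iff, wp_ifz_iff, wp_skip_iff,
    Op.Ok, Op.next, Cfg.wait, update_var, reduceCtorEq, if_false, if_true, ArithOp.eval, hL.one,
    hio, hd, hb]
  and_intros <;> try omega
  · intro ht
    and_intros <;> try omega
    refine hQ _ (fun a ha => ?_) rfl ?_ rfl ?_
    · simp only [List.mem_cons, List.not_mem_nil, not_or] at ha
      simp only [update_var, ha, if_false]
    · simp only; omega
    · simp only [update_var, if_true]
      exact hN.eq o ho d hdn (by omega) b hb1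
  · intro ht
    refine hQ _ (fun a ha => ?_) rfl ?_ rfl ?_
    · simp only [List.mem_cons, List.not_mem_nil, not_or] at ha
      simp only [update_var, ha, if_false]
    · simp only; omega
    · simp only [update_var, reduceCtorEq, if_false, if_true]
      rw [hN.ne o ho d hdn (by omega) b]

/-- The marks of the elements of the list `N` at address `base` are their positions. -/
def Marks (C : Ctx) (S : List Tm) (m : ℕ → ℕ) (base : ℕ) (N : List (Option Tm)) : Prop :=
  ∀ i (h : i < N.length), m (C.ad S N[i] + 3) = base + i

/-- Marks of nodes that are not in the current list are arbitrary, so a mark is believed only if the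
list confirms it. No marks need to be erased between lists. -/
theorem wp_checkMark {C : Ctx} {S : List Tm} (hS : IsTrie C S) {σ : Cfg} {Q : Cfg → Prop}
    {r : Option Tm} {N : List (Option Tm)} (hr : HasNode S r) (hN : ∀ o ∈ N, HasNode S o)
    (hu : σ.v .u = C.ad S r) (hnb : C.hp S ≤ σ.v .nb) (htop : σ.v .top = σ.v .nb + N.length)
    (hbd : σ.v .top < C.bound) (hseg : Seg C S σ.m (σ.v .nb) N) (hmk : Marks C S σ.m (σ.v .nb) N)
    (hp : σ.m (C.ad S r + 3) < C.E.narrow)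
    (hQ : ∀ σ', (∀ a ∉ [Var.t, .t1, .a, .p, .q, .y], σ'.v a = σ.v a) → σ'.m = σ.m →
      σ'.gap ≤ σ.gap + 20 → σ'.words = σ.words → σ'.v .a = C.ad S r + 3 →
      (σ'.v .y = 0 ↔ r ∈ N) → Q σ') :
    wp C.E Prog.checkMark Q σ := by
  have hnar := C.bound_lt
  obtain ⟨hb1', hb2, hb3⟩ := hp_le_bound hS
  obtain ⟨hA1, hA2⟩ := ad_lt_hp (C := C) hr (a := 3) (by have := four_le_sz C; omega)
  have hmem : ∀ o ∈ N, C.ad S o < C.hp S := fun o ho => (ad_lt_hp (C := C) (hN o ho) (a := 0)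
    (by have := four_le_sz C; omega)).2
  -- if `r` is in the list, its mark leads to it
  have hin : r ∈ N → ∃ i, ∃ h : i < N.length, N[i] = r ∧ σ.m (C.ad S r + 3) = σ.v .nb + i ∧
      σ.m (σ.v .nb + i) = C.ad S r := by
    intro h
    obtain ⟨i, hi, rfl⟩ := List.getElem_of_mem h
    exact ⟨i, hi, rfl, hmk i hi, hseg i hi⟩
  set p := σ.m (C.ad S r + 3) with hpd
  simp (disch := omega) only [Prog.checkMark, wp_seq_iff, wp_op_iff, wp_ifz_iff, wp_skip_iff,
    Op.Ok, Op.next, Cfg.wait, update_var, reduceCtorEq, if_false, if_true, ArithOp.eval, hu, ← hpd,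
    true_and]
  and_intros <;> try omega
  · intro ht
    refine hQ _ (fun a ha => ?_) rfl ?_ rfl ?_ ?_
    · simp only [List.mem_cons, List.not_mem_nil, not_or] at ha
      simp only [update_var, ha, if_false]
    · simp only; omega
    · simp only [update_var, reduceCtorEq, if_false, if_true]
    · simp only [update_var, reduceCtorEq, if_false, if_true]
      refine ⟨fun h => h.elim, fun h => ?_⟩
      obtain ⟨i, h1, -, h2, -⟩ := hin h
      omega
  · intro ht
    and_intros <;> try omega
    · intro ht2
      have hpi : p - σ.v .nb < N.length := by omega
      have hmp : σ.m p = C.ad S N[p - σ.v .nb] := by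
        rw [← hseg _ hpi]; congr 1; omega
      have hlt := hmem _ (List.getElem_mem hpi)
      rw [← hmp] at hlt
      have hiff : σ.m p = C.ad S r ↔ r ∈ N := by
        constructor
        · intro h
          have h1 : N[p - σ.v .nb] ∈ N := List.getElem_mem hpi
          rwa [(ad_inj (C := C) (hN _ h1) hr (a := 0) (b := 0) (by have := four_le_sz C; omega)
            (by have := four_le_sz C; omega) (by rw [← hmp, h])).1] at h1
        · intro h
          obtain ⟨i, h1, -, h2, h3⟩ := hin h
          rw [h2, h3]
      and_intros <;> try omega
      · intro ht3
        refine hQ _ (fun a ha => ?_) rfl ?_ rfl ?_ ?_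
        · simp only [List.mem_cons, List.not_mem_nil, not_or] at ha
          simp only [update_var, ha, if_false]
        · simp only; omega
        · simp only [update_var, reduceCtorEq, if_false, if_true]
        · simp only [update_var, if_true, true_iff]
          exact hiff.1 (by omega)
      · intro ht3
        refine hQ _ (fun a ha => ?_) rfl ?_ rfl ?_ ?_
        · simp only [List.mem_cons, List.not_mem_nil, not_or] at ha
          simp only [update_var, ha, if_false]
        · simp only; omega
        · simp only [update_var, reduceCtorEq, if_false, if_true]
        · simp only [update_var, reduceCtorEq, if_false, if_true, one_ne_zero, false_iff]
          intro h
          have := hiff.2 h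
          omega
    · intro ht2
      refine hQ _ (fun a ha => ?_) rfl ?_ rfl ?_ ?_
      · simp only [List.mem_cons, List.not_mem_nil, not_or] at ha
        simp only [update_var, ha, if_false]
      · simp only; omega
      · simp only [update_var, reduceCtorEq, if_false, if_true]
      · simp only [update_var, reduceCtorEq, if_false, if_true]
        refine ⟨fun h => h.elim, fun h => ?_⟩
        obtain ⟨i, h1, -, h2, -⟩ := hin h
        omega

/-- Append an element to a list, unless it is there already. -/
def insertNew (N : List (Option Tm)) (r : Option Tm) : List (Option Tm) :=
  if r ∈ N then N else N ++ [r]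

/-- The marks are bounded, whether they are meaningful or not. -/
def MarkBound (C : Ctx) (S : List Tm) (m : ℕ → ℕ) : Prop :=
  ∀ o, HasNode S o → m (C.ad S o + 3) < C.bound

/-- The registers that change while a list element is processed. -/
def elementVars : List Var := [.u, .var, .t, .t1, .a, .p, .q, .y, .i, .e, .top,
  .ta, .tb, .tt, .tv, .ty, .tj, .cnt]

/-- One element of the list is restricted and appended to the list `N` that is under construction.
-/
theorem wp_restrictElement {C : Ctx} {S : List Tm} (hS : IsTrie C S) {σ : Cfg} {Q : Cfg → Prop}
    {Bs : List (List ℕ)} {Φ Φ' : ℚ} {e : ℕ} (hI : Inv C Bs Φ e σ) (he : e ≤ 100)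
    (hΦ : Φ + 1 / (σ.v .bud : ℚ) ≤ Φ') (hΦ' : Φ' ≤ 2 ^ C.nf)
    (hN : Nodes C S σ.m) (hM : MarkBound C S σ.m)
    {o : Option Tm} {d b : ℕ} (ho : HasNode S o)
    (hi : 64 ≤ σ.v .i) (hi2 : σ.v .i < C.bound) (hio : σ.m (σ.v .i) = C.ad S o) (hd : σ.v .d = d)
    (hdn : d < C.n) (hb : σ.v .b = b) (hb1 : b ≤ 1) {N : List (Option Tm)}
    (hNn : ∀ o ∈ N, HasNode S o) (hnb : C.hp S ≤ σ.v .nb) (htop : σ.v .top = σ.v .nb + N.length)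
    (hbd : σ.v .top < C.bound) (hhi : σ.v .hi < C.bound)
    (hseg : Seg C S σ.m (σ.v .nb) N) (hmk : Marks C S σ.m (σ.v .nb) N)
    (hQ : ∀ σ', (∀ a ∉ elementVars, σ'.v a = σ.v a) → σ'.v .i = σ.v .i + 1 →
      σ'.v .e = σ.v .hi - (σ.v .i + 1) →
      σ'.v .top = σ.v .nb + (insertNew N (restrict d b o)).length →
      (∀ a, 65 + 3 * C.n ≤ a → a ≠ σ.v .top → (∀ o, HasNode S o → a ≠ C.ad S o + 3) →
        σ'.m a = σ.m a) →
      MarkBound C S σ'.m → Nodes C S σ'.m → Seg C S σ'.m (σ.v .nb) (insertNew N (restrict d b o)) →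
      Marks C S σ'.m (σ.v .nb) (insertNew N (restrict d b o)) → Inv C Bs Φ' 0 σ' → Q σ') :
    wp C.E Prog.restrictElement Q σ := by
  have hnar := C.bound_lt
  have h4 := four_le_sz C
  obtain ⟨hG1, hG2⟩ := C.le_G
  obtain ⟨hb1', hb2, hb3⟩ := hp_le_bound hS
  have hL := hI.lay
  have hr := ho.restrict hS d b
  obtain ⟨hA1, hA2⟩ := ad_lt_hp (C := C) hr (a := 3) (by omega)
  set r := restrict d b o with hrd
  simp only [Prog.restrictElement, wp_seq_iff]
  refine wp_restrictNode hS hL hN ho hi hio hd hdn hb hb1 fun σ₁ hv₁ hm₁ hg₁ hw₁ hu₁ => ?_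
  have hnb₁ : σ₁.v .nb = σ.v .nb := hv₁ _ (by simp)
  have htop₁ : σ₁.v .top = σ.v .top := hv₁ _ (by simp)
  refine wp_seq (wp_checkMark hS hr hNn hu₁ (by omega) (by omega) (by omega)
    (by rw [hm₁, hnb₁]; exact hseg) (by rw [hm₁, hnb₁]; exact hmk)
    (by rw [hm₁]; have := hM _ hr; omega) fun σ₂ hv₂ hm₂ hg₂ hw₂ ha₂ hy₂ => ?_)
  have hv : ∀ a ∉ [Var.u, .var, .t, .t1, .a, .p, .q, .y], σ₂.v a = σ.v a := by
    intro a ha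
    simp only [List.mem_cons, List.not_mem_nil, not_or] at ha
    rw [hv₂ _ (by simp [ha]), hv₁ _ (by simp [ha])]
  rw [hm₁] at hm₂
  rw [hw₁] at hw₂
  have hu₂ : σ₂.v .u = C.ad S r := by rw [hv₂ _ (by simp), hu₁]
  have htop₂ : σ₂.v .top = σ.v .top := hv _ (by simp)
  have hi₂ : σ₂.v .i = σ.v .i := hv _ (by simp)
  have hhi₂ : σ₂.v .hi = σ.v .hi := hv _ (by simp)
  have hone₂ : σ₂.v .one = 1 := by rw [hv _ (by simp), hL.one]
  by_cases hrN : r ∈ N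
  · have hy0 := hy₂.2 hrN
    have hins : insertNew N r = N := if_pos hrN
    simp (disch := omega) only [wp_seq_iff, wp_op_iff, wp_ifz_iff, wp_skip_iff,
      Op.Ok, Op.next, Cfg.wait, update_var, reduceCtorEq, if_false, if_true, ArithOp.eval, hu₂, ha₂,
      hy0, htop₂, hi₂, hhi₂, hone₂, hm₂]
    and_intros <;> try omega
    · intro _
      and_intros <;> try omega
      refine wp_tick (e := e + 36) (hI.of_eq ?_ ?_ ?_ ?_ ?_ hw₂ ?_) (by omega)
        (Φ' := Φ') ?_ hΦ' fun σ₃ hv₃ hm₃ hI₃ => ?_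
      · simp only [layVars, update_var]
        simp [hv]
      · exact fun _ _ => rfl
      · simp [hv]
      · simp [hv]
      · simp [hv]
      · simp only; omega
      · simpa [hv] using hΦ
      · have hm₄ : ∀ a, 65 + 3 * C.n ≤ a → σ₃.m a = σ.m a := fun a ha => hm₃ a ha
        refine hQ _ ?_ ?_ ?_ ?_ ?_ ?_ ?_ ?_ ?_ hI₃
        · intro a ha
          simp only [elementVars, List.mem_cons, List.not_mem_nil, not_or] at ha
          rw [hv₃ _ (by simp [ha])]
          simp [ha, hv]
        · rw [hv₃ _ (by simp)]
          simp
        · rw [hv₃ _ (by simp)]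
          simp
        · rw [hv₃ _ (by simp), hins]
          simp [htop₂, htop]
        · exact fun a ha _ _ => hm₄ a ha
        · intro o' ho'
          have := ad_lt_hp (C := C) ho' (a := 3) (by omega)
          rw [hm₄ _ (by omega)]
          exact hM o' ho'
        · exact hN.of_eq fun a ha1 ha2 _ => hm₄ a (by omega)
        · intro i hi'
          rw [hins] at hi'
          simp only [hins]
          rw [hm₄ _ (by omega)]
          exact hseg i hi'
        · intro i hi'
          rw [hins] at hi'
          simp only [hins]
          have := ad_lt_hp (C := C) (hNn _ (List.getElem_mem hi')) (a := 3) (by omega)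
          rw [hm₄ _ (by omega)]
          exact hmk i hi'
  · have hy0 : σ₂.v .y ≠ 0 := fun h => hrN (hy₂.1 h)
    have hins : insertNew N r = N ++ [r] := if_neg hrN
    simp (disch := omega) only [wp_seq_iff, wp_op_iff, wp_ifz_iff, wp_skip_iff,
      Op.Ok, Op.next, Cfg.wait, update_var, reduceCtorEq, if_false, if_true, ArithOp.eval, hu₂, ha₂,
      htop₂, hi₂, hhi₂, hone₂, hm₂]
    and_intros <;> try omega
    · intro _
      and_intros <;> try omega
      refine wp_tick (e := e + 46) (hI.of_eq ?_ ?_ ?_ ?_ ?_ hw₂ ?_) (by omega)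
        (Φ' := Φ') ?_ hΦ' fun σ₃ hv₃ hm₃ hI₃ => ?_
      · simp only [layVars, update_var]
        simp [hv]
      · intro a ha
        simp (disch := omega) only [update_mem_of_ne]
      · simp [hv]
      · simp [hv]
      · simp [hv]
      · simp only; omega
      · simpa [hv] using hΦ
      · have hm₄ : ∀ a, 65 + 3 * C.n ≤ a → a ≠ C.ad S r + 3 → a ≠ σ.v .top →
            σ₃.m a = σ.m a := fun a ha h1 h2 => by
          rw [hm₃ a ha]
          simp (disch := omega) only [update_mem_of_ne]
        have hmt : σ₃.m (σ.v .top) = C.ad S r := by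
          rw [hm₃ _ (by omega)]
          simp (disch := omega) only [update_mem_of_ne, Function.update_self]
        have hmr : σ₃.m (C.ad S r + 3) = σ.v .top := by
          rw [hm₃ _ (by omega)]
          simp only [Function.update_self]
        refine hQ _ ?_ ?_ ?_ ?_ ?_ ?_ ?_ ?_ ?_ hI₃
        · intro a ha
          simp only [elementVars, List.mem_cons, List.not_mem_nil, not_or] at ha
          rw [hv₃ _ (by simp [ha])]
          simp [ha, hv]
        · rw [hv₃ _ (by simp)]
          simp
        · rw [hv₃ _ (by simp)]
          simp
        · rw [hv₃ _ (by simp), hins]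
          simp [htop]
          omega
        · exact fun a ha h1 h2 => hm₄ a ha (h2 r hr) h1
        · intro o' ho'
          have := ad_lt_hp (C := C) ho' (a := 3) (by omega)
          by_cases h : C.ad S o' + 3 = C.ad S r + 3
          · rw [h, hmr]; exact hbd
          · rw [hm₄ _ (by omega) h (by omega)]
            exact hM o' ho'
        · exact hN.of_eq fun a ha1 ha2 ha3 => hm₄ a (by omega) (ha3 r hr) (by omega)
        · intro i hi'
          simp only [hins, List.length_append, List.length_singleton] at hi'
          simp only [hins]
          rcases Nat.lt_or_ge i N.length with h | h
          · rw [hm₄ _ (by omega) (by omega) (by omega), List.getElem_append_left h]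
            exact hseg i h
          · have : i = N.length := by omega
            subst this
            rw [← htop, hmt]; simp
        · intro i hi'
          simp only [hins, List.length_append, List.length_singleton] at hi'
          simp only [hins]
          rcases Nat.lt_or_ge i N.length with h | h
          · rw [List.getElem_append_left h]
            have h1 := hNn _ (List.getElem_mem h)
            have := ad_lt_hp (C := C) h1 (a := 3) (by omega)
            rw [hm₄ _ (by omega) (fun heq => hrN ?_) (by omega)]
            · exact hmk i h
            · rw [← (ad_inj h1 hr (by omega) (by omega) heq).1]
              exact List.getElem_mem h
          · have : i = N.length := by omega
            subst this
            simp only [List.getElem_append_right le_rfl, Nat.sub_self, List.getElem_cons_zero]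
            rw [hmr, htop]

theorem mem_insertNew {N : List (Option Tm)} {r o : Option Tm} :
    o ∈ insertNew N r ↔ o ∈ N ∨ o = r := by
  unfold insertNew
  split_ifs with h
  · exact ⟨.inl, fun h' => h'.elim id (fun e => e ▸ h)⟩
  · simp

theorem nodup_insertNew {N : List (Option Tm)} (h : N.Nodup) (r : Option Tm) :
    (insertNew N r).Nodup := by
  unfold insertNew
  split_ifs with hr
  · exact h
  · rw [List.nodup_append]
    refine ⟨h, by simp, fun a ha b hb => ?_⟩
    rw [List.mem_singleton] at hb
    rintro rfl
    exact hr (hb ▸ ha)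

theorem head?_insertNew {N : List (Option Tm)} {r o : Option Tm} (h : N.head? = some o) :
    (insertNew N r).head? = some o := by
  unfold insertNew
  split_ifs
  · exact h
  · rw [List.head?_append, h]; rfl

/-! ### The lists of restricted terms -/

/-- `N` lists what the assignment `p` to the first variables leaves of the terms, and starts with
what is left of the first term. -/
structure ListFor (C : Ctx) (p : List ℕ) (N : List (Option Tm)) : Prop where
  nodup : N.Nodup
  mem : ∀ o, o ∈ N ↔ ∃ l ∈ C.F, o = restrictAll p l
  head : N.head? = some (restrictAll p C.T)

theorem ListFor.hasNode {C : Ctx} {S : List Tm} (hS : IsTrie C S) (hF : ∀ l ∈ C.F, l ∈ S)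
    {p : List ℕ} {N : List (Option Tm)} (h : ListFor C p N) {o : Option Tm} (ho : o ∈ N) :
    HasNode S o := by
  intro r hr
  obtain ⟨l, hl, rfl⟩ := (h.mem o).1 ho
  obtain ⟨t, ht⟩ := (restrictAll_suffix (C.isTm l hl) hr).1
  have hlS := hF l hl
  rw [← ht] at hlS
  clear ht hr hl
  induction t with
  | nil => exact hlS
  | cons x t ih => exact ih (hS.closed x _ hlS)

theorem length_le_of_hasNode {S : List Tm} {N : List (Option Tm)} (hN : N.Nodup)
    (h : ∀ o ∈ N, HasNode S o) : N.length ≤ S.length + 1 := by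
  have : N.Subperm (none :: S.map some) := hN.subperm fun o ho => by
    cases o with
    | none => simp
    | some l => simpa using h _ ho l rfl
  simpa using this.length_le

/-- The elements of a list are different terms over the remaining variables, and possibly the
falsified term. -/
theorem ListFor.length_le_numTm {C : Ctx} {p : List ℕ} {N : List (Option Tm)} (h : ListFor C p N)
    {κ : ℕ} (hκ : ∀ l ∈ C.F, l.length ≤ κ) : N.length ≤ numTm (C.n - p.length) κ + 1 := by
  refine KDNF.length_le_numTm (a := p.length) h.nodup fun r hr => ?_
  obtain ⟨l, hl, h1⟩ := (h.mem _).1 hr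
  obtain ⟨h2, h3⟩ := restrictAll_suffix (C.isTm l hl) h1.symm
  exact ⟨h3, h2.length_le.trans (hκ l hl)⟩

/-- The memory holds the lists `L j` for the prefixes of `p` of length `j`, from address `base j`
on, and the tables of the addresses of the lists and of their ends. -/
structure Lists (C : Ctx) (S : List Tm) (p : List ℕ) (base : ℕ → ℕ) (L : ℕ → List (Option Tm))
    (m : ℕ → ℕ) : Prop where
  base_zero : base 0 = 68 + 7 * C.n
  base_one : base 1 = C.hp S
  base_succ : ∀ j, 1 ≤ j → j ≤ p.length → base (j + 1) = base j + (L j).length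
  zero_le : base 0 + (L 0).length ≤ C.dead
  listFor : ∀ j ≤ p.length, ListFor C (p.take j) (L j)
  seg : ∀ j ≤ p.length, Seg C S m (base j) (L j)
  bs : ∀ j ≤ p.length + 1, m (65 + 5 * C.n + j) = base j
  be : ∀ j ≤ p.length, m (67 + 6 * C.n + j) = base j + (L j).length

theorem Lists.base_le {C : Ctx} {S : List Tm} {p : List ℕ} {base : ℕ → ℕ}
    {L : ℕ → List (Option Tm)} {m : ℕ → ℕ} (hS : IsTrie C S) (hF : ∀ l ∈ C.F, l ∈ S)
    (h : Lists C S p base L m) (j : ℕ) (hj : j ≤ p.length) :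
    C.hp S ≤ base (j + 1) ∧ base (j + 1) ≤ C.hp S + j * (C.nodes + 1) := by
  induction j with
  | zero => rw [h.base_one]; omega
  | succ j ih =>
    have h1 := ih (by omega)
    have h2 := length_le_of_hasNode (h.listFor (j + 1) hj).nodup
      fun o ho => (h.listFor (j + 1) hj).hasNode hS hF ho
    have h3 := hS.length_le
    have h4 := h.base_succ (j + 1) (by omega) hj
    have h5 : (j + 1) * (C.nodes + 1) = j * (C.nodes + 1) + (C.nodes + 1) := by ring
    omega

/-- The lists do not depend on the marks of the nodes, nor on the memory behind them and the table
entries for the next list. -/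
theorem Lists.of_eq {C : Ctx} {S : List Tm} {p : List ℕ} {base : ℕ → ℕ}
    {L : ℕ → List (Option Tm)} {m m' : ℕ → ℕ} (hS : IsTrie C S) (hF : ∀ l ∈ C.F, l ∈ S)
    (hp : p.length < C.n)
    (h : Lists C S p base L m) (hm : ∀ a, 65 + 5 * C.n ≤ a → a < base (p.length + 1) →
      (∀ o, HasNode S o → a ≠ C.ad S o + 3) → a ≠ 67 + 5 * C.n + p.length →
      a ≠ 68 + 6 * C.n + p.length → m' a = m a) :
    Lists C S p base L m' := by
  obtain ⟨hb1, hb2, hb3⟩ := hp_le_bound hS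
  have hbase := h.base_le hS hF p.length le_rfl
  have h4 := four_le_sz C
  have key : ∀ a, 65 + 5 * C.n ≤ a → a < base (p.length + 1) → (a < C.dead ∨ C.hp S ≤ a) →
      a ≠ 67 + 5 * C.n + p.length → a ≠ 68 + 6 * C.n + p.length → m' a = m a :=
    fun a h1 h2 h3 h4 h5 => hm a h1 h2 (fun o ho => by
      have := ad_lt_hp (C := C) ho (a := 3) (by omega)
      omega) h4 h5
  have mono : ∀ k, ∀ j, 1 ≤ j → j + k = p.length + 1 → base j ≤ base (p.length + 1) := by
    intro k
    induction k with
    | zero => intro j _ h1; rw [← h1]; exact le_rfl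
    | succ k ih =>
      intro j h1 h2
      have h3 := h.base_succ j h1 (by omega)
      have := ih (j + 1) (by omega) (by omega)
      omega
  refine ⟨h.base_zero, h.base_one, h.base_succ, h.zero_le, h.listFor, fun j hj i hi => ?_,
    fun j hj => ?_, fun j hj => ?_⟩
  · rw [← h.seg j hj i hi]
    rcases Nat.eq_zero_or_pos j with rfl | h0
    · have h1 := h.base_zero
      have h2 := h.zero_le
      exact key _ (by omega) (by omega) (by omega) (by omega) (by omega)
    · have h1 := h.base_succ j h0 hj
      have h2 := mono (p.length + 1 - (j + 1)) (j + 1) (by omega) (by omega)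
      have h3 := (h.base_le hS hF (j - 1) (by omega)).1
      rw [Nat.sub_add_cancel h0] at h3
      exact key _ (by omega) (by omega) (by omega) (by omega) (by omega)
  · rw [← h.bs j hj]
    exact key _ (by omega) (by omega) (by omega) (by omega) (by omega)
  · rw [← h.be j hj]
    exact key _ (by omega) (by omega) (by omega) (by omega) (by omega)

/-- The state of the search when the first variables have the values in `p`; all terms have at most
`κ` literals. -/
structure SearchInv (C : Ctx) (S : List Tm) (κ : ℕ) (Bs : List (List ℕ)) (Φ : ℚ) (e : ℕ)
    (p : List ℕ) (σ : Cfg) : Prop where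
  inv : Inv C Bs Φ e σ
  rm : σ.v .rm = κ
  nodes : Nodes C S σ.m
  marks : MarkBound C S σ.m
  vb : ∀ i (h : i < p.length), σ.m (65 + 3 * C.n + i) = p[i]
  lists : ∃ base L, Lists C S p base L σ.m

theorem Inv.mono {C : Ctx} {Bs : List (List ℕ)} {Φ Φ' : ℚ} {e e' : ℕ} {σ : Cfg}
    (h : Inv C Bs Φ e σ) (hΦ : Φ ≤ Φ') (he : e ≤ e') : Inv C Bs Φ' e' σ where
  lay := h.lay
  gray := by
    obtain ⟨i, h1, h2, h3, h4, h5⟩ := h.gray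
    exact ⟨i, h1, h2, h3, h4.trans hΦ, h5⟩
  bud := h.bud
  rm := h.rm
  gap := h.gap.trans (by omega)

/-- What the loop over the list elements has achieved after `k` elements. -/
structure LoopInv (C : Ctx) (S : List Tm) (Bs : List (List ℕ)) (Φ : ℚ) (σ₀ : Cfg) (d b : ℕ)
    (Ld : List (Option Tm)) (k : ℕ) (N : List (Option Tm)) (σ : Cfg) : Prop where
  inv : Inv C Bs (Φ + k * (1 / (σ₀.v .bud : ℚ))) (if k = 0 then 60 else 3) σ
  v : ∀ a ∉ elementVars, σ.v a = σ₀.v a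
  i : σ.v .i = σ₀.v .lo + k
  e : σ.v .e = Ld.length - k
  top : σ.v .top = σ₀.v .nb + N.length
  m : ∀ a, 65 + 3 * C.n ≤ a → a < σ₀.v .nb → (∀ o, HasNode S o → a ≠ C.ad S o + 3) →
    σ.m a = σ₀.m a
  marks : MarkBound C S σ.m
  nodes : Nodes C S σ.m
  seg : Seg C S σ.m (σ₀.v .nb) N
  marked : Marks C S σ.m (σ₀.v .nb) N
  nodup : N.Nodup
  mem : ∀ o, o ∈ N ↔ ∃ j, ∃ h : j < Ld.length, j < k ∧ o = restrict d b Ld[j]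
  head : ∀ h : 0 < Ld.length, 0 < k → N.head? = some (restrict d b Ld[0])

theorem wp_elementLoop {C : Ctx} {S : List Tm} (hS : IsTrie C S) {σ₀ : Cfg} {Q : Cfg → Prop}
    {Bs : List (List ℕ)} {Φ Φ' : ℚ} {d b : ℕ} {Ld : List (Option Tm)}
    (hLd : ∀ o ∈ Ld, HasNode S o) (hdn : d < C.n) (hb1 : b ≤ 1) (hd : σ₀.v .d = d)
    (hb : σ₀.v .b = b) (hlo : 64 + 4 * C.n ≤ σ₀.v .lo) (hhi : σ₀.v .hi = σ₀.v .lo + Ld.length)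
    (hnbhi : σ₀.v .hi ≤ σ₀.v .nb) (hdis : σ₀.v .hi ≤ C.dead ∨ C.hp S ≤ σ₀.v .lo)
    (hnb : C.hp S ≤ σ₀.v .nb) (hbd : σ₀.v .nb + C.nodes + 2 < C.bound)
    (hseg : Seg C S σ₀.m (σ₀.v .lo) Ld)
    (hΦ : Φ + Ld.length * (1 / (σ₀.v .bud : ℚ)) ≤ Φ') (hΦ' : Φ' ≤ 2 ^ C.nf)
    (h0 : LoopInv C S Bs Φ σ₀ d b Ld 0 [] σ₀)
    (hQ : ∀ σ N, LoopInv C S Bs Φ σ₀ d b Ld Ld.length N σ → Q (σ.wait 1)) :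
    wp C.E (.loop .e Prog.restrictElement) Q σ₀ := by
  have h4 := four_le_sz C
  obtain ⟨hb1', hb2, hb3⟩ := hp_le_bound hS
  have hbud : (0 : ℚ) < 1 / (σ₀.v .bud : ℚ) := by
    have := h0.inv.bud_pos
    positivity
  refine wp_loop_of_invariant (N := Ld.length)
    (fun M σ => ∃ k N, k + M = Ld.length ∧ LoopInv C S Bs Φ σ₀ d b Ld k N σ) ?_ ?_
    ⟨0, [], by omega, h0⟩
  · rintro M σ ⟨k, N, hk, h⟩ he
    have := h.e
    have hkl : k = Ld.length := by omega
    subst hkl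
    exact hQ σ N h
  · rintro M σ ⟨k, N, hk, h⟩ he
    have hke := h.e
    have hkl : k < Ld.length := by omega
    refine ⟨M - 1, by omega, ?_⟩
    have hnbσ : σ.v .nb = σ₀.v .nb := h.v _ (by simp [elementVars])
    have hhiσ : σ.v .hi = σ₀.v .hi := h.v _ (by simp [elementVars])
    have hNn : ∀ o ∈ N, HasNode S o := by
      intro o ho
      obtain ⟨j, hj, -, rfl⟩ := (h.mem o).1 ho
      exact (hLd _ (List.getElem_mem hj)).restrict hS d b
    have hlen := length_le_of_hasNode h.nodup hNn
    have hSl := hS.length_le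
    have hiσ := h.i
    have htop := h.top
    have hbudσ : σ.v .bud = σ₀.v .bud := h.v _ (by simp [elementVars])
    have hΦk : Φ + (k + 1 : ℕ) * (1 / (σ₀.v .bud : ℚ)) ≤ Φ' := by
      refine le_trans ?_ hΦ
      have : ((k + 1 : ℕ) : ℚ) ≤ Ld.length := by exact_mod_cast hkl
      have := mul_le_mul_of_nonneg_right this hbud.le
      linarith
    have hread : σ.m (σ₀.v .lo + k) = C.ad S Ld[k] := by
      rw [← hseg k hkl]
      refine h.m _ (by omega) (by omega) fun o ho => ?_
      have := ad_lt_hp (C := C) ho (a := 3) (by omega)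
      omega
    refine wp_restrictElement (Bs := Bs) (σ := σ.wait 1) (e := (if k = 0 then 60 else 3) + 1)
      (Φ := Φ + k * (1 / (σ₀.v .bud : ℚ)))
      (Φ' := Φ + (k + 1 : ℕ) * (1 / (σ₀.v .bud : ℚ))) (o := Ld[k]) (d := d) (b := b) (N := N)
      hS ?_ ?_ ?_ (hΦk.trans hΦ') h.nodes h.marks (hLd _ (List.getElem_mem hkl)) ?_ ?_ ?_ ?_ hdn ?_
      hb1 hNn ?_ ?_ ?_ ?_ ?_ ?_ fun σ' hv hi' he' htop' hm' hM' hN' hseg' hmk' hI' => ?_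
    · exact h.inv.of_eq (fun _ _ => rfl) (fun _ _ => rfl) rfl rfl rfl rfl
        (by simp only [Cfg.wait]; omega)
    · split_ifs <;> omega
    · simp only [Cfg.wait, hbudσ]
      push_cast
      linarith
    · simp only [Cfg.wait]; omega
    · simp only [Cfg.wait]; omega
    · simp only [Cfg.wait, hiσ]; exact hread
    · exact (h.v _ (by simp [elementVars])).trans hd
    · exact (h.v _ (by simp [elementVars])).trans hb
    · simp only [Cfg.wait]; omega
    · simp only [Cfg.wait]; omega
    · simp only [Cfg.wait]; omega
    · simp only [Cfg.wait]; omega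
    · simp only [Cfg.wait, hnbσ]; exact h.seg
    · simp only [Cfg.wait, hnbσ]; exact h.marked
    · simp only [Cfg.wait, hnbσ, hhiσ, hiσ, htop] at hv hi' he' htop' hm' hseg' hmk'
      refine ⟨k + 1, insertNew N (restrict d b Ld[k]), by omega, ?_⟩
      constructor
      · rw [if_neg (by omega)]
        exact hI'.of_eq (fun _ _ => rfl) (fun _ _ => rfl) rfl rfl rfl rfl
          (by simp only [Cfg.wait]; omega)
      · exact fun a ha => (hv a ha).trans (h.v a ha)
      · simp only [Cfg.wait]; omega
      · simp only [Cfg.wait]; omega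
      · exact htop'
      · intro a ha1 ha2 ha3
        simp only [Cfg.wait]
        rw [hm' a ha1 (by omega) ha3, h.m a ha1 ha2 ha3]
      · exact hM'
      · exact hN'
      · exact hseg'
      · exact hmk'
      · exact nodup_insertNew h.nodup _
      · intro o
        rw [mem_insertNew, h.mem]
        constructor
        · rintro (⟨j, hj, hjk, rfl⟩ | rfl)
          · exact ⟨j, hj, by omega, rfl⟩
          · exact ⟨k, hkl, by omega, rfl⟩
        · rintro ⟨j, hj, hjk, rfl⟩
          rcases Nat.lt_succ_iff_lt_or_eq.1 hjk with h1 | rfl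
          · exact .inl ⟨j, hj, h1, rfl⟩
          · exact .inr rfl
      · intro hl _
        rcases Nat.eq_zero_or_pos k with rfl | hk0
        · have : N = [] := List.eq_nil_iff_forall_not_mem.2 fun o ho => by
            obtain ⟨j, -, hj, -⟩ := (h.mem o).1 ho
            omega
          subst this
          simp [insertNew]
        · exact head?_insertNew (h.head hl hk0)

/-! ### Restriction of a whole list -/

/-- The registers that change while a list is processed. -/
def listVars : List Var := [.u, .var, .t, .t1, .a, .p, .q, .y, .i, .e, .top,
  .ta, .tb, .tt, .tv, .ty, .tj, .cnt, .lo, .nb, .hi, .d]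

/-- A list for one more variable is put behind the other lists. -/
theorem Lists.extend {C : Ctx} {S : List Tm} {p : List ℕ} {base : ℕ → ℕ}
    {L : ℕ → List (Option Tm)} {m m' : ℕ → ℕ} (hS : IsTrie C S) (hF : ∀ l ∈ C.F, l ∈ S)
    (hp : p.length < C.n) {b : ℕ} {N : List (Option Tm)}
    (h : Lists C S p base L m) (hm : ∀ a, 65 + 5 * C.n ≤ a → a < base (p.length + 1) →
      (∀ o, HasNode S o → a ≠ C.ad S o + 3) → a ≠ 67 + 5 * C.n + p.length →
      a ≠ 68 + 6 * C.n + p.length → m' a = m a) (hN : ListFor C (p ++ [b]) N)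
    (hseg : Seg C S m' (base (p.length + 1)) N)
    (h1 : m' (67 + 5 * C.n + p.length) = base (p.length + 1) + N.length)
    (h2 : m' (68 + 6 * C.n + p.length) = base (p.length + 1) + N.length) :
    Lists C S (p ++ [b]) (Function.update base (p.length + 2) (base (p.length + 1) + N.length))
      (Function.update L (p.length + 1) N) m' := by
  have h' := h.of_eq hS hF hp hm
  have hlen : (p ++ [b]).length = p.length + 1 := by simp
  refine ⟨?_, ?_, fun j hj1 hj => ?_, ?_, fun j hj => ?_, fun j hj => ?_, fun j hj => ?_,
    fun j hj => ?_⟩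
  · rw [Function.update_of_ne (by omega), h'.base_zero]
  · rw [Function.update_of_ne (by omega), h'.base_one]
  · rw [hlen] at hj
    rcases Nat.lt_succ_iff_lt_or_eq.1 (Nat.lt_succ_of_le hj) with hj2 | rfl
    · rw [Function.update_of_ne (by omega), Function.update_of_ne (by omega),
        Function.update_of_ne (by omega), h'.base_succ j hj1 (by omega)]
    · rw [Function.update_self, Function.update_self, Function.update_of_ne (by omega)]
  · rw [Function.update_of_ne (by omega), Function.update_of_ne (by omega)]
    exact h'.zero_le
  · rw [hlen] at hj
    rcases Nat.lt_succ_iff_lt_or_eq.1 (Nat.lt_succ_of_le hj) with hj2 | rfl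
    · rw [Function.update_of_ne (by omega), List.take_append_of_le_length (by omega)]
      exact h'.listFor j (by omega)
    · rw [Function.update_self, ← hlen, List.take_length]
      exact hN
  · rw [hlen] at hj
    rcases Nat.lt_succ_iff_lt_or_eq.1 (Nat.lt_succ_of_le hj) with hj2 | rfl
    · rw [Function.update_of_ne (by omega), Function.update_of_ne (by omega)]
      exact h'.seg j (by omega)
    · rw [Function.update_self, Function.update_of_ne (by omega)]
      exact hseg
  · rw [hlen] at hj
    rcases Nat.lt_succ_iff_lt_or_eq.1 (Nat.lt_succ_of_le hj) with hj2 | rfl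
    · rw [Function.update_of_ne (by omega)]
      exact h'.bs j (by omega)
    · rw [Function.update_self, ← h1]
      congr 1; omega
  · rw [hlen] at hj
    rcases Nat.lt_succ_iff_lt_or_eq.1 (Nat.lt_succ_of_le hj) with hj2 | rfl
    · rw [Function.update_of_ne (by omega), Function.update_of_ne (by omega)]
      exact h'.be j (by omega)
    · rw [Function.update_self, Function.update_of_ne (by omega), ← h2]
      congr 1; omega

/-- The restriction of the elements of the list for `p` yields the list for `p ++ [b]`. -/
theorem ListFor.concat {C : Ctx} {p : List ℕ} {Ld N : List (Option Tm)} {b : ℕ}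
    (h : ListFor C p Ld) (hN : N.Nodup)
    (hmem : ∀ o, o ∈ N ↔ ∃ j, ∃ h : j < Ld.length, j < Ld.length ∧ o = restrict p.length b Ld[j])
    (hhead : ∀ h : 0 < Ld.length, 0 < Ld.length → N.head? = some (restrict p.length b Ld[0])) :
    ListFor C (p ++ [b]) N := by
  refine ⟨hN, fun o => ?_, ?_⟩
  · rw [hmem]
    constructor
    · rintro ⟨j, hj, -, rfl⟩
      obtain ⟨l, hl, h1⟩ := (h.mem _).1 (List.getElem_mem hj)
      exact ⟨l, hl, by rw [h1, restrictAll_concat (C.isTm l hl)]⟩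
    · rintro ⟨l, hl, rfl⟩
      obtain ⟨j, hj, h1⟩ := List.getElem_of_mem ((h.mem _).2 ⟨l, hl, rfl⟩)
      exact ⟨j, hj, hj, by rw [h1, restrictAll_concat (C.isTm l hl)]⟩
  · have h0 := h.head
    have hlen : 0 < Ld.length := by
      rcases Ld with _ | ⟨x, r⟩
      · simp at h0
      · simp
    rw [List.head?_eq_getElem?, List.getElem?_eq_getElem hlen, Option.some.injEq] at h0
    rw [hhead hlen hlen, h0, restrictAll_concat (C.isTm _ (by simp))]

/-- One more variable gets a value. The cost is one unit of work for each element of the list for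
`p`. -/
theorem wp_restrictList {C : Ctx} {S : List Tm} (hS : IsTrie C S) (hF : ∀ l ∈ C.F, l ∈ S)
    {σ : Cfg} {Q : Cfg → Prop} {Bs : List (List ℕ)} {Φ Φ' : ℚ} {e κ b : ℕ} {p : List ℕ}
    (h : SearchInv C S κ Bs Φ e p σ) (he : e ≤ 49) (hp : p.length < C.n) (hb1 : b ≤ 1)
    (hd : σ.v .d = p.length) (hb : σ.v .b = b) (hκ : ∀ l ∈ C.F, l.length ≤ κ)
    (hΦ : Φ + (numTm (C.n - p.length) κ + 1 : ℕ) * (1 / (σ.v .bud : ℚ)) ≤ Φ')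
    (hΦ' : Φ' ≤ 2 ^ C.nf)
    (hQ : ∀ σ' N, SearchInv C S κ Bs Φ' 10 (p ++ [b]) σ' → σ'.v .d = p.length + 1 →
      C.hp S ≤ σ'.v .nb → σ'.v .top = σ'.v .nb + N.length → σ'.v .top < C.bound →
      Seg C S σ'.m (σ'.v .nb) N → ListFor C (p ++ [b]) N →
      (∀ a ∉ listVars, σ'.v a = σ.v a) →
      (∀ a, 65 + 4 * C.n ≤ a → a < 65 + 5 * C.n → σ'.m a = σ.m a) → Q σ') :
    wp C.E Prog.restrictList Q σ := by
  have hnar := C.bound_lt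
  have h4 := four_le_sz C
  obtain ⟨hb1', hb2, hb3⟩ := hp_le_bound hS
  have hL := h.inv.lay
  obtain ⟨base, L, hLs⟩ := h.lists
  set d := p.length with hdd
  have hbl := hLs.base_le hS hF d le_rfl
  have hmul : (d + 2) * (C.nodes + 1) ≤ (C.n + 1) * (C.nodes + 1) :=
    Nat.mul_le_mul_right _ (by omega)
  have hmul1 : (d + 2) * (C.nodes + 1) = d * (C.nodes + 1) + 2 * (C.nodes + 1) := by ring
  have hmul2 : (C.n + 2) * (C.nodes + 2) = (C.n + 1) * (C.nodes + 1) + (C.n + 1) +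
    (C.nodes + 2) := by
    ring
  have hbs := hLs.bs d (by omega)
  have hbs1 := hLs.bs (d + 1) (by omega)
  have hbe := hLs.be d le_rfl
  have hLd : ListFor C p (L d) := by
    have := hLs.listFor d le_rfl
    rwa [hdd, List.take_length] at this
  have hLdn : ∀ o ∈ L d, HasNode S o := fun o ho => hLd.hasNode hS hF ho
  -- the position of the current list
  have hpos : 68 + 7 * C.n ≤ base d ∧ base d + (L d).length ≤ base (d + 1) ∧
      (base d + (L d).length ≤ C.dead ∨ C.hp S ≤ base d) := by
    rcases Nat.eq_zero_or_pos d with h0 | h0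
    · rw [h0, zero_add]
      have h1 := hLs.base_zero
      have h2 := hLs.base_one
      have h3 := hLs.zero_le
      omega
    · have h1 := hLs.base_succ d h0 le_rfl
      have h2 := (hLs.base_le hS hF (d - 1) (by omega)).1
      rw [Nat.sub_add_cancel h0] at h2
      omega
  obtain ⟨hpos1, hpos2, hpos3⟩ := hpos
  have e1 : 65 + 5 * C.n + d + 1 = 65 + 5 * C.n + (d + 1) := by ring
  simp (disch := omega) only [Prog.restrictList, wp_seq_iff, wp_op_iff, Op.Ok, Op.next, update_var,
    reduceCtorEq, if_false, if_true, ArithOp.eval, hL.zero, hL.one, hL.vb, hL.bs, hL.be, hd,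
    hb, update_mem_of_ne, e1, hbs, hbs1, hbe, add_zero]
  and_intros <;> try omega
  set σ₀ : Cfg := ⟨_, _, _, _⟩ with hσ₀
  have hv₀ : ∀ a ∉ listVars, σ₀.v a = σ.v a := by
    intro a ha
    simp only [listVars, List.mem_cons, List.not_mem_nil, not_or] at ha
    simp only [hσ₀, update_var, ha, if_false]
  have hm₀ : ∀ a, a ≠ 65 + 3 * C.n + d → σ₀.m a = σ.m a := fun a ha => update_mem_of_ne ha
  have h0i : σ₀.v .i = base d := by simp [hσ₀]
  have h0lo : σ₀.v .lo = base d := by simp [hσ₀]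
  have h0nb : σ₀.v .nb = base (d + 1) := by simp [hσ₀]
  have h0hi : σ₀.v .hi = base d + (L d).length := by simp [hσ₀]
  have h0top : σ₀.v .top = base (d + 1) := by simp [hσ₀]
  have h0e : σ₀.v .e = (L d).length := by simp [hσ₀]
  have h0d : σ₀.v .d = d := by simp [hσ₀, hd]
  have h0b : σ₀.v .b = b := by simp [hσ₀, hb]
  have h0cnt : σ₀.v .cnt = σ.v .cnt := by simp [hσ₀]
  have h0bud : σ₀.v .bud = σ.v .bud := hv₀ _ (by simp [listVars])
  have h0gap : σ₀.gap = σ.gap + 11 := rfl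
  have h0w : σ₀.words = σ.words := rfl
  have h0vb : σ₀.m (65 + 3 * C.n + d) = b := by simp [hσ₀]
  clear_value σ₀
  have hlen0 : 0 < (L d).length := by
    have := hLd.head
    rcases hLd : L d with _ | ⟨x, r⟩
    · simp [hLd] at this
    · simp
  have hadm : ∀ o, HasNode S o → 65 + 3 * C.n + d ≠ C.ad S o + 3 := fun o ho => by
    have := ad_lt_hp (C := C) ho (a := 3) (by omega)
    omega
  refine wp_elementLoop (Bs := Bs) (Φ := Φ) (Φ' := Φ') (d := d) (b := b) (Ld := L d) hS hLdn hp hb1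
    h0d h0b (by omega) (by omega) (by omega) (by omega) (by omega) (by omega) ?_ ?_ hΦ' ?_
    fun σ₁ N h1 => ?_
  · intro i hi
    rw [hm₀ _ (by omega), h0lo]
    have := hLs.seg d le_rfl i hi
    exact this
  · refine le_trans ?_ hΦ
    rw [h0bud]
    have h1 : ((L d).length : ℚ) ≤ (numTm (C.n - d) κ + 1 : ℕ) := by
      exact_mod_cast hLd.length_le_numTm hκ
    have h2 : (0 : ℚ) ≤ 1 / (σ.v .bud : ℚ) := by positivity
    have := mul_le_mul_of_nonneg_right h1 h2
    linarith
  · refine ⟨?_, fun _ _ => rfl, by omega, by omega, by simp [h0top, h0nb], fun _ _ _ _ => rfl, ?_,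
      ?_, ?_, ?_, List.nodup_nil, ?_, ?_⟩
    · refine (h.inv.of_eq ?_ ?_ ?_ ?_ ?_ h0w ?_ : Inv C Bs Φ 60 σ₀).mono ?_ (by simp)
      · intro a ha
        refine hv₀ _ fun h' => ?_
        revert ha h'
        cases a <;> simp [layVars, listVars]
      · intro a ha
        exact hm₀ _ (by omega)
      · exact h0cnt
      · exact h0bud
      · exact hv₀ _ (by simp [listVars])
      · omega
      · simp
    · intro o ho
      rw [hm₀ _ (hadm o ho).symm]
      exact h.marks o ho
    · exact h.nodes.of_eq fun a h1 h2 _ => hm₀ _ (by omega)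
    · intro i hi; simp at hi
    · intro i hi; simp at hi
    · simp
    · simp
  · have hL1 := h1.inv.lay
    have hNF : ListFor C (p ++ [b]) N := hLd.concat h1.nodup h1.mem h1.head
    have h1d : σ₁.v .d = d := (h1.v _ (by simp [elementVars])).trans h0d
    have h1nb : σ₁.v .nb = base (d + 1) := (h1.v _ (by simp [elementVars])).trans h0nb
    have h1top := h1.top
    rw [h0nb] at h1top
    have hNlen := length_le_of_hasNode h1.nodup fun o ho => hNF.hasNode hS hF ho
    have hSl := hS.length_le
    have e2 : 65 + 5 * C.n + (d + 1) + 1 = 67 + 5 * C.n + d := by ring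
    have e3 : 67 + 6 * C.n + (d + 1) = 68 + 6 * C.n + d := by ring
    have hinv : Inv C Bs Φ' 3 σ₁ := by
      have h2 := h1.inv
      rw [if_neg (by omega)] at h2
      refine h2.mono ?_ le_rfl
      refine le_trans ?_ hΦ
      rw [h0bud]
      have h1 : ((L d).length : ℚ) ≤ (numTm (C.n - d) κ + 1 : ℕ) := by
        exact_mod_cast hLd.length_le_numTm hκ
      have h2 : (0 : ℚ) ≤ 1 / (σ.v .bud : ℚ) := by positivity
      have := mul_le_mul_of_nonneg_right h1 h2
      linarith
    simp (disch := omega) only [wp_seq_iff, wp_op_iff, Op.Ok, Op.next, Cfg.wait, update_var,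
      reduceCtorEq, if_false, if_true, ArithOp.eval, hL1.one, hL1.bs, hL1.be, h1d, h1top, e2, e3]
    and_intros <;> try omega
    set σ₂ : Cfg := ⟨_, _, _, _⟩ with hσ₂
    have hv₂ : ∀ a ∉ listVars, σ₂.v a = σ.v a := by
      intro a ha
      rw [← hv₀ a ha]
      simp only [listVars, List.mem_cons, List.not_mem_nil, not_or] at ha
      simp only [hσ₂, update_var, ha, if_false]
      exact h1.v a (by simp [elementVars, ha])
    have h2d : σ₂.v .d = d + 1 := by simp [hσ₂]
    have h2nb : σ₂.v .nb = base (d + 1) := by simp [hσ₂, h1nb]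
    have h2top : σ₂.v .top = base (d + 1) + N.length := by simp [hσ₂, h1top]
    have h2m : ∀ a, a ≠ 68 + 6 * C.n + d → a ≠ 67 + 5 * C.n + d → σ₂.m a = σ₁.m a := by
      intro a ha1 ha2
      simp only [hσ₂]
      rw [update_mem_of_ne ha2, update_mem_of_ne ha1]
    have h2m1 : σ₂.m (68 + 6 * C.n + d) = base (d + 1) + N.length := by
      simp only [hσ₂]
      rw [update_mem_of_ne (by omega), Function.update_self]
    have h2m2 : σ₂.m (67 + 5 * C.n + d) = base (d + 1) + N.length := by
      simp only [hσ₂, Function.update_self]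
    have h2gap : σ₂.gap = σ₁.gap + 7 := rfl
    have h2w : σ₂.words = σ₁.words := rfl
    have h2v : ∀ a ∈ [Var.cnt, .bud, .rm], σ₂.v a = σ₁.v a := by
      intro a ha
      simp only [List.mem_cons, List.not_mem_nil, or_false] at ha
      rcases ha with rfl | rfl | rfl <;> simp [hσ₂]
    have h2lay : ∀ a ∈ layVars, σ₂.v a = σ₁.v a := by
      simp only [layVars, hσ₂, update_var]; simp
    clear_value σ₂
    -- the memory as seen from the start
    have h2m' : ∀ a, 65 + 3 * C.n ≤ a → a ≠ 65 + 3 * C.n + d → a < base (d + 1) →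
        (∀ o, HasNode S o → a ≠ C.ad S o + 3) → a ≠ 67 + 5 * C.n + d → a ≠ 68 + 6 * C.n + d →
        σ₂.m a = σ.m a := by
      intro a ha1 ha2 ha3 ha4 ha5 ha6
      rw [h2m a ha6 ha5, h1.m a ha1 (by omega) ha4, hm₀ a ha2]
    have h2seg : Seg C S σ₂.m (base (d + 1)) N := by
      intro i hi
      rw [h2m _ (by omega) (by omega), ← h0nb]
      exact h1.seg i hi
    refine hQ σ₂ N ⟨?_, ?_, ?_, ?_, ?_, ?_⟩ h2d (by omega) (by omega) (by omega)
      (by rw [h2nb]; exact h2seg) hNF hv₂ ?_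
    · refine hinv.of_eq h2lay (fun a ha => h2m _ (by omega) (by omega)) (h2v _ (by simp))
        (h2v _ (by simp)) (h2v _ (by simp)) h2w (by omega)
    · rw [hv₂ _ (by simp [listVars])]; exact h.rm
    · exact h1.nodes.of_eq fun a h1 h2 _ => h2m _ (by omega) (by omega)
    · intro o ho
      have := ad_lt_hp (C := C) ho (a := 3) (by omega)
      rw [h2m _ (by omega) (by omega)]
      exact h1.marks o ho
    · intro i hi
      simp only [List.length_append, List.length_singleton] at hi
      have hna : ∀ o, HasNode S o → 65 + 3 * C.n + i ≠ C.ad S o + 3 := fun o ho => by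
        have := ad_lt_hp (C := C) ho (a := 3) (by omega)
        omega
      rcases Nat.lt_succ_iff_lt_or_eq.1 hi with hi2 | rfl
      · rw [List.getElem_append_left hi2, ← h.vb i hi2]
        exact h2m' _ (by omega) (by omega) (by omega) hna (by omega) (by omega)
      · rw [h2m _ (by omega) (by omega), h1.m _ (by omega) (by omega) hna, h0vb]
        simp
    · refine ⟨_, _, hLs.extend hS hF hp (fun a ha1 ha2 ha3 ha4 ha5 => ?_) hNF h2seg h2m2 h2m1⟩
      exact h2m' a (by omega) (by omega) ha2 ha3 ha4 ha5
    · intro a ha1 ha2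
      refine h2m' a (by omega) (by omega) (by omega) (fun o ho => ?_) (by omega) (by omega)
      have := ad_lt_hp (C := C) ho (a := 3) (by omega)
      omega

/-! ### The search -/

theorem Lists.le_base {C : Ctx} {S : List Tm} {p : List ℕ} {base : ℕ → ℕ}
    {L : ℕ → List (Option Tm)} {m : ℕ → ℕ} (hS : IsTrie C S) (hF : ∀ l ∈ C.F, l ∈ S)
    (h : Lists C S p base L m) {j : ℕ} (hj : j ≤ p.length) : 68 + 7 * C.n ≤ base j := by
  obtain ⟨-, hb2, hb3⟩ := hp_le_bound hS
  rcases j with _ | j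
  · rw [h.base_zero]
  · have := (h.base_le hS hF j (by omega)).1
    omega

theorem Lists.congr {C : Ctx} {S : List Tm} {p : List ℕ} {base : ℕ → ℕ}
    {L : ℕ → List (Option Tm)} {m m' : ℕ → ℕ} (hS : IsTrie C S) (hF : ∀ l ∈ C.F, l ∈ S)
    (h : Lists C S p base L m) (hm : ∀ a, 65 + 5 * C.n ≤ a → m' a = m a) :
    Lists C S p base L m' where
  base_zero := h.base_zero
  base_one := h.base_one
  base_succ := h.base_succ
  zero_le := h.zero_le
  listFor := h.listFor
  seg j hj i hi := by
    have := h.le_base hS hF hj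
    rw [hm _ (by omega)]
    exact h.seg j hj i hi
  bs j hj := by rw [hm _ (by omega)]; exact h.bs j hj
  be j hj := by rw [hm _ (by omega)]; exact h.be j hj

theorem Lists.take {C : Ctx} {S : List Tm} {p : List ℕ} {base : ℕ → ℕ}
    {L : ℕ → List (Option Tm)} {m : ℕ → ℕ} (h : Lists C S p base L m) {d : ℕ}
    (hd : d ≤ p.length) : Lists C S (p.take d) base L m := by
  have hlen : (p.take d).length = d := by simp [hd]
  refine ⟨h.base_zero, h.base_one, fun j h1 h2 => h.base_succ j h1 (by omega), h.zero_le,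
    fun j hj => ?_, fun j hj => h.seg j (by omega), fun j hj => h.bs j (by omega),
    fun j hj => h.be j (by omega)⟩
  rw [List.take_take, min_eq_left (by omega)]
  exact h.listFor j (by omega)

namespace SearchInv
variable {C : Ctx} {S : List Tm} {κ : ℕ} {Bs : List (List ℕ)} {Φ : ℚ} {e : ℕ} {p : List ℕ}
  {σ σ' : Cfg}

theorem congr (hS : IsTrie C S) (hF : ∀ l ∈ C.F, l ∈ S) (h : SearchInv C S κ Bs Φ e p σ)
    (hp : p.length ≤ C.n) {e' : ℕ} (hv : ∀ a ∈ layVars ++ [.cnt, .bud, .rm], σ'.v a = σ.v a)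
    (hm : ∀ a, a < 65 + 4 * C.n ∨ 65 + 5 * C.n ≤ a → σ'.m a = σ.m a)
    (hw : σ'.words = σ.words) (hg : σ'.gap + e ≤ σ.gap + e') : SearchInv C S κ Bs Φ e' p σ' := by
  obtain ⟨-, hb2, hb3⟩ := hp_le_bound hS
  refine ⟨h.inv.of_eq (fun a ha => hv a (by simp [ha])) (fun a ha => hm a (by omega))
    (hv _ (by simp)) (hv _ (by simp)) (hv _ (by simp)) hw hg, ?_,
    h.nodes.of_eq fun a h1 _ _ => hm a (by omega), fun o ho => ?_, fun i hi => ?_, ?_⟩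
  · rw [hv _ (by simp)]; exact h.rm
  · have := ad_lt_hp (C := C) ho (a := 3) (by have := four_le_sz C; omega)
    rw [hm _ (by omega)]
    exact h.marks o ho
  · rw [hm _ (by omega)]
    exact h.vb i hi
  · obtain ⟨base, L, h1⟩ := h.lists
    exact ⟨base, L, h1.congr hS hF fun a ha => hm a (by omega)⟩

theorem take (h : SearchInv C S κ Bs Φ e p σ) {d : ℕ} (hd : d ≤ p.length) :
    SearchInv C S κ Bs Φ e (p.take d) σ := by
  refine ⟨h.inv, h.rm, h.nodes, h.marks, fun i hi => ?_, ?_⟩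
  · rw [List.getElem_take]
    exact h.vb i _
  · obtain ⟨base, L, h1⟩ := h.lists
    exact ⟨base, L, h1.take hd⟩

end SearchInv

/-- What one unit of work costs when all terms have at most `κ` literals. -/
def Ctx.unit (C : Ctx) (κ : ℕ) : ℚ := 1 / (16 * 2 ^ (C.T.length + κ))

theorem SearchInv.unit {C : Ctx} {S : List Tm} {κ : ℕ} {Bs : List (List ℕ)} {Φ : ℚ} {e : ℕ}
    {p : List ℕ} {σ : Cfg} (h : SearchInv C S κ Bs Φ e p σ) : 1 / (σ.v .bud : ℚ) = C.unit κ := by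
  rw [h.inv.bud, h.rm, Ctx.unit]
  push_cast
  rfl

/-- The assignment satisfies the formula, but not its first term. -/
def Ctx.IsExtra (C : Ctx) (q : List ℕ) : Prop :=
  restrictAll q C.T = none ∧ ∃ l ∈ C.F, restrictAll q l = some []

/-- The search stops at `p` to assign the value `b` to the next variable; `stk` lists the variables
for which the value `1` is to be explored later. -/
structure Task (C : Ctx) (S : List Tm) (κ : ℕ) (Bs : List (List ℕ)) (Φ : ℚ) (e : ℕ) (p : List ℕ)
    (b : ℕ) (stk : List ℕ) (σ : Cfg) : Prop where
  inv : SearchInv C S κ Bs Φ e p σ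
  d : σ.v .d = p.length
  b : σ.v .b = b
  go : σ.v .go ≠ 0
  sp : σ.v .sp = stk.length
  mem : ∀ i (h : i < stk.length), σ.m (65 + 4 * C.n + i) = stk[i]
  sorted : stk.Pairwise (· < ·)
  le : ∀ d ∈ stk, d ≤ p.length

/-- The next task has been taken from the stack `stk`, or the search is over. -/
structure Popped (C : Ctx) (S : List Tm) (κ : ℕ) (Bs : List (List ℕ)) (Φ : ℚ) (e : ℕ) (p : List ℕ)
    (stk : List ℕ) (σ : Cfg) : Prop where
  nil : stk = [] → Inv C Bs Φ e σ ∧ σ.v .go = 0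
  concat : ∀ stk' d, stk = stk' ++ [d] → Task C S κ Bs Φ e (p.take d) 1 stk' σ

/-- The stack does not outgrow its place in the memory. -/
theorem length_le_of_sorted {stk : List ℕ} (h : stk.Pairwise (· < ·)) {k : ℕ}
    (hk : ∀ d ∈ stk, d ≤ k) : stk.length ≤ k + 1 := by
  have h1 : stk.Subperm (List.range (k + 1)) :=
    List.Nodup.subperm (h.imp fun h => Nat.ne_of_lt h) fun d hd => List.mem_range.2
      (by have := hk d hd; omega)
  simpa using h1.length_le

/-- At a leaf at which the first term is falsified, the list consists of the falsified term and, if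
some other term is satisfied, the satisfied term. -/
theorem ListFor.one_lt_length_iff {C : Ctx} {q : List ℕ} {N : List (Option Tm)} (h : ListFor C q N)
    (hq : q.length = C.n) (hT : restrictAll q C.T = none) :
    1 < N.length ↔ ∃ l ∈ C.F, restrictAll q l = some [] := by
  have h0 := h.head
  rw [hT] at h0
  rcases hN : N with _ | ⟨o, _ | ⟨o', r⟩⟩
  · simp [hN] at h0
  · simp only [hN, List.head?_cons, Option.some.injEq] at h0
    simp only [List.length_singleton, lt_irrefl, false_iff]
    rintro ⟨l, hl, h1⟩
    have := (h.mem _).2 ⟨l, hl, h1.symm⟩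
    simp [hN, h0] at this
  · simp only [hN, List.head?_cons, Option.some.injEq] at h0
    simp only [List.length_cons, lt_add_iff_pos_left, add_pos_iff, zero_lt_one, or_true, true_iff]
    have hnd := h.nodup
    obtain ⟨l, hl, h1⟩ := (h.mem o').1 (by simp [hN])
    refine ⟨l, hl, ?_⟩
    rcases restrictAll_full (C.isTm l hl) hq with h2 | h2
    · exact h2.2
    · rw [hN] at hnd
      simp [h0, h1, h2.2] at hnd

theorem wp_pop {C : Ctx} {S : List Tm} (hS : IsTrie C S) (hF : ∀ l ∈ C.F, l ∈ S)
    {σ : Cfg} {Q : Cfg → Prop} {Bs : List (List ℕ)} {Φ : ℚ} {e κ : ℕ} {p stk : List ℕ}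
    (h : SearchInv C S κ Bs Φ e p σ) (hp : p.length = C.n) (hgo : σ.v .go ≠ 0)
    (hsp : σ.v .sp = stk.length)
    (hmem : ∀ i (h : i < stk.length), σ.m (65 + 4 * C.n + i) = stk[i])
    (hsort : stk.Pairwise (· < ·)) (hle : ∀ d ∈ stk, d < C.n)
    (hQ : ∀ σ', Popped C S κ Bs Φ (e + 10) p stk σ' → Q σ') :
    wp C.E (.ifz .sp (.const .go 0)
      (.sub .sp .sp .one ;; .add .a .st .sp ;; .load .d .a ;; .const .b 1)) Q σ := by
  have hL := h.inv.lay
  have hnar := C.bound_lt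
  obtain ⟨hb1, hb2, hb3⟩ := hp_le_bound hS
  have hlen : stk.length ≤ C.n := by
    rcases Nat.eq_zero_or_pos C.n with h0 | h0
    · rcases stk with _ | ⟨d, r⟩
      · simp
      · have := hle d (by simp)
        omega
    · have := length_le_of_sorted (k := C.n - 1) hsort fun d hd => by have := hle d hd; omega
      omega
  simp (disch := omega) only [wp_seq_iff, wp_op_iff, wp_ifz_iff, Op.Ok,
    Op.next, Cfg.wait, update_var, reduceCtorEq, if_false, if_true, true_and, ArithOp.eval, hL.one,
    hL.st]
  and_intros
  · intro h0
    refine hQ _ ⟨fun _ => ⟨h.inv.of_eq ?_ (fun _ _ => rfl) ?_ ?_ ?_ rfl ?_, ?_⟩,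
      fun stk' d hs => ?_⟩
    · simp only [layVars, update_var]; simp
    · simp
    · simp
    · simp
    · simp only; omega
    · simp
    · rw [hsp, hs] at h0
      simp at h0
  · intro h0
    and_intros <;> try omega
    refine hQ _ ⟨fun hs => ?_, fun stk' d hs => ?_⟩
    · rw [hsp, hs] at h0
      simp at h0
    · subst hs
      have hd : d < C.n := hle d (by simp)
      have hlen' : σ.v .sp - 1 = stk'.length := by rw [hsp]; simp
      have hread : σ.m (65 + 4 * C.n + stk'.length) = d := by
        rw [hmem _ (by simp)]; simp
      rw [hlen', hread]
      have htk : (p.take d).length = d := by simp; omega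
      refine ⟨?_, ?_, ?_, ?_, ?_, fun i hi => ?_, ?_, fun d' hd' => ?_⟩
      · refine (h.take (d := d) (by omega)).congr hS hF (by omega) ?_ (fun _ _ => rfl) rfl ?_
        · simp only [layVars, update_var]; simp
        · simp only; omega
      · simp; omega
      · simp
      · simpa [update_var] using hgo
      · simp
      · simp only
        rw [hmem i (by simp; omega), List.getElem_append_left hi]
      · exact (List.pairwise_append.1 hsort).1
      · rw [htk]
        exact ((List.pairwise_append.1 hsort).2.2 d' hd' d (by simp)).le

open Classical in
theorem wp_leaf {C : Ctx} {S : List Tm} (hS : IsTrie C S) (hF : ∀ l ∈ C.F, l ∈ S)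
    {σ : Cfg} {Q : Cfg → Prop} {Bs : List (List ℕ)} {Φ : ℚ} {e κ : ℕ} {p stk : List ℕ}
    {N : List (Option Tm)} (h : SearchInv C S κ Bs Φ e p σ) (he : e ≤ 20) (hΦ : Φ ≤ 2 ^ C.nf)
    (hp : p.length = C.n)
    (hnb : C.hp S ≤ σ.v .nb) (htop : σ.v .top = σ.v .nb + N.length) (hbd : σ.v .top < C.bound)
    (hseg : Seg C S σ.m (σ.v .nb) N) (hN : ListFor C p N) (hgo : σ.v .go ≠ 0)
    (hsp : σ.v .sp = stk.length)
    (hmem : ∀ i (h : i < stk.length), σ.m (65 + 4 * C.n + i) = stk[i])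
    (hsort : stk.Pairwise (· < ·)) (hle : ∀ d ∈ stk, d < C.n)
    (hQ : ∀ σ', Popped C S κ (Bs ++ [p].filter C.IsExtra) Φ 40 p stk σ' → Q σ') :
    wp C.E Prog.leaf Q σ := by
  have hL := h.inv.lay
  have hnar := C.bound_lt
  have hG := C.le_G
  obtain ⟨hb1, hb2, hb3⟩ := hp_le_bound hS
  have hgap := h.inv.gap_le hΦ (by omega)
  have hwne := h.inv.words_ne
  have hlen0 : 0 < N.length := by
    have := hN.head
    rcases N with _ | ⟨x, r⟩
    · simp at this
    · simp
  have h0 : N[0] = restrictAll p C.T := by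
    have := hN.head
    rwa [List.head?_eq_getElem?, List.getElem?_eq_getElem hlen0, Option.some.injEq] at this
  have hread : σ.m (σ.v .nb) = C.ad S (restrictAll p C.T) := by
    rw [← h0]; exact hseg 0 hlen0
  have hnode : HasNode S (restrictAll p C.T) := by
    rw [← h0]; exact hN.hasNode hS hF (List.getElem_mem hlen0)
  have hadr := ad_lt_hp (C := C) hnode (a := 0) (by have := four_le_sz C; omega)
  -- the end of the work at the leaf: the assignment has been output if necessary
  have fin : ∀ σ' : Cfg, SearchInv C S κ (Bs ++ [p].filter C.IsExtra) Φ 30 p σ' →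
      σ'.v .go ≠ 0 → σ'.v .sp = σ.v .sp → σ'.m = σ.m → wp C.E (.ifz .sp (.const .go 0)
      (.sub .sp .sp .one ;; .add .a .st .sp ;; .load .d .a ;; .const .b 1)) Q σ' :=
    fun σ' h1 h2 h3 h4 => wp_pop hS hF h1 hp h2 (h3.trans hsp) (by rw [h4]; exact hmem) hsort hle hQ
  have quiet : ¬ C.IsExtra p → Bs ++ [p].filter C.IsExtra = Bs := by
    intro h1; simp [h1]
  unfold Prog.leaf
  generalize Stmt.ifz .sp (Stmt.const .go 0)
    (.sub .sp .sp .one ;; .add .a .st .sp ;; .load .d .a ;; .const .b 1) = pop at fin ⊢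
  simp (disch := omega) only [wp_seq_iff, wp_op_iff, wp_ifz_iff, wp_skip_iff, Op.Ok, Op.next,
    Cfg.wait, update_var, reduceCtorEq, if_false, if_true, ArithOp.eval, hL.one, hL.vb,
    hL.vbe, hL.dead, hread, hwne]
  and_intros <;> try omega
  · intro ht
    have hT : restrictAll p C.T = none := by
      rcases ho : restrictAll p C.T with _ | l
      · rfl
      · rw [ho, Ctx.ad] at ht
        have : C.sz * 1 ≤ C.sz * (S.idxOf l + 1) := Nat.mul_le_mul_left _ (by omega)
        have := four_le_sz C
        omega
    have hlen := hN.one_lt_length_iff hp hT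
    and_intros <;> try omega
    · intro h1
      refine fin _ ?_ (by simpa using hgo) (by simp) rfl
      rw [quiet fun h2 => by have := hlen.2 h2.2; omega]
      refine h.congr hS hF hp.le ?_ (fun _ _ => rfl) rfl ?_
      · simp only [layVars, update_var]; simp
      · simp only; omega
    · intro h1
      refine ⟨⟨by omega, by omega⟩, fin _ ?_ (by simpa using hgo) (by simp) rfl⟩
      have hx : C.IsExtra p := ⟨hT, hlen.1 (by omega)⟩
      have hword : (List.range' (65 + 3 * C.n) (64 + 4 * C.n + 1 -
        (65 + 3 * C.n))).map σ.m = p := by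
        refine List.ext_getElem (by simp; omega) fun i hi1 hi2 => ?_
        simp only [List.getElem_map, List.getElem_range', one_mul]
        exact h.vb i hi2
      rw [hword, show [p].filter C.IsExtra = [p] by simpa using hx]
      obtain ⟨i, g1, g2, g3, g4, g5⟩ := h.inv.gray
      refine ⟨⟨hL.of_eq ?_, ⟨i, g1, g2, ?_, ?_⟩, ?_, ?_, ?_⟩, ?_, h.nodes, h.marks, h.vb, h.lists⟩
      · simp only [layVars, update_var]; simp
      · rw [← List.append_assoc]
        exact g3.append_right [p]
      · simpa [update_var] using ⟨g4, g5⟩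
      · simpa [update_var] using h.inv.bud
      · simpa [update_var] using h.inv.rm
      · simp
      · simpa [update_var] using h.rm
  · intro ht
    refine fin _ ?_ (by simpa using hgo) (by simp) rfl
    rw [quiet fun h2 => by rw [h2.1, Ctx.ad] at ht; omega]
    refine h.congr hS hF hp.le ?_ (fun _ _ => rfl) rfl ?_
    · simp only [layVars, update_var]; simp
    · simp only; omega

open Classical in
/-- Exploring the value `b` of the variable behind `p`, and everything below, yields the extra
models below, and costs `work κ m`. -/
theorem wp_task {C : Ctx} {S : List Tm} (hS : IsTrie C S) (hF : ∀ l ∈ C.F, l ∈ S) {κ : ℕ}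
    (hκ : ∀ l ∈ C.F, l.length ≤ κ) {body : Stmt} {Q : Cfg → Prop}
    (hbody : body = (Prog.restrictList ;; .sub .t .n .d ;;
     .ifz .t Prog.leaf (.add .a .st .sp ;; .store .a .d ;; .add .sp .sp .one ;; .const .b 0)))
    (m : ℕ) : ∀ {σ : Cfg} {Bs : List (List ℕ)} {Φ Φ' : ℚ} {b : ℕ} {p stk : List ℕ},
      p.length + 1 + m = C.n → b ≤ 1 → Task C S κ Bs Φ 42 p b stk σ →
      Φ + work κ m * C.unit κ ≤ Φ' → Φ' ≤ 2 ^ C.nf →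
      (∀ σ', Popped C S κ (Bs ++ (leaves (p ++ [b]) m).filter C.IsExtra) Φ' 42 p stk σ' →
        wp C.E (.loop .go body) Q σ') →
      wp C.E (.loop .go body) Q σ := by
  have hu : 0 ≤ C.unit κ := by unfold Ctx.unit; positivity
  have hnar := C.bound_lt
  obtain ⟨hb1, hb2, hb3⟩ := hp_le_bound hS
  have hseq : ∀ R τ, wp C.E body R τ ↔ wp C.E Prog.restrictList (wp C.E (.sub .t .n .d ;;
     .ifz .t Prog.leaf (.add .a .st .sp ;; .store .a .d ;; .add .sp .sp .one ;; .const .b 0)) R)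
       τ :=
    fun R τ => by rw [hbody]; exact wp_seq_iff
  induction m with
  | zero =>
    intro σ Bs Φ Φ' b p stk hp hb h hΦ hΦ' hQ
    have hstk : ∀ d ∈ stk, d < C.n := fun d hd => by have := h.le d hd; omega
    refine wp_loop (fun h0 => absurd h0 h.go) fun _ => ?_
    refine (hseq _ _).2 ?_
    refine wp_restrictList (p := p) (b := b) (Φ' := Φ') hS hF
      (h.inv.congr (σ' := σ.wait 1) (e' := 43) hS hF (by omega) (fun _ _ => rfl)
        (fun _ _ => rfl) rfl
        (by simp only [Cfg.wait]; omega)) (by omega) (by omega) hb h.d h.b hκ ?_ hΦ'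
      fun σ₁ N h1 hd1 hnb1 htop1 hbd1 hseg1 hN1 hv1 hm1 => ?_
    · simp only [Cfg.wait]
      rw [h.inv.unit]
      refine le_trans (le_of_eq ?_) hΦ
      rw [show C.n - p.length = 1 by omega]
      rfl
    · have hL1 := h1.inv.lay
      have hlen : (p ++ [b]).length = C.n := by simp; omega
      simp (disch := omega) only [wp_seq_iff, wp_op_iff, wp_ifz_iff, Op.Ok, Op.next, Cfg.wait,
        update_var, if_true, ArithOp.eval, hL1.n, hd1]
      and_intros <;> try omega
      intro _
      refine wp_leaf (κ := κ) (p := p ++ [b]) (stk := stk) (N := N) (e := 12) (Φ := Φ')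
        (Bs := Bs) hS hF ?_
        (by omega) hΦ' hlen ?_ ?_ ?_ ?_ hN1 ?_ ?_ ?_ h.sorted hstk fun σ₂ h2 => ?_
      · refine h1.congr hS hF hlen.le ?_ (fun _ _ => rfl) rfl ?_
        · simp only [layVars, update_var]; simp
        · simp only; omega
      · simpa using hnb1
      · simpa using htop1
      · simpa using hbd1
      · simpa using hseg1
      · simpa [hv1 .go (by simp [listVars]), Cfg.wait] using h.go
      · simpa [hv1 .sp (by simp [listVars]), Cfg.wait] using h.sp
      · intro i hi
        have := length_le_of_sorted h.sorted h.le
        simp only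
        rw [hm1 _ (by omega) (by omega)]
        exact h.mem i hi
      · refine hQ _ ⟨fun hs => ?_, fun stk' d hs => ?_⟩
        · obtain ⟨h3, h4⟩ := h2.nil hs
          exact ⟨h3.of_eq (fun _ _ => rfl) (fun _ _ => rfl) rfl rfl rfl rfl
            (by simp only; omega), h4⟩
        · have h3 := h2.concat stk' d hs
          have hd : d ≤ p.length := h.le d (by simp [hs])
          rw [List.take_append_of_le_length hd] at h3
          refine ⟨?_, h3.d, h3.b, h3.go, h3.sp, h3.mem, h3.sorted, h3.le⟩
          exact h3.inv.congr hS hF (by simp; omega) (fun _ _ => rfl) (fun _ _ => rfl) rfl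
            (by simp only; omega)
  | succ m ih =>
    intro σ Bs Φ Φ' b p stk hp hb h hΦ hΦ' hQ
    set Φ₁ := Φ + (numTm (m + 2) κ + 1 : ℕ) * C.unit κ with hΦ₁
    set Φ₂ := Φ₁ + work κ m * C.unit κ with hΦ₂
    have hw : 0 ≤ work κ m * C.unit κ := by positivity
    have h21 : Φ₂ + work κ m * C.unit κ ≤ Φ' := by
      refine le_trans (le_of_eq ?_) hΦ
      rw [hΦ₂, hΦ₁, work]
      push_cast
      ring
    refine wp_loop (fun h0 => absurd h0 h.go) fun _ => ?_
    refine (hseq _ _).2 ?_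
    refine wp_restrictList (p := p) (b := b) (Φ' := Φ₁) hS hF
      (h.inv.congr (σ' := σ.wait 1) (e' := 43) hS hF (by omega) (fun _ _ => rfl)
        (fun _ _ => rfl) rfl
        (by simp only [Cfg.wait]; omega)) (by omega) (by omega) hb h.d h.b hκ ?_ (by linarith)
      fun σ₁ N h1 hd1 hnb1 htop1 hbd1 hseg1 hN1 hv1 hm1 => ?_
    · simp only [Cfg.wait]
      rw [h.inv.unit, show C.n - p.length = m + 2 by omega]
    · have hL1 := h1.inv.lay
      have hlen : (p ++ [b]).length = p.length + 1 := by simp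
      have hsl := length_le_of_sorted h.sorted h.le
      have hsp1 : σ₁.v .sp = stk.length := by rw [hv1 .sp (by simp [listVars])]; exact h.sp
      have hgo1 : σ₁.v .go ≠ 0 := by rw [hv1 .go (by simp [listVars])]; exact h.go
      simp (disch := omega) only [wp_seq_iff, wp_op_iff, wp_ifz_iff, Op.Ok, Op.next, Cfg.wait,
        update_var, reduceCtorEq, if_false, if_true, true_and, ArithOp.eval, hL1.n, hd1,
          hL1.st, hL1.one,
        hsp1]
      and_intros <;> try omega
      intro _
      and_intros <;> try omega
      refine ih (Bs := Bs) (Φ := Φ₁) (Φ' := Φ₂) (b := 0) (p := p ++ [b]) (stk := stk ++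
        [p.length + 1]) (by simp; omega)
        (by omega) ⟨?_, ?_, ?_, ?_, ?_, ?_, ?_, ?_⟩ (le_refl _) (by linarith) fun σ₂ h2 => ?_
      · refine h1.congr hS hF (by omega) ?_ (fun a ha => update_mem_of_ne (by omega)) rfl ?_
        · simp only [layVars, update_var]; simp
        · simp only; omega
      · simp [hd1]
      · simp
      · simpa [update_var] using hgo1
      · simp
      · intro i hi
        simp only [List.length_append, List.length_singleton] at hi
        rcases Nat.lt_succ_iff_lt_or_eq.1 hi with h3 | rfl
        · simp only
          rw [update_mem_of_ne (by omega), hm1 _ (by omega) (by omega),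
            List.getElem_append_left h3]
          exact h.mem i h3
        · simp
      · refine List.pairwise_append.2 ⟨h.sorted, by simp, fun x hx y hy => ?_⟩
        have := h.le x hx
        simp only [List.mem_singleton] at hy
        omega
      · intro x hx
        rw [List.mem_append, List.mem_singleton] at hx
        rcases hx with hx | rfl
        · have := h.le x hx
          omega
        · omega
      · have h3 := h2.concat stk _ rfl
        rw [List.take_of_length_le (by omega)] at h3
        refine ih (Φ' := Φ') (b := 1) (p := p ++ [b]) (stk := stk) (by simp; omega)
          (by omega) h3 h21 hΦ' fun σ₃ h4 => ?_
        refine hQ _ ⟨fun hs => ?_, fun stk' d hs => ?_⟩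
        · rw [leaves, List.filter_append, ← List.append_assoc]
          exact h4.nil hs
        · have h5 := h4.concat stk' d hs
          rw [List.take_append_of_le_length (h.le d (by simp [hs]))] at h5
          rw [leaves, List.filter_append, ← List.append_assoc]
          exact h5

open Classical in
/-- The search outputs the extra models. -/
theorem wp_search {C : Ctx} {S : List Tm} (hS : IsTrie C S) (hF : ∀ l ∈ C.F, l ∈ S) {κ : ℕ}
    (hκ : ∀ l ∈ C.F, l.length ≤ κ) {σ : Cfg} {Q : Cfg → Prop} {Φ Φ' : ℚ} {e : ℕ}
    {L : List (Option Tm)}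
    (hI : Inv C [] Φ e σ) (he : e ≤ 20) (hrm : σ.v .rm = κ) (hnodes : Nodes C S σ.m)
    (hmarks : MarkBound C S σ.m) (hL : ListFor C [] L) (hseg : Seg C S σ.m (68 + 7 * C.n) L)
    (hlp : σ.v .lp = 68 + 7 * C.n + L.length) (hlen : L.length ≤ C.F.length)
    (hhp : σ.v .hp = C.hp S) (hΦ : Φ + 2 ^ (C.n + κ + 3) * C.unit κ ≤ Φ') (hΦ' : Φ' ≤ 2 ^ C.nf)
    (hQ : ∀ σ', Inv C ((leaves [] C.n).filter C.IsExtra) Φ' 43 σ' → Q σ') :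
    wp C.E Prog.search Q σ := by
  have hu : 0 ≤ C.unit κ := by unfold Ctx.unit; positivity
  have hnar := C.bound_lt
  obtain ⟨hb1, hb2, hb3⟩ := hp_le_bound hS
  have hLay := hI.lay
  have h4 := four_le_sz C
  unfold Prog.search
  generalize hbd : (Prog.restrictList ;; Stmt.sub .t .n .d ;;
     .ifz .t Prog.leaf (.add .a .st .sp ;; .store .a .d ;; .add .sp .sp .one ;; .const .b 0)) = body
  simp (disch := omega) only [wp_seq_iff, wp_op_iff, Op.Ok, Op.next,
    update_var, reduceCtorEq, if_false, if_true, true_and, ArithOp.eval, hLay.zero, hLay.one,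
      hLay.l0, hLay.bs,
    hLay.be, hLay.st, hLay.n, hlp, hhp, add_zero]
  and_intros <;> try omega
  set σ₀ : Cfg := ⟨_, _, _, _⟩ with hσ₀
  have hm₀ : ∀ a, a ≠ 65 + 5 * C.n → a ≠ 67 + 6 * C.n → a ≠ 66 + 5 * C.n → a ≠ 65 + 4 * C.n →
      σ₀.m a = σ.m a := by
    intro a h1 h2 h3 h4
    simp (disch := omega) only [hσ₀, update_mem_of_ne]
  have hI₀ : Inv C [] Φ 30 σ₀ := by
    refine hI.of_eq ?_ (fun a ha => hm₀ a (by omega) (by omega) (by omega) (by omega))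
      ?_ ?_ ?_ rfl ?_
    · simp only [hσ₀, layVars, update_var]; simp
    · simp [hσ₀]
    · simp [hσ₀]
    · simp [hσ₀]
    · simp only [hσ₀]; omega
  have hgo : σ₀.v .go = C.n := by simp [hσ₀]
  rcases Nat.eq_zero_or_pos C.n with hn | hn
  · refine wp_loop (fun _ => hQ _ ?_) fun h => absurd (hgo.trans hn) h
    have : (leaves [] C.n).filter C.IsExtra = [] := by
      rw [hn, leaves, List.filter_eq_nil_iff]
      simp only [List.mem_singleton, decide_eq_true_eq]
      rintro _ rfl ⟨h1, -⟩
      rw [restrictAll_nil] at h1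
      simp at h1
    rw [this]
    refine (hI₀.mono ?_ le_rfl).of_eq (e' := 43) (fun _ _ => rfl) (fun _ _ => rfl) rfl
      rfl rfl rfl ?_
    rotate_left
    · simp only [Cfg.wait]; omega
    · have : 0 ≤ (2 : ℚ) ^ (C.n + κ + 3) * C.unit κ := by positivity
      linarith
  have htask : Task C S κ [] Φ 42 [] 0 [0] σ₀ := by
    refine ⟨⟨hI₀.mono le_rfl (by omega), ?_, ?_, fun o ho => ?_, fun i hi => by simp at hi,
      fun j => if j = 0 then 68 + 7 * C.n else C.hp S, fun _ => L, ?_⟩, ?_, ?_, ?_, ?_, ?_, ?_, ?_⟩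
    · simpa [hσ₀] using hrm
    · exact hnodes.of_eq fun a h1 _ _ => hm₀ a (by omega) (by omega) (by omega) (by omega)
    · have := ad_lt_hp (C := C) ho (a := 3) (by omega)
      rw [hm₀ _ (by omega) (by omega) (by omega) (by omega)]
      exact hmarks o ho
    · refine ⟨rfl, rfl, fun j h1 h2 => ?_, ?_, fun j hj => ?_, fun j hj i hi => ?_, fun j hj => ?_,
        fun j hj => ?_⟩
      · simp only [List.length_nil] at h2; omega
      · simp only [if_true, Ctx.dead]; omega
      · simpa using hL
      · simp only [List.length_nil, Nat.le_zero] at hj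
        simp only [hj, if_true]
        have : 68 + 7 * C.n + L.length ≤ C.dead := by simp only [Ctx.dead]; omega
        rw [hm₀ _ (by omega) (by omega) (by omega) (by omega)]
        exact hseg i hi
      · simp only [List.length_nil, zero_add] at hj
        interval_cases j
        · simp (disch := omega) [hσ₀]
        · simp (disch := omega) [hσ₀]
      · simp only [List.length_nil, Nat.le_zero] at hj
        simp (disch := omega) [hσ₀, hj]
    · simp [hσ₀]
    · simp [hσ₀]
    · omega
    · simp [hσ₀]
    · intro i hi
      simp only [List.length_singleton, Nat.lt_one_iff] at hi
      subst hi
      simp (disch := omega) [hσ₀]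
    · simp
    · simp
  obtain ⟨m, hm⟩ : ∃ m, C.n = m + 1 := ⟨C.n - 1, by omega⟩
  have hwork : (work κ m : ℚ) + work κ m ≤ 2 ^ (C.n + κ + 3) := by
    have h1 := work_le κ m
    have h2 : 2 ^ (C.n + κ + 3) = 2 ^ (m + κ + 3) + 2 ^ (m + κ + 3) := by rw [hm]; ring
    have h3 : work κ m + work κ m ≤ 2 ^ (C.n + κ + 3) := by omega
    exact_mod_cast h3
  have hwork' := mul_le_mul_of_nonneg_right hwork hu
  have hw : 0 ≤ work κ m * C.unit κ := by positivity
  rw [add_mul] at hwork'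
  refine wp_task hS hF hκ hbd.symm m (Φ' := Φ + work κ m * C.unit κ) (by simp; omega)
    (by omega) htask
    le_rfl (by linarith) fun σ₁ h1 => ?_
  refine wp_task hS hF hκ hbd.symm m (Φ' := Φ') (by simp; omega) (by omega) (h1.concat [] 0 rfl)
    (by linarith) hΦ' fun σ₂ h2 => ?_
  obtain ⟨h3, h4⟩ := h2.nil rfl
  refine wp_loop (fun _ => hQ _ ?_) fun h => absurd h4 h
  rw [hm, leaves, List.filter_append]
  exact h3.of_eq (fun _ _ => rfl) (fun _ _ => rfl) rfl rfl rfl rfl (by simp only [Cfg.wait]; omega)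

/-! ### Construction of the trie -/

/-- The terms without a node are added at the end. -/
theorem ad_of_prefix {C : Ctx} {S S' : List Tm} (h : S <+: S') {o : Option Tm} (ho : HasNode S o) :
    C.ad S' o = C.ad S o := by
  obtain ⟨r, rfl⟩ := h
  cases o with
  | none => rfl
  | some l => simp only [Ctx.ad, List.idxOf_append_of_mem (ho l rfl)]

/-- The memory holds the trie `S` of suffixes of terms, with empty marks and with the tables of
children that are needed to extend it. -/
structure Built (C : Ctx) (S : List Tm) (m : ℕ → ℕ) : Prop where
  trie : IsTrie C S
  suffix : ∀ l ∈ S, ∃ t ∈ C.F, l <:+ t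
  var_none : m C.dead = C.n
  var_nil : m (C.ad S (some [])) = C.n
  var : ∀ x l, x :: l ∈ S → m (C.ad S (some (x :: l))) = x.1
  succ : ∀ x l, x :: l ∈ S → m (C.ad S (some (x :: l)) + 1 + x.2) = C.ad S (some l)
  fail : ∀ x l, x :: l ∈ S → m (C.ad S (some (x :: l)) + 2 - x.2) = C.dead
  mark : ∀ o, HasNode S o → m (C.ad S o + 3) = 0
  child : ∀ l ∈ S, ∀ v < C.n, ∀ s ≤ 1, m (C.ad S (some l) + 4 + 2 * v + s) =
    if (v, s) :: l ∈ S then C.ad S (some ((v, s) :: l)) else 0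
  zero : ∀ a, C.hp S ≤ a → m a = 0

theorem hasNode_some {S : List Tm} {l : Tm} (h : l ∈ S) : HasNode S (some l) := by
  rintro _ ⟨⟩; exact h

theorem IsTrie.nil_mem {C : Ctx} {S : List Tm} (h : IsTrie C S) : [] ∈ S :=
  List.mem_of_mem_head? h.head

theorem Built.nodes {C : Ctx} {S : List Tm} {m : ℕ → ℕ} (h : Built C S m) : Nodes C S m := by
  have hnil := h.trie.nil_mem
  refine ⟨fun o ho => ?_, fun o ho d hd h1 b hb => ?_, fun o ho d hd h1 b => ?_⟩
  · rcases o with _ | (_ | ⟨x, l⟩)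
    · exact h.var_none.le
    · exact h.var_nil.le
    · rw [h.var x l (ho _ rfl)]
      have := (h.trie.isTm _ (ho _ rfl)).2 x (by simp)
      omega
  · rcases o with _ | (_ | ⟨x, l⟩)
    · rw [show C.ad S none = C.dead from rfl, h.var_none] at h1; omega
    · rw [h.var_nil] at h1; omega
    · have hx := h.trie.isTm _ (ho _ rfl)
      have hx2 := (hx.2 x (by simp)).2.2
      rw [h.var x l (ho _ rfl)] at h1
      simp only [restrict, if_pos h1]
      split_ifs with h2
      · rw [← h2]; exact h.succ x l (ho _ rfl)
      · rw [show C.ad S none = C.dead from rfl, ← h.fail x l (ho _ rfl)]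
        congr 1; omega
  · rcases o with _ | (_ | ⟨x, l⟩)
    · rfl
    · rfl
    · rw [h.var x l (ho _ rfl)] at h1
      simp only [restrict, if_neg h1]

theorem Built.markBound {C : Ctx} {S : List Tm} {m : ℕ → ℕ} (h : Built C S m) :
    MarkBound C S m := by
  obtain ⟨h1, h2, -⟩ := hp_le_bound h.trie
  have h3 : 0 < C.bound := by simp only [Ctx.bound]; omega
  intro o ho
  rw [h.mark o ho]
  exact h3

theorem Built.of_eq {C : Ctx} {S : List Tm} {m m' : ℕ → ℕ} (h : Built C S m)
    (hm : ∀ a, C.dead ≤ a → m' a = m a) : Built C S m' := by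
  have key : ∀ o a, m' (C.ad S o + a) = m (C.ad S o + a) := fun o a => by
    refine hm _ ?_
    cases o with
    | none => exact Nat.le_add_right _ _
    | some l => simp only [Ctx.ad]; omega
  have key0 : ∀ o, m' (C.ad S o) = m (C.ad S o) := fun o => key o 0
  refine ⟨h.trie, h.suffix, (hm _ le_rfl).trans h.var_none, (key0 _).trans h.var_nil,
    fun x l hx => (key0 _).trans (h.var x l hx), fun x l hx => ?_, fun x l hx => ?_, fun o ho => ?_,
    fun l hl v hv s hs => ?_, fun a ha => (hm _ ?_).trans (h.zero a ha)⟩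
  · rw [add_assoc, key, ← add_assoc]; exact h.succ x l hx
  · have hx2 := ((h.trie.isTm _ hx).2 x (by simp)).2.2
    rw [Nat.add_sub_assoc (by omega), key, ← Nat.add_sub_assoc (by omega)]; exact h.fail x l hx
  · rw [key]; exact h.mark o ho
  · rw [add_assoc, add_assoc, key, ← add_assoc, ← add_assoc]; exact h.child l hl v hv s hs
  · have := (hp_le_bound h.trie).2.2
    omega

/-- The number of suffixes of terms is at most `nodes`. -/
theorem length_le_nodes {C : Ctx} {S : List Tm} (hS : S.Nodup)
    (h : ∀ l ∈ S, ∃ t ∈ C.F, l <:+ t) : S.length ≤ C.nodes := by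
  have h1 : S.Subperm ([] :: C.F.flatMap fun t => (List.range t.length).map t.drop) := by
    refine hS.subperm fun l hl => ?_
    obtain ⟨t, ht, r, rfl⟩ := h l hl
    rcases l with _ | ⟨x, l⟩
    · simp
    · refine List.mem_cons_of_mem _ (List.mem_flatMap.2 ⟨_, ht, List.mem_map.2 ⟨r.length, ?_, ?_⟩⟩)
      · simp
      · simp
  have h2 := h1.length_le
  simpa [Ctx.nodes, List.length_flatMap, Function.comp_def] using h2

theorem IsTrie.concat {C : Ctx} {S : List Tm} (hS : IsTrie C S)
    (hsuf : ∀ l ∈ S, ∃ t ∈ C.F, l <:+ t) {x : ℕ × ℕ} {l t : Tm} (hl : l ∈ S) (hx : x :: l ∉ S)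
    (ht : t ∈ C.F) (hxt : x :: l <:+ t) :
    IsTrie C (S ++ [x :: l]) ∧ ∀ l' ∈ S ++ [x :: l], ∃ t ∈ C.F, l' <:+ t := by
  have hsuf' : ∀ l' ∈ S ++ [x :: l], ∃ t ∈ C.F, l' <:+ t := by
    intro l' hl'
    rw [List.mem_append, List.mem_singleton] at hl'
    rcases hl' with hl' | rfl
    · exact hsuf l' hl'
    · exact ⟨t, ht, hxt⟩
  have hnd : (S ++ [x :: l]).Nodup := by
    rw [List.nodup_append]
    refine ⟨hS.nodup, by simp, fun a ha b hb => ?_⟩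
    rw [List.mem_singleton] at hb
    rintro rfl
    exact hx (hb ▸ ha)
  refine ⟨⟨hnd, fun l' hl' => ?_, fun y l' hl' => ?_, ?_, length_le_nodes hnd hsuf'⟩, hsuf'⟩
  · obtain ⟨t, ht, hlt⟩ := hsuf' l' hl'
    have := C.isTm t ht
    exact ⟨this.1.sublist hlt.sublist, fun z hz => this.2 z (hlt.subset hz)⟩
  · rw [List.mem_append, List.mem_singleton] at hl' ⊢
    rcases hl' with hl' | hl'
    · exact .inl (hS.closed y l' hl')
    · obtain ⟨-, rfl⟩ := List.cons.inj hl'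
      exact .inl hl
  · rw [List.head?_append, hS.head]; rfl

theorem hp_concat (C : Ctx) (S : List Tm) (l : Tm) : C.hp (S ++ [l]) = C.hp S + C.sz := by
  simp only [Ctx.hp, List.length_append, List.length_singleton]; ring

theorem ad_concat (C : Ctx) {S : List Tm} {l : Tm} (hl : l ∉ S) :
    C.ad (S ++ [l]) (some l) = C.hp S := by
  simp only [Ctx.ad, Ctx.hp, List.idxOf_append_of_notMem hl]; simp

/-- The memory after the creation of the node for `x :: l`. -/
theorem Built.concat {C : Ctx} {S : List Tm} {m m' : ℕ → ℕ} (h : Built C S m) {x : ℕ × ℕ} {l t : Tm}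
    (hl : l ∈ S) (hx : x :: l ∉ S) (ht : t ∈ C.F) (hxt : x :: l <:+ t)
    (h1 : m' (C.ad S (some l) + 4 + 2 * x.1 + x.2) = C.hp S) (h2 : m' (C.hp S) = x.1)
    (h3 : m' (C.hp S + 1 + x.2) = C.ad S (some l)) (h4 : m' (C.hp S + 2 - x.2) = C.dead)
    (hm : ∀ a, C.dead ≤ a → a ≠ C.ad S (some l) + 4 + 2 * x.1 + x.2 → a ≠ C.hp S →
      a ≠ C.hp S + 1 + x.2 → a ≠ C.hp S + 2 - x.2 → m' a = m a) :
    Built C (S ++ [x :: l]) m' := by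
  obtain ⟨hS', hsuf'⟩ := h.trie.concat h.suffix hl hx ht hxt
  have hpre : S <+: S ++ [x :: l] := List.prefix_append _ _
  have hx' : x.1 < C.n ∧ x.2 ≤ 1 := by
    have := (C.isTm t ht).2 x (hxt.subset (by simp))
    omega
  have hsz : C.sz = 2 * C.n + 4 := rfl
  have hln := hasNode_some hl
  have hnew := ad_concat C hx
  -- the old nodes have changed only in the table of children of `l`
  have old : ∀ o, HasNode S o → ∀ c < C.sz, (o = some l → c ≠ 4 + 2 * x.1 + x.2) →
      m' (C.ad (S ++ [x :: l]) o + c) = m (C.ad S o + c) := by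
    intro o ho c hc hne
    rw [ad_of_prefix hpre ho]
    have := ad_lt_hp (C := C) ho hc
    refine hm _ (by omega) (fun heq => ?_) (by omega) (by omega) (by omega)
    obtain ⟨rfl, h5⟩ := ad_inj ho hln (a := c) (b := 4 + 2 * x.1 + x.2) hc (by omega) (by omega)
    exact hne rfl h5
  have old0 : ∀ o, HasNode S o → m' (C.ad (S ++ [x :: l]) o) = m (C.ad S o) := fun o ho =>
    old o ho 0 (by omega) fun _ => by omega
  have hcases : ∀ y l', y :: l' ∈ S ++ [x :: l] → y :: l' ∈ S ∨ y = x ∧ l' = l := by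
    intro y l' hy
    rw [List.mem_append, List.mem_singleton] at hy
    exact hy.imp_right fun h => List.cons.inj h
  have hdead := (hp_le_bound h.trie).2.2
  have fresh : ∀ a, C.hp S + 3 ≤ a → m' a = 0 := by
    intro a ha
    have := ad_lt_hp (C := C) hln (a := 4 + 2 * x.1 + x.2) (by omega)
    rw [hm a (by omega) (by omega) (by omega) (by omega) (by omega)]
    exact h.zero a (by omega)
  refine ⟨hS', hsuf', ?_, ?_, fun y l' hy => ?_, fun y l' hy => ?_, fun y l' hy => ?_,
    fun o ho => ?_, fun l' hl' v hv s hs => ?_, fun a ha => ?_⟩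
  · exact (old0 none (by intro _ h; simp at h)).trans h.var_none
  · exact (old0 _ (hasNode_some h.trie.nil_mem)).trans h.var_nil
  · rcases hcases y l' hy with hy | ⟨rfl, rfl⟩
    · exact (old0 _ (hasNode_some hy)).trans (h.var y l' hy)
    · rw [hnew, h2]
  · rcases hcases y l' hy with hy' | ⟨rfl, rfl⟩
    · have := ((hS'.isTm _ hy).2 y (by simp)).2.2
      rw [add_assoc, old _ (hasNode_some hy') _ (by omega) fun _ => by omega, ← add_assoc,
        ad_of_prefix hpre (hasNode_some (h.trie.closed _ _ hy'))]
      exact h.succ y l' hy'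
    · rw [hnew, h3, ad_of_prefix hpre hln]
  · rcases hcases y l' hy with hy' | ⟨rfl, rfl⟩
    · have := ((hS'.isTm _ hy).2 y (by simp)).2.2
      rw [Nat.add_sub_assoc (by omega), old _ (hasNode_some hy') _ (by omega) fun _ => by omega,
        ← Nat.add_sub_assoc (by omega)]
      exact h.fail y l' hy'
    · rw [hnew, h4]
  · have : HasNode S o ∨ o = some (x :: l) := by
      rcases o with _ | l'
      · exact .inl fun _ h => by simp at h
      · have := ho l' rfl
        rw [List.mem_append, List.mem_singleton] at this
        exact this.imp hasNode_some fun h => by rw [h]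
    rcases this with h5 | rfl
    · rw [old _ h5 _ (by omega) fun _ => by omega]
      exact h.mark o h5
    · rw [hnew, fresh _ (by omega)]
  · rw [List.mem_append, List.mem_singleton] at hl'
    rcases hl' with hl' | rfl
    · by_cases heq : l' = l ∧ (v, s) = x
      · obtain ⟨rfl, rfl⟩ := heq
        rw [if_pos (by simp), hnew, ad_of_prefix hpre hln, h1]
      · rw [add_assoc, add_assoc, old _ (hasNode_some hl') _ (by omega) fun h5 h6 =>
          heq ?_, ← add_assoc,
          ← add_assoc, h.child l' hl' v hv s hs]
        · by_cases h6 : (v, s) :: l' ∈ S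
          · rw [if_pos h6, if_pos (by simp [h6]), ad_of_prefix hpre (hasNode_some h6)]
          · rw [if_neg h6, if_neg]
            intro h7
            rcases hcases _ _ h7 with h8 | h8
            · exact h6 h8
            · exact heq ⟨h8.2, h8.1⟩
        · exact ⟨Option.some.inj h5, Prod.ext (by simp only; omega) (by simp only; omega)⟩
    · rw [if_neg, hnew, fresh _ (by omega)]
      intro h5
      rcases hcases _ _ h5 with h6 | h6
      · exact hx (h.trie.closed _ _ h6)
      · have := congrArg List.length h6.2
        simp at this
  · rw [hp_concat] at ha
    exact fresh a (by omega)

/-! ### Insertion of a term into the trie -/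

/-- The registers that change while a term is inserted into the trie. -/
def descendVars : List Var := [.s, .q, .var, .t, .a, .y, .hp, .u, .j]

theorem wp_descend {C : Ctx} {S : List Tm} {σ : Cfg} {Q : Cfg → Prop} (hB : Built C S σ.m)
    (hL : Lay C σ.v) (hhp : σ.v .hp = C.hp S) {x : ℕ × ℕ} {l t : Tm} (hl : l ∈ S) (ht : t ∈ C.F)
    (hxt : x :: l <:+ t) (hu : σ.v .u = C.ad S (some l)) (hq : σ.v .q < C.E.narrow)
    (hj : σ.v .j < C.E.narrow) (hx2 : C.x.getD (σ.v .q) 0 = x.2)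
    (hx1 : C.x.getD (σ.v .q - 1) 0 = x.1)
    (hQ : ∀ σ' S', S <+: S' → Built C S' σ'.m → x :: l ∈ S' → σ'.v .hp = C.hp S' →
      σ'.v .u = C.ad S' (some (x :: l)) → σ'.v .q = σ.v .q - 2 → σ'.v .j = σ.v .j - 1 →
      σ'.gap ≤ σ.gap + 40 → σ'.words = σ.words → (∀ a ∉ descendVars, σ'.v a = σ.v a) →
      (∀ a < C.dead, σ'.m a = σ.m a) → Q σ') :
    wp C.E Prog.descend Q σ := by
  have hnar := C.bound_lt
  have hsz : C.sz = 2 * C.n + 4 := rfl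
  obtain ⟨hb1, hb2, hb3⟩ := hp_le_bound hB.trie
  have hbn : (C.n + 2) * 2 ≤ (C.n + 2) * (C.nodes + 2) := Nat.mul_le_mul_left _ (by omega)
  have hx : x.1 < C.n ∧ x.2 ≤ 1 := by
    have := (C.isTm t ht).2 x (hxt.subset (by simp))
    omega
  have hadr := ad_lt_hp (C := C) (hasNode_some hl) (a := 4 + 2 * x.1 + x.2) (by omega)
  have hchild : σ.m (C.ad S (some l) + 4 + 2 * x.1 + x.2) =
      if x :: l ∈ S then C.ad S (some (x :: l)) else 0 := hB.child l hl x.1 hx.1 x.2 hx.2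
  have e1 : C.ad S (some l) + 4 + x.1 + x.1 + x.2 = C.ad S (some l) + 4 + 2 * x.1 + x.2 := by ring
  have hEx : C.E.x = C.x := rfl
  simp (disch := omega) only [Prog.descend, wp_seq_iff, wp_op_iff, wp_ifz_iff, wp_skip_iff, Op.Ok,
    Op.next, Cfg.wait, update_var, reduceCtorEq, if_false, if_true, true_and, ArithOp.eval, hL.zero,
    hL.one, hL.sz, hL.dead, hu, hhp, hEx, hx1, hx2, e1, add_zero]
  and_intros <;> try omega
  · intro h0
    have hnot : x :: l ∉ S := by
      intro h1
      rw [if_pos h1] at hchild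
      have := ad_lt_hp (C := C) (hasNode_some h1) (a := 0) (by omega)
      omega
    and_intros <;> try omega
    refine hQ _ (S ++ [x :: l]) (List.prefix_append _ _) (hB.concat hl hnot ht hxt ?_ ?_ ?_ ?_ ?_)
      (by simp) ?_ ?_ ?_ ?_ ?_ rfl (fun a ha => ?_) (fun a ha => ?_)
    · simp (disch := omega) only [update_mem_of_ne, Function.update_self]
    · simp (disch := omega) only [update_mem_of_ne, Function.update_self]
    · simp (disch := omega) only [update_mem_of_ne, Function.update_self]
    · simp (disch := omega) only [Function.update_self]
    · intro a _ ha1 ha2 ha3 ha4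
      simp (disch := omega) only [update_mem_of_ne]
    · simp [hp_concat]
    · simp [ad_concat C hnot]
    · simp; omega
    · simp
    · simp only; omega
    · simp only [descendVars, List.mem_cons, List.not_mem_nil, not_or] at ha
      simp only [update_var, ha, if_false]
    · simp (disch := omega) only [update_mem_of_ne]
  · intro h0
    have hmem : x :: l ∈ S := by
      by_contra h1
      rw [if_neg h1] at hchild
      exact h0 hchild
    rw [if_pos hmem] at hchild
    have := ad_lt_hp (C := C) (hasNode_some hmem) (a := 0) (by omega)
    and_intros <;> try omega
    refine hQ _ S List.prefix_rfl hB hmem ?_ ?_ ?_ ?_ ?_ rfl (fun a ha => ?_) (fun a ha => rfl)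
    · simp [hhp]
    · simp [hchild]
    · simp; omega
    · simp
    · simp only; omega
    · simp only [descendVars, List.mem_cons, List.not_mem_nil, not_or] at ha
      simp only [update_var, ha, if_false]

/-- The position in the input at which the term with index `k` starts. -/
def Ctx.pos (C : Ctx) (k : ℕ) : ℕ := 2 + ((C.F.take k).flatMap encTm).length

theorem length_flatMap_encTm (L : List Tm) :
    (L.flatMap encTm).length = L.length + 2 * (L.map List.length).sum := by
  induction L with
  | nil => rfl
  | cons l L ih => simp [Ctx.encTm_length, ih]; omega

theorem Ctx.pos_succ (C : Ctx) {k : ℕ} (hk : k < C.F.length) :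
    C.pos (k + 1) = C.pos k + (2 * C.F[k].length + 1) := by
  simp only [Ctx.pos, List.take_succ_eq_append_getElem hk, List.flatMap_append, List.length_append,
    List.flatMap_singleton, Ctx.encTm_length]
  ring

theorem Ctx.getD_pos (C : Ctx) {k : ℕ} (hk : k < C.F.length) {i : ℕ}
    (hi : i < 2 * C.F[k].length + 1) : C.x.getD (C.pos k + i) 0 = (encTm C.F[k]).getD i 0 := by
  have h1 : C.F.flatMap encTm = (C.F.take k).flatMap encTm ++
      (encTm C.F[k] ++ (C.F.drop (k + 1)).flatMap encTm) := by
    conv_lhs => rw [← List.take_append_drop k C.F, List.drop_eq_getElem_cons hk]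
    rw [List.flatMap_append, List.flatMap_cons]
  rw [Ctx.x, show C.pos k + i = ((C.F.take k).flatMap encTm).length + i + 1 + 1 by
    simp only [Ctx.pos]; ring, List.getD_cons_succ, List.getD_cons_succ, h1,
    List.getD_append_right _ _ _ _ (by omega), Nat.add_sub_cancel_left,
    List.getD_append _ _ _ _ (by rw [Ctx.encTm_length]; exact hi)]

theorem getD_encTm {l : Tm} {j : ℕ} (hj : j < l.length) :
    (encTm l).getD (2 * j + 1) 0 = l[j].1 ∧ (encTm l).getD (2 * j + 2) 0 = l[j].2 := by
  have h : ∀ l : Tm, ∀ j (hj : j < l.length), (l.flatMap fun y => [y.1, y.2]).getD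
    (2 * j) 0 = l[j].1 ∧
      (l.flatMap fun y => [y.1, y.2]).getD (2 * j + 1) 0 = l[j].2 := by
    intro l
    induction l with
    | nil => intro j hj; simp at hj
    | cons y l ih =>
      intro j hj
      rcases j with _ | j
      · simp
      · have := ih j (by simpa using hj)
        simpa [Nat.mul_succ] using this
  exact h l j hj

theorem Ctx.pos_le (C : Ctx) (k : ℕ) : C.pos k ≤ C.bound := by
  have h1 : C.pos k ≤ C.pos C.F.length := by
    have h2 : (C.F.flatMap encTm).length = ((C.F.take k).flatMap encTm).length +
        ((C.F.drop k).flatMap encTm).length := by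
      conv_lhs => rw [← List.take_append_drop k C.F]
      rw [List.flatMap_append, List.length_append]
    simp only [Ctx.pos, List.take_length]
    omega
  have h2 : C.pos C.F.length = 2 + (C.F.length + 2 * (C.F.map List.length).sum) := by
    rw [Ctx.pos, List.take_length, length_flatMap_encTm]
  have h3 : 4 * (C.nodes + 2) ≤ C.sz * (C.nodes + 2) := Nat.mul_le_mul_right _ (four_le_sz C)
  have h4 : C.nodes = (C.F.map List.length).sum + 1 := rfl
  have h5 : C.dead = 68 + 7 * C.n + C.F.length := rfl
  simp only [Ctx.bound]
  omega

theorem wp_insert {C : Ctx} {S : List Tm} {σ : Cfg} {Q : Cfg → Prop} (hB : Built C S σ.m)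
    (hL : Lay C σ.v) (hhp : σ.v .hp = C.hp S) {k : ℕ} (hk : k < C.F.length)
    (hj : σ.v .j = C.F[k].length) (hu : σ.v .u = C.dead + C.sz)
    (hq : σ.v .q = C.pos k + 2 * C.F[k].length)
    (hQ : ∀ σ' S', S <+: S' → Built C S' σ'.m → C.F[k] ∈ S' → σ'.v .hp = C.hp S' →
      σ'.v .u = C.ad S' (some C.F[k]) → σ'.gap ≤ σ.gap + 50 * C.F[k].length + 1 →
      σ'.words = σ.words → (∀ a ∉ descendVars, σ'.v a = σ.v a) →
      (∀ a < C.dead, σ'.m a = σ.m a) → Q σ') :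
    wp C.E (.loop .j Prog.descend) Q σ := by
  have hnar := C.bound_lt
  set t := C.F[k] with htd
  have ht : t ∈ C.F := List.getElem_mem hk
  have hpos : C.pos k + 2 * t.length < C.E.narrow := by
    have h1 := C.pos_succ hk
    have h2 := C.pos_le (k + 1)
    rw [← htd] at h1
    omega
  refine wp_loop_of_invariant (N := t.length) (fun j σ₁ => j ≤ t.length ∧ σ₁.v .j = j ∧
    σ₁.v .q = C.pos k + 2 * j ∧ σ₁.gap + 50 * j ≤ σ.gap + 50 * t.length ∧ σ₁.words = σ.words ∧
    (∀ a ∉ descendVars, σ₁.v a = σ.v a) ∧ (∀ a < C.dead, σ₁.m a = σ.m a) ∧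
    ∃ S', S <+: S' ∧ Built C S' σ₁.m ∧ t.drop j ∈ S' ∧ σ₁.v .hp = C.hp S' ∧
      σ₁.v .u = C.ad S' (some (t.drop j))) ?_ ?_ ?_
  · rintro j σ₁ ⟨h1, h2, h3, h4, h5, h6, h7, S', h8, h9, h10, h11, h12⟩ h0
    obtain rfl : j = 0 := by omega
    rw [List.drop_zero] at h10 h12
    exact hQ _ S' h8 h9 h10 h11 h12 (by simp only [Cfg.wait]; omega) h5 h6 h7
  · rintro j σ₁ ⟨h1, h2, h3, h4, h5, h6, h7, S', h8, h9, h10, h11, h12⟩ h0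
    obtain ⟨j, rfl⟩ : ∃ i, j = i + 1 := ⟨j - 1, by omega⟩
    have hcons : t[j] :: t.drop (j + 1) = t.drop j := (List.drop_eq_getElem_cons (by omega)).symm
    have hget := getD_encTm (l := t) (j := j) (by omega)
    refine ⟨j, by omega, wp_descend (x := t[j]) (t := t) (σ := σ₁.wait 1) h9
      (hL.of_eq fun a ha => ?_)
      h11 h10 ht ?_ h12 ?_ ?_ ?_ ?_ fun σ₂ S₂ g1 g2 g3 g4 g5 g6 g7 g8 g9 g10 g11 => ?_⟩
    · refine h6 a fun h => ?_
      revert ha h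
      cases a <;> simp [layVars, descendVars]
    · rw [hcons]; exact List.drop_suffix _ _
    · simp only [Cfg.wait]; omega
    · simp only [Cfg.wait]; omega
    · simp only [Cfg.wait, h3]
      rw [← hget.2, show C.pos k + 2 * (j + 1) = C.pos k + (2 * j + 2) by ring]
      exact C.getD_pos hk (by rw [← htd]; omega)
    · simp only [Cfg.wait, h3]
      rw [← hget.1, show C.pos k + 2 * (j + 1) - 1 = C.pos k + (2 * j + 1) by omega]
      exact C.getD_pos hk (by rw [← htd]; omega)
    · simp only [Cfg.wait] at g6 g7 g8 g9 g10 g11 ⊢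
      rw [hcons] at g3 g5
      exact ⟨by omega, by omega, by omega, by omega, g9.trans h5,
        fun a ha => (g10 a ha).trans (h6 a ha), fun a ha => (g11 a ha).trans (h7 a ha),
        S₂, h8.trans g1, g2, g3, g4, g5⟩
  · have hnil := hB.trie.nil_mem
    refine ⟨le_rfl, hj, hq, by omega, rfl, fun _ _ => rfl, fun _ _ => rfl, S,
      List.prefix_rfl, hB, ?_, hhp,
      ?_⟩
    · rwa [List.drop_length]
    · rw [List.drop_length, hu, Ctx.ad]
      have : S.idxOf [] = 0 := by
        have := hB.trie.head
        rcases S with _ | ⟨y, r⟩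
        · simp at this
        · simp only [List.head?_cons, Option.some.injEq] at this
          rw [this, List.idxOf_cons_self]
      rw [this]; ring

/-! ### Reading the formula -/

/-- The budget is doubled for each literal by which a term exceeds all terms before. This keeps the
accounts, as it only lowers the cost of the work done so far. -/
theorem wp_raiseBudget {C : Ctx} {Bs : List (List ℕ)} {Φ : ℚ} {e d : ℕ} {σ : Cfg} {Q : Cfg → Prop}
    (h : Inv C Bs Φ e σ) (ht : σ.v .t = d) (hd : σ.v .rm + d ≤ C.K) (hn : σ.v .rm + d ≤ C.n)
    (hQ : ∀ σ', Inv C Bs Φ (e + 1) σ' → σ'.v .rm = σ.v .rm + d → σ'.m = σ.m →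
      (∀ a ∉ [Var.rm, .bud, .t], σ'.v a = σ.v a) → Q σ') :
    wp C.E (.loop .t (.add .rm .rm .one ;; .wideAdd .bud .bud .bud ;; .sub .t .t .one)) Q σ := by
  obtain ⟨hG1, hG2⟩ := C.le_G
  have hnar := C.bound_lt
  have hmax : C.E.wide = 4 * C.maxBud := rfl
  have hbd : C.n < C.bound := by simp only [Ctx.bound, Ctx.dead]; omega
  refine wp_loop_of_invariant (N := d) (fun j σ₁ => σ₁.v .t = j ∧ σ₁.v .rm + j = σ.v .rm + d ∧
    Inv C Bs Φ e σ₁ ∧ σ₁.m = σ.m ∧ ∀ a ∉ [Var.rm, .bud, .t], σ₁.v a = σ.v a) ?_ ?_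
    ⟨ht, rfl, h, rfl, fun _ _ => rfl⟩
  · rintro j σ₁ ⟨h1, h2, h3, h4, h5⟩ h0
    exact hQ _ (h3.of_eq (fun _ _ => rfl) (fun _ _ => rfl) rfl rfl rfl rfl
      (by simp only [Cfg.wait]; omega)) (by simp only [Cfg.wait]; omega) h4 h5
  · rintro j σ₁ ⟨h1, h2, h3, h4, h5⟩ h0
    have hL := h3.lay
    have hb := h3.bud_le
    have hb0 := h3.bud_pos
    refine ⟨j - 1, by omega, ?_⟩
    simp (disch := omega) only [wp_seq_iff, wp_op_iff, Op.Ok, Op.next, Cfg.wait, update_var,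
      reduceCtorEq, if_false, if_true, ArithOp.eval, hL.one]
    and_intros <;> try omega
    · refine ⟨hL.of_eq ?_, ?_, ?_, ?_, ?_⟩
      · simp only [layVars, update_var]; simp
      · obtain ⟨i, g1, g2, g3, g4, g5⟩ := h3.gray
        refine ⟨i, g1, g2, g3, ?_, fun g6 => ?_⟩
        · refine le_trans ?_ g4
          simp only [update_var, reduceCtorEq, if_false, if_true]
          gcongr
          omega
        · have := g5 g6
          simp only [update_var, reduceCtorEq, if_false, if_true]
          omega
      · simp only [update_var, reduceCtorEq, if_false, if_true]
        rw [h3.bud, ← add_assoc, pow_succ]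
        ring
      · simp only [update_var, reduceCtorEq, if_false, if_true]
        omega
      · simp only [update_var, reduceCtorEq, if_false, if_true]
        have h6 := h3.gap
        have h7 : C.G * (σ₁.v .cnt + (σ₁.v .rm + 1) + C.T.length + 1) =
          C.G * (σ₁.v .cnt + σ₁.v .rm + C.T.length + 1) + C.G := by ring
        omega
    · intro a ha
      rw [← h5 a ha]
      simp only [List.mem_cons, List.not_mem_nil, not_or] at ha
      simp only [ha, if_false]

/-- The first `k` terms have been read. -/
structure Reading (C : Ctx) (k : ℕ) (S : List Tm) (Φ : ℚ) (e : ℕ) (σ : Cfg) : Prop where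
  inv : Inv C [] Φ e σ
  built : Built C S σ.m
  hp : σ.v .hp = C.hp S
  ip : σ.v .ip = C.pos k
  lp : σ.v .lp = 68 + 7 * C.n + k
  rem : σ.v .rem = C.F.length - k
  rm_le : σ.v .rm ≤ C.n
  terms : ∀ l ∈ C.F.take k, l.length ≤ σ.v .rm ∧ l ∈ S
  seg : Seg C S σ.m (68 + 7 * C.n) ((C.F.take k).map some)

theorem length_le_of_isTm {n : ℕ} {l : Tm} (h : IsTm 0 n l) : l.length ≤ n := by
  have h1 : (l.map Prod.fst).Subperm (List.range n) := by
    refine List.Nodup.subperm (List.Pairwise.map _ (fun _ _ h => h.ne) h.1) fun i hi => ?_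
    obtain ⟨x, hx, rfl⟩ := List.mem_map.1 hi
    have := h.2 x hx
    simp; omega
  simpa using h1.length_le

theorem wp_readTerm {C : Ctx} {k : ℕ} {S : List Tm} {Φ Φ' : ℚ} {e : ℕ} {σ : Cfg} {Q : Cfg → Prop}
    (h : Reading C k S Φ e σ) (he : e ≤ 10) (hk : k < C.F.length)
    (hΦ : Φ + C.unit C.F[k].length ≤ Φ') (hΦ' : Φ' ≤ 2 ^ C.nf)
    (hQ : ∀ σ' S', Reading C (k + 1) S' Φ' 0 σ' → Q σ') :
    wp C.E Prog.readTerm Q σ := by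
  have hL := h.inv.lay
  have hnar := C.bound_lt
  obtain ⟨hb1, hb2, hb3⟩ := hp_le_bound h.built.trie
  obtain ⟨hG1, hG2⟩ := C.le_G
  have hKw : C.E.wideCost = C.K + 1 := rfl
  have hEx : C.E.x = C.x := rfl
  have ht : C.F[k] ∈ C.F := List.getElem_mem hk
  have htn := length_le_of_isTm (C.isTm _ ht)
  have htK := C.length_le _ ht
  have hlen : C.x.getD (C.pos k) 0 = C.F[k].length := C.getD_pos hk (i := 0) (by omega)
  have hps := C.pos_succ hk
  have hpos := C.pos_le (k + 1)
  have hdl : C.dead = 68 + 7 * C.n + C.F.length := rfl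
  have hip := h.ip
  have hrem := h.rem
  have hrm := h.rm_le
  simp (disch := omega) only [Prog.readTerm, wp_seq_iff, wp_op_iff, Op.Ok, Op.next,
    update_var, reduceCtorEq, if_false, if_true, true_and, ArithOp.eval, hL.zero, hL.one, hL.root,
    hip, hEx, hlen, add_zero]
  and_intros <;> try omega
  refine wp_insert (k := k) h.built (hL.of_eq ?_) ?_ hk ?_ ?_ ?_ fun σ₁ S' g1 g2 g3 g4 g5 g6
    g7 g8 g9 => ?_
  · simp only [layVars, update_var]; simp
  · simp [h.hp]
  · simp
  · simp
  · simp; omega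
  simp only at g6 g7 g8 g9
  have v1 : ∀ a ∉ descendVars ++ [.len, .ip], σ₁.v a = σ.v a := by
    intro a ha
    rw [g8 a fun h => ha (by simp [h])]
    simp only [descendVars, List.cons_append, List.nil_append, List.mem_cons,
      List.not_mem_nil, not_or] at ha
    simp only [update_var, ha, if_false]
  have hL1 : Lay C σ₁.v := hL.of_eq fun a ha => v1 a fun h => by
    revert ha h
    cases a <;> simp [layVars, descendVars]
  have hrm1 : σ₁.v .rm = σ.v .rm := v1 _ (by simp [descendVars])
  have hrem1 : σ₁.v .rem = σ.v .rem := v1 _ (by simp [descendVars])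
  have hlp1 : σ₁.v .lp = 68 + 7 * C.n + k := by rw [v1 _ (by simp [descendVars]), h.lp]
  have hlen1 : σ₁.v .len = C.F[k].length := by rw [g8 _ (by simp [descendVars])]; simp
  have hip1 : σ₁.v .ip = C.pos (k + 1) := by
    rw [g8 _ (by simp [descendVars])]
    simp only [update_var, reduceCtorEq, if_false, if_true]
    omega
  have hI1 : Inv C [] Φ (60 * C.E.wideCost) σ₁ :=
    h.inv.of_eq (fun a ha => v1 a fun h => by
      revert ha h
      cases a <;> simp [layVars, descendVars]) (fun a ha => g9 a (by omega))
        (v1 _ (by simp [descendVars]))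
      (v1 _ (by simp [descendVars])) hrm1 g7 (by omega)
  simp (disch := omega) only [wp_seq_iff, wp_op_iff, Op.Ok, Op.next,
    ArithOp.eval, hlen1, hrm1]
  and_intros <;> try omega
  refine wp_raiseBudget (Bs := []) (Φ := Φ) (e := 60 * C.E.wideCost + 1)
    (d := C.F[k].length - σ.v .rm)
    (hI1.of_eq ?_ (fun _ _ => rfl) ?_ ?_ ?_ rfl ?_) ?_ ?_ ?_ fun σ₂ r1 r2 r3 r4 => ?_
  · simp only [layVars, update_var]; simp
  · simp
  · simp
  · simp
  · simp only; omega
  · simp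
  · have := h.inv.rm
    simp [hrm1]; omega
  · simp [hrm1]; omega
  simp only at r2 r3 r4
  have v2 : ∀ a ∉ [Var.rm, .bud, .t], σ₂.v a = σ₁.v a := by
    intro a ha
    rw [r4 a ha]
    simp only [List.mem_cons, List.not_mem_nil, not_or] at ha
    simp only [update_var, ha, if_false]
  have hrm2 : σ₂.v .rm = max (σ.v .rm) C.F[k].length := by
    rw [r2]; simp [hrm1]; omega
  have hlp2 : σ₂.v .lp = 68 + 7 * C.n + k := (v2 _ (by simp)).trans hlp1
  have hrem2 : σ₂.v .rem = C.F.length - k := by rw [v2 _ (by simp), hrem1, hrem]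
  have hu2 : σ₂.v .u = C.ad S' (some C.F[k]) := (v2 _ (by simp)).trans g5
  have hL2 := r1.lay
  simp (disch := omega) only [wp_seq_iff, wp_op_iff, Op.Ok, Op.next, update_var, reduceCtorEq,
    if_false, ArithOp.eval, hlp2, hrem2, hL2.one, hu2]
  and_intros <;> try omega
  refine wp_tick (Bs := []) (Φ := Φ) (Φ' := Φ') (e := 60 * C.E.wideCost + 5)
    (r1.of_eq ?_ (fun a ha => update_mem_of_ne (by omega)) ?_ ?_ ?_ rfl ?_) (by omega) ?_ hΦ'
    fun σ₃ s1 s2 s3 => ?_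
  · simp only [layVars, update_var]; simp
  · simp
  · simp
  · simp
  · simp only; omega
  · simp only [update_var, reduceCtorEq, if_false]
    refine le_trans ?_ hΦ
    rw [r1.bud, hrm2, Ctx.unit]
    push_cast
    gcongr
    · norm_num
    · exact le_max_right _ _
  simp only at s1 s2
  have hS' := hp_le_bound g2.trie
  have hm3 : ∀ a, 65 + 3 * C.n ≤ a → a ≠ 68 + 7 * C.n + k → σ₃.m a = σ₁.m a := by
    intro a ha1 ha2
    rw [s2 a ha1, update_mem_of_ne ha2, r3]
  have hv3 : ∀ a ∉ [Var.ta, .tb, .tt, .tv, .ty, .tj, .cnt, .rm, .bud, .t, .lp, .rem],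
      σ₃.v a = σ₁.v a := by
    intro a ha
    simp only [List.mem_cons, List.not_mem_nil, not_or] at ha
    rw [s1 a (by simp [ha])]
    simp only [update_var, ha, if_false]
    exact v2 a (by simp [ha])
  have hrm3 : σ₃.v .rm = max (σ.v .rm) C.F[k].length := by
    rw [s1 _ (by simp)]; simpa using hrm2
  have htake : C.F.take (k + 1) = C.F.take k ++ [C.F[k]] := List.take_succ_eq_append_getElem hk
  refine hQ σ₃ S' ⟨s3, g2.of_eq fun a ha => hm3 a (by omega) (by omega), ?_, ?_, ?_, ?_, ?_,
    fun l hl => ?_, fun i hi => ?_⟩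
  · rw [hv3 _ (by simp), g4]
  · rw [hv3 _ (by simp), hip1]
  · rw [s1 _ (by simp)]; simp; omega
  · rw [s1 _ (by simp)]; simp; omega
  · rw [hrm3]; omega
  · rw [hrm3]
    rw [htake, List.mem_append, List.mem_singleton] at hl
    rcases hl with hl | rfl
    · have := h.terms l hl
      exact ⟨by omega, g1.subset this.2⟩
    · exact ⟨by omega, g3⟩
  · simp only [List.length_map, List.length_take] at hi
    simp only [List.getElem_map, List.getElem_take]
    rcases Nat.lt_or_ge i k with hik | hik
    · have h1 := h.seg i (by simp; omega)
      simp only [List.getElem_map, List.getElem_take] at h1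
      have h2 : C.F[i] ∈ S := (h.terms _ (by
        rw [List.mem_take_iff_getElem]; exact ⟨i, by omega, rfl⟩)).2
      rw [hm3 _ (by omega) (by omega), g9 _ (by omega), h1, ad_of_prefix g1 (hasNode_some h2)]
    · obtain rfl : i = k := by omega
      rw [s2 _ (by omega), Function.update_self]

theorem built_nil {C : Ctx} {m : ℕ → ℕ} (h1 : m C.dead = C.n) (h2 : m (C.dead + C.sz) = C.n)
    (h : ∀ a, C.dead < a → a ≠ C.dead + C.sz → m a = 0) : Built C [[]] m := by
  have hsz : C.sz = 2 * C.n + 4 := rfl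
  have had : C.ad [[]] (some []) = C.dead + C.sz := by simp [Ctx.ad]
  have hhp : C.hp [[]] = C.dead + C.sz * 2 := rfl
  have hmem : ∀ x l, x :: l ∉ ([[]] : List Tm) := by simp
  have hT : C.T ∈ C.F := by simp [Ctx.F]
  refine ⟨⟨by simp, ?_, by simp, rfl, by simp [Ctx.nodes]⟩, ?_, h1, had ▸ h2, fun x l hx => ?_,
    fun x l hx => ?_, fun x l hx => ?_, fun o ho => ?_, fun l hl v hv s hs => ?_, fun a ha => ?_⟩
  · intro l hl
    rw [List.mem_singleton] at hl
    rw [hl]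
    exact ⟨List.Pairwise.nil, by simp⟩
  · intro l hl
    rw [List.mem_singleton] at hl
    exact ⟨C.T, hT, hl ▸ List.nil_suffix⟩
  · exact absurd hx (hmem x l)
  · exact absurd hx (hmem x l)
  · exact absurd hx (hmem x l)
  · rcases o with _ | l
    · rw [show C.ad [[]] none = C.dead from rfl, h _ (by omega) (by omega)]
    · have := ho l rfl
      rw [List.mem_singleton] at this
      rw [this, had, h _ (by omega) (by omega)]
  · rw [List.mem_singleton] at hl
    rw [if_neg (hmem _ _), hl, had, h _ (by omega) (by omega)]
  · exact h _ (by omega) (by omega)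

/-- The part of the potential that pays for reading all terms. -/
def Ctx.readCost (C : Ctx) : ℚ := (C.F.map fun l => C.unit l.length).sum

/-- Reading the terms costs at most the `16`-th part of the words of the Gray code. -/
theorem Ctx.readCost_le (C : Ctx) : C.readCost ≤ 2 ^ C.nf / 16 := by
  have h1 := sum_weight_le C.nodup C.isTm
  have h2 : C.readCost = 1 / (16 * 2 ^ C.T.length) * (C.F.map fun l =>
    (1 / 2 : ℚ) ^ l.length).sum := by
    rw [Ctx.readCost, ← List.sum_map_mul_left]
    congr 1
    refine List.map_congr_left fun l _ => ?_
    rw [Ctx.unit, pow_add, one_div_pow]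
    field_simp
  have h3 : (2 : ℚ) ^ C.n = 2 ^ C.nf * 2 ^ C.T.length := by
    rw [← pow_add, C.nf_add_length]
  rw [h2]
  calc 1 / (16 * 2 ^ C.T.length) * (C.F.map fun l => (1 / 2 : ℚ) ^ l.length).sum
      ≤ 1 / (16 * 2 ^ C.T.length) * 2 ^ C.n := by gcongr; exact h1
    _ = 2 ^ C.nf / 16 := by rw [h3]; field_simp

theorem wp_readTerms {C : Ctx} {e : ℕ} {σ : Cfg} {Q : Cfg → Prop} (h : Inv C [] 0 e σ) (he : e ≤ 3)
    (hrm : σ.v .rm = 0) (hhp : σ.v .hp = C.dead + C.sz * 2) (hrem : σ.v .rem = C.F.length)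
    (hm : ∀ a, C.dead ≤ a → σ.m a = 0)
    (hQ : ∀ σ' S, Reading C C.F.length S C.readCost 3 σ' → Q σ') :
    wp C.E Prog.readTerms Q σ := by
  have hL := h.lay
  have hnar := C.bound_lt
  have hdl : C.dead = 68 + 7 * C.n + C.F.length := rfl
  have hsz : C.sz = 2 * C.n + 4 := rfl
  have hne : C.F.length ≠ 0 := by simp [Ctx.F]
  have hbd : 68 + 7 * C.n < C.bound := by simp only [Ctx.bound]; omega
  have hu : ∀ κ, 0 ≤ C.unit κ := fun κ => by unfold Ctx.unit; positivity
  simp (disch := omega) only [Prog.readTerms, wp_seq_iff, wp_op_iff, Op.Ok, Op.next, update_var,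
    reduceCtorEq, if_false, true_and, ArithOp.eval, hL.zero, hL.n, hL.root, hL.dead, hL.l0,
    add_zero]
  and_intros <;> try omega
  set σ₀ : Cfg := ⟨_, _, _, _⟩ with hσ₀
  have h0 : Reading C 0 [[]] 0 7 σ₀ := by
    refine ⟨h.of_eq ?_ (fun a ha => ?_) ?_ ?_ ?_ rfl ?_, built_nil ?_ ?_ fun a ha1 ha2 =>
      ?_, ?_, ?_, ?_,
      ?_, ?_, ?_, ?_⟩
    · simp only [hσ₀, layVars, update_var]; simp
    · simp (disch := omega) only [hσ₀, update_mem_of_ne]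
    · simp [hσ₀]
    · simp [hσ₀]
    · simp [hσ₀]
    · simp only [hσ₀]; omega
    · simp (disch := omega) only [hσ₀, update_mem_of_ne, Function.update_self]
    · simp (disch := omega) only [hσ₀, Function.update_self]
    · simp (disch := omega) only [hσ₀, update_mem_of_ne]
      exact hm a ha1.le
    · simp [hσ₀, hhp, Ctx.hp]
    · simp [hσ₀, Ctx.pos]
    · simp [hσ₀]
    · simp [hσ₀, hrem]
    · simp [hσ₀, hrm]
    · simp
    · intro i hi; simp at hi
  refine wp_loop_of_invariant (N := C.F.length) (fun j σ₁ => ∃ k S, k + j = C.F.length ∧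
    Reading C k S ((C.F.take k).map fun l => C.unit l.length).sum (if k = 0 then 7 else 2) σ₁) ?_ ?_
    ⟨0, [[]], by omega, by simpa using h0⟩
  · rintro j σ₁ ⟨k, S, h1, h2⟩ h3
    have := h2.rem
    obtain rfl : k = C.F.length := by omega
    rw [List.take_length, if_neg hne] at h2
    refine hQ _ S ⟨h2.inv.of_eq (fun _ _ => rfl) (fun _ _ => rfl) rfl rfl rfl rfl ?_,
      h2.built, h2.hp,
      h2.ip, h2.lp, h2.rem, h2.rm_le, by simpa [Cfg.wait] using h2.terms,
      by simpa [Cfg.wait] using h2.seg⟩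
    simp only [Cfg.wait]; omega
  · rintro j σ₁ ⟨k, S, h1, h2⟩ h3
    have := h2.rem
    have hk : k < C.F.length := by omega
    have htake : C.F.take (k + 1) = C.F.take k ++ [C.F[k]] := List.take_succ_eq_append_getElem hk
    refine ⟨j - 1, by omega, wp_readTerm (σ := σ₁.wait 1) (k := k) (S := S) (e := 8)
      (Φ := ((C.F.take k).map fun l => C.unit l.length).sum)
      (Φ' := ((C.F.take (k + 1)).map fun l => C.unit l.length).sum)
      ⟨h2.inv.of_eq (fun _ _ => rfl) (fun _ _ => rfl) rfl rfl rfl rfl ?_, h2.built,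
        h2.hp, h2.ip, h2.lp,
        h2.rem, h2.rm_le, h2.terms, h2.seg⟩ (by omega) hk ?_ ?_ fun σ₂ S' h4 => ?_⟩
    · simp only [Cfg.wait]; split_ifs <;> omega
    · rw [htake, List.map_append, List.sum_append, List.map_singleton, List.sum_singleton]
    · have h5 := C.readCost_le
      have h6 : C.readCost = ((C.F.take (k + 1)).map fun l => C.unit l.length).sum +
          ((C.F.drop (k + 1)).map fun l => C.unit l.length).sum := by
        rw [← List.sum_append, ← List.map_append, List.take_append_drop]; rfl
      have h7 : 0 ≤ ((C.F.drop (k + 1)).map fun l => C.unit l.length).sum :=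
        List.sum_nonneg fun x hx => by
          obtain ⟨l, -, rfl⟩ := List.mem_map.1 hx
          exact hu _
      have h8 : (0 : ℚ) ≤ 2 ^ C.nf := by positivity
      linarith
    · refine ⟨k + 1, S', by omega, ?_⟩
      rw [if_neg (by omega)]
      exact ⟨h4.inv.of_eq (fun _ _ => rfl) (fun _ _ => rfl) rfl rfl rfl rfl
        (by simp only [Cfg.wait]; omega), h4.built, h4.hp, h4.ip, h4.lp,
        h4.rem, h4.rm_le, h4.terms, h4.seg⟩

/-! ### Precomputation -/

/-- The constant registers that are set before any term is read. -/
def PreLay (C : Ctx) (v : Var → ℕ) : Prop :=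
  Lay C (Function.update (Function.update v .tl C.T.length) .nf C.nf)

theorem PreLay.of_eq {C : Ctx} {v v' : Var → ℕ} (h : PreLay C v)
    (hv : ∀ a ∈ layVars, a ≠ .tl → a ≠ .nf → v' a = v a) : PreLay C v' :=
  Lay.of_eq h fun a ha => by
    simp only [update_var]
    split_ifs with h1 h2
    · rfl
    · rfl
    · exact hv a ha h2 h1

theorem two_sz_le_bound (C : Ctx) : C.dead + C.sz * 2 ≤ C.bound ∧ C.sz = 2 * C.n + 4 ∧
    C.dead = 68 + 7 * C.n + C.F.length := by
  have : C.sz * 2 ≤ C.sz * (C.nodes + 2) := Nat.mul_le_mul_left _ (by omega)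
  refine ⟨?_, rfl, rfl⟩
  simp only [Ctx.bound]
  omega

theorem wp_layout {C : Ctx} {σ : Cfg} {Q : Cfg → Prop} (h0 : σ.v .zero = 0) (h1 : σ.v .one = 1)
    (hn : σ.v .n = C.n) (hrem : σ.v .rem = C.F.length)
    (hQ : ∀ σ', PreLay C σ'.v → σ'.v .hp = C.dead + C.sz * 2 → σ'.v .rem = C.F.length →
      σ'.m = σ.m → σ'.gap = σ.gap + 20 → σ'.words = σ.words → Q σ') :
    wp C.E Prog.layout Q σ := by
  have hnar := C.bound_lt
  obtain ⟨hb1, hb2, hb3⟩ := two_sz_le_bound C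
  simp (disch := omega) only [Prog.layout, wp_seq_iff, wp_op_iff, Op.Ok, Op.next, update_var,
    reduceCtorEq, if_false, if_true, true_and, ArithOp.eval, h1, hn, hrem]
  and_intros <;> try omega
  refine hQ _ ?_ ?_ ?_ rfl rfl rfl
  · constructor <;> simp [h0, h1, hn] <;> omega
  · simp; omega
  · simp [hrem]

/-- The first `i` literals of the first term have been entered. -/
structure Entered (C : Ctx) (i : ℕ) (m : ℕ → ℕ) : Prop where
  va : ∀ v < C.n, m (64 + v) = if (v, 1) ∈ C.T.take i then 1 else 0
  vb : ∀ v < C.n, m (65 + 3 * C.n + v) = if v ∈ (C.T.take i).map Prod.fst then 1 else 0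
  zero : ∀ a, 64 + C.n ≤ a → (a < 65 + 3 * C.n ∨ 65 + 4 * C.n ≤ a) → m a = 0

theorem Entered.step {C : Ctx} {i : ℕ} {m : ℕ → ℕ} (h : Entered C i m) (hi : i < C.T.length) :
    Entered C (i + 1) (Function.update (Function.update m (64 + C.T[i].1) C.T[i].2)
      (65 + 3 * C.n + C.T[i].1) 1) := by
  have hT := C.isTm C.T (by simp)
  have hx := hT.2 C.T[i] (List.getElem_mem hi)
  have htake : C.T.take (i + 1) = C.T.take i ++ [C.T[i]] := List.take_succ_eq_append_getElem hi
  have hnot : ∀ s, (C.T[i].1, s) ∉ C.T.take i := by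
    intro s hs
    have h1 := hT.1.sublist (List.take_sublist (i + 1) C.T)
    rw [htake, List.pairwise_append] at h1
    exact absurd (h1.2.2 _ hs C.T[i] (by simp)) (lt_irrefl C.T[i].1)
  refine ⟨fun v hv => ?_, fun v hv => ?_, fun a h1 h2 => ?_⟩
  · rw [update_mem_of_ne (by omega), Function.update_apply, htake]
    split_ifs with h1 h2 h2
    · obtain rfl : v = C.T[i].1 := by omega
      have h3 := hnot 1
      rw [List.mem_append, List.mem_singleton] at h2
      rcases h2 with h2 | h2
      · exact absurd h2 h3
      · rw [← h2]
    · obtain rfl : v = C.T[i].1 := by omega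
      by_contra h3
      refine h2 (List.mem_append_right _ (List.mem_singleton.2 (Prod.ext rfl ?_)))
      simp only
      omega
    · rw [h.va v hv, if_pos]
      rw [List.mem_append, List.mem_singleton] at h2
      rcases h2 with h2 | h2
      · exact h2
      · exact absurd (by rw [← h2]) h1
    · rw [h.va v hv, if_neg fun h3 => h2 (List.mem_append_left _ h3)]
  · rw [Function.update_apply, htake, List.map_append, List.map_singleton]
    split_ifs with h1 h2 h2
    · rfl
    · exact absurd (List.mem_append_right _ (List.mem_singleton.2 (by omega))) h2
    · rw [update_mem_of_ne (by omega), h.vb v hv, if_pos]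
      rw [List.mem_append, List.mem_singleton] at h2
      rcases h2 with h2 | h2
      · exact h2
      · omega
    · rw [update_mem_of_ne (by omega), h.vb v hv, if_neg fun h3 => h2 (List.mem_append_left _ h3)]
  · rw [update_mem_of_ne (by omega), update_mem_of_ne (by omega)]
    exact h.zero a h1 h2

theorem wp_readFirst {C : Ctx} {σ : Cfg} {Q : Cfg → Prop} (hL : PreLay C σ.v) (hm : ∀ a, σ.m a = 0)
    (hQ : ∀ σ', PreLay C σ'.v → σ'.v .tl = C.T.length → σ'.v .hp = σ.v .hp →
      σ'.v .rem = σ.v .rem → Entered C C.T.length σ'.m → σ'.gap ≤ σ.gap + 20 * C.n + 10 →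
      σ'.words = σ.words → Q σ') :
    wp C.E Prog.readFirst Q σ := by
  have hnar := C.bound_lt
  obtain ⟨hb1, hb2, hb3⟩ := two_sz_le_bound C
  have hEx : C.E.x = C.x := rfl
  have h0F : 0 < C.F.length := by simp [Ctx.F]
  have hT0 : C.F[0] = C.T := rfl
  have hpos0 : C.pos 0 = 2 := rfl
  have hx2 : C.x.getD 2 0 = C.T.length := C.getD_pos h0F (i := 0) (by omega)
  have hTn := length_le_of_isTm (C.isTm C.T (by simp))
  have hTm := C.isTm C.T (by simp)
  have zero : σ.v .zero = 0 := by simpa [PreLay] using hL.zero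
  simp (disch := omega) only [Prog.readFirst, wp_seq_iff, wp_op_iff, Op.Ok, Op.next, update_var,
    reduceCtorEq, if_false, if_true, true_and, ArithOp.eval, hEx, hx2, zero, add_zero]
  and_intros <;> try omega
  refine wp_loop_of_invariant (N := C.T.length) (fun j σ₁ => ∃ i, i + j = C.T.length ∧
    PreLay C σ₁.v ∧
    σ₁.v .tl = C.T.length ∧ σ₁.v .hp = σ.v .hp ∧ σ₁.v .rem = σ.v .rem ∧ σ₁.v .j = j ∧
    σ₁.v .q = 3 + 2 * i ∧ Entered C i σ₁.m ∧ σ₁.gap ≤ σ.gap + 20 * i + 4 ∧ σ₁.words =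
      σ.words) ?_ ?_ ?_
  · rintro j σ₁ ⟨i, g1, g2, g3, g4, g5, g6, g7, g8, g9, g10⟩ h
    obtain rfl : i = C.T.length := by omega
    exact hQ _ g2 g3 g4 g5 g8 (by simp only [Cfg.wait]; omega) g10
  · rintro j σ₁ ⟨i, g1, g2, g3, g4, g5, g6, g7, g8, g9, g10⟩ h
    have hi : i < C.T.length := by omega
    have one : σ₁.v .one = 1 := by simpa [PreLay] using g2.one
    have va : σ₁.v .va = 64 := by simpa [PreLay] using g2.va
    have vb : σ₁.v .vb = 65 + 3 * C.n := by simpa [PreLay] using g2.vb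
    have hx := hTm.2 C.T[i] (List.getElem_mem hi)
    have hget := getD_encTm hi
    have hx1 : C.x.getD (3 + 2 * i) 0 = C.T[i].1 := by
      rw [← hget.1, show 3 + 2 * i = C.pos 0 + (2 * i + 1) by omega]
      exact C.getD_pos h0F (by rw [hT0]; omega)
    have hx2 : C.x.getD (3 + 2 * i + 1) 0 = C.T[i].2 := by
      rw [← hget.2, show 3 + 2 * i + 1 = C.pos 0 + (2 * i + 2) by omega]
      exact C.getD_pos h0F (by rw [hT0]; omega)
    refine ⟨j - 1, by omega, ?_⟩
    simp (disch := omega) only [wp_seq_iff, wp_op_iff, Op.Ok, Op.next, Cfg.wait, update_var,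
      reduceCtorEq, if_false, if_true, true_and, ArithOp.eval, hEx, one, va, vb, g7, hx1, hx2]
    and_intros <;> try omega
    refine ⟨i + 1, by omega, g2.of_eq ?_, by simpa using g3, by simpa using g4, by simpa using g5,
      by omega, by omega, g8.step hi, by omega, g10⟩
    simp only [layVars, update_var]; simp
  · refine ⟨0, by omega, hL.of_eq ?_, by simp, by simp, by simp, by simp, by simp, ?_, by simp, rfl⟩
    · simp only [layVars, update_var]; simp
    · refine ⟨fun v hv => ?_, fun v hv => ?_, fun a h1 h2 => hm a⟩
      · simp [hm]
      · simp [hm]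

/-- The variables below `i` that do not occur in the first term. -/
def Ctx.freeBelow (C : Ctx) (i : ℕ) : List ℕ := (List.range i).filter fun v => v ∉ C.T.map Prod.fst

theorem Ctx.freeBelow_succ (C : Ctx) (i : ℕ) : C.freeBelow (i + 1) =
    C.freeBelow i ++ if i ∈ C.T.map Prod.fst then [] else [i] := by
  rw [Ctx.freeBelow, List.range_succ, List.filter_append, Ctx.freeBelow]
  split_ifs with h
  · rw [List.filter_singleton]; simp [h]
  · rw [List.filter_singleton]; simp [h]

theorem Ctx.length_freeBelow_le (C : Ctx) (i : ℕ) : (C.freeBelow i).length ≤ i := by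
  simpa [Ctx.freeBelow] using List.length_filter_le (fun v => v ∉ C.T.map Prod.fst) (List.range i)

theorem wp_initGray {C : Ctx} {σ : Cfg} {Q : Cfg → Prop} (hL : PreLay C σ.v)
    (htl : σ.v .tl = C.T.length) (hm : Entered C C.T.length σ.m)
    (hQ : ∀ σ', Lay C σ'.v → σ'.v .hp = σ.v .hp → σ'.v .rem = σ.v .rem → GrayMem C C.s₀ σ'.m →
      (∀ a, C.dead ≤ a → σ'.m a = 0) → σ'.gap ≤ σ.gap + 20 * C.n + 10 →
      σ'.words = σ.words → Q σ') :
    wp C.E Prog.initGray Q σ := by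
  have hnar := C.bound_lt
  obtain ⟨hb1, hb2, hb3⟩ := two_sz_le_bound C
  have zero : σ.v .zero = 0 := by simpa [PreLay] using hL.zero
  have hn : σ.v .n = C.n := by simpa [PreLay] using hL.n
  simp (disch := omega) only [Prog.initGray, wp_seq_iff, wp_op_iff, Op.Ok, Op.next, update_var,
    reduceCtorEq, if_false, true_and, ArithOp.eval, zero, hn, add_zero]
  and_intros <;> try omega
  refine wp_loop_of_invariant (N := C.n) (fun j σ₁ => ∃ i, i + j = C.n ∧ PreLay C σ₁.v ∧
    σ₁.v .tl = C.T.length ∧ σ₁.v .hp = σ.v .hp ∧ σ₁.v .rem = σ.v .rem ∧ σ₁.v .e = j ∧ σ₁.v .i = i ∧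
    σ₁.v .nf = (C.freeBelow i).length ∧ σ₁.gap ≤ σ.gap + 20 * i + 3 ∧ σ₁.words = σ.words ∧
    (∀ j (h : j < (C.freeBelow i).length), σ₁.m (64 + C.n + j) = (C.freeBelow i)[j] ∧
      σ₁.m (64 + 2 * C.n + j) = j) ∧
    (∀ a, a < 64 + C.n ∨ 65 + 3 * C.n ≤ a → σ₁.m a = σ.m a)) ?_ ?_ ?_
  · rintro j σ₁ ⟨i, g1, g2, g3, g4, g5, g6, g7, g8, g9, g10, g11, g12⟩ h
    obtain rfl : i = C.n := by omega
    have fo : σ₁.v .fo = 64 + 2 * C.n := by simpa [PreLay] using g2.fo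
    have hnf : (C.freeBelow C.n).length = C.nf := rfl
    have hnfn := C.nf_le
    simp (disch := omega) only [wp_seq_iff, wp_op_iff, Op.Ok, Op.next, Cfg.wait, update_var,
      reduceCtorEq, if_false, if_true, ArithOp.eval, fo, g8, hnf]
    and_intros <;> try omega
    refine hQ _ ?_ (by simpa using g4) (by simpa using g5) ⟨fun v hv => ?_, fun j hj => ?_,
      fun j hj => ?_, fun v => ?_⟩ (fun a ha => ?_) (by simp only; omega) g10
    · refine Lay.of_eq g2 ?_
      simp only [layVars, update_var]
      simp [g3, g8, hnf]
    · simp only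
      rw [update_mem_of_ne (by omega), g12 _ (by omega), hm.va v hv, List.take_length]
      rfl
    · simp only
      rw [update_mem_of_ne (by omega), (g11 j hj).1, Ctx.ps, List.getD_eq_getElem _ _ hj]
      rfl
    · simp only [Function.update_apply]
      split_ifs with h1
      · simp only [Ctx.s₀]; omega
      · exact (g11 j (by omega)).2
    · simp only [Ctx.s₀]; split_ifs <;> omega
    · simp only
      rw [update_mem_of_ne (by omega), g12 _ (by omega)]
      exact hm.zero a (by omega) (by omega)
  · rintro j σ₁ ⟨i, g1, g2, g3, g4, g5, g6, g7, g8, g9, g10, g11, g12⟩ h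
    have one : σ₁.v .one = 1 := by simpa [PreLay] using g2.one
    have ps : σ₁.v .ps = 64 + C.n := by simpa [PreLay] using g2.ps
    have fo : σ₁.v .fo = 64 + 2 * C.n := by simpa [PreLay] using g2.fo
    have vb : σ₁.v .vb = 65 + 3 * C.n := by simpa [PreLay] using g2.vb
    have hlen := C.length_freeBelow_le i
    have hflag : σ₁.m (65 + 3 * C.n + i) = if i ∈ C.T.map Prod.fst then 1 else 0 := by
      rw [g12 _ (by omega), hm.vb i (by omega), List.take_length]
    refine ⟨j - 1, by omega, ?_⟩
    simp (disch := omega) only [wp_seq_iff, wp_op_iff, wp_ifz_iff, wp_skip_iff, Op.Ok, Op.next,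
      Cfg.wait, update_var, reduceCtorEq, if_false, if_true, ArithOp.eval, one, ps, fo, vb, g7, g8,
      hflag]
    and_intros <;> try omega
    · intro h1
      have hfree : i ∉ C.T.map Prod.fst := fun h2 => by rw [if_pos h2] at h1; omega
      have hsucc := C.freeBelow_succ i
      rw [if_neg hfree] at hsucc
      and_intros <;> try omega
      refine ⟨i + 1, by omega, g2.of_eq ?_, by simpa using g3, by simpa using g4, by simpa using g5,
        by omega, rfl, by rw [hsucc]; simp, by omega, g10, fun k hk => ?_, fun a ha => ?_⟩
      · simp only [layVars, update_var]; simp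
      · simp only [hsucc, List.length_append, List.length_singleton] at hk
        simp only [hsucc]
        rcases Nat.lt_succ_iff_lt_or_eq.1 hk with h2 | rfl
        · rw [update_mem_of_ne (by omega), update_mem_of_ne (by omega),
            update_mem_of_ne (by omega), update_mem_of_ne (by omega), List.getElem_append_left h2]
          exact g11 k h2
        · rw [Function.update_self, update_mem_of_ne (by omega), Function.update_self]
          simp
      · rw [update_mem_of_ne (by omega), update_mem_of_ne (by omega)]
        exact g12 a ha
    · intro h1
      have hfree : i ∈ C.T.map Prod.fst := by
        by_contra h2
        rw [if_neg h2] at h1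
        exact h1 rfl
      have hsucc := C.freeBelow_succ i
      rw [if_pos hfree, List.append_nil] at hsucc
      and_intros <;> try omega
      refine ⟨i + 1, by omega, g2.of_eq ?_, by simpa using g3, by simpa using g4, by simpa using g5,
        by omega, rfl, by rw [hsucc], by omega, g10, ?_, g12⟩
      · simp only [layVars, update_var]; simp
      · rw [hsucc]; exact g11
  · refine ⟨0, by omega, hL.of_eq ?_, by simpa using htl, by simp, by simp, by simp, by simp,
      by simp [Ctx.freeBelow], by simp, rfl, fun j hj => by simp [Ctx.freeBelow] at hj,
        fun _ _ => rfl⟩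
    simp only [layVars, update_var]; simp

theorem wp_initBudget {C : Ctx} {σ : Cfg} {Q : Cfg → Prop} (hL : Lay C σ.v)
    (hm : GrayMem C C.s₀ σ.m) (hw : σ.words = [C.word C.s₀.2]) (hg : σ.gap ≤ 10)
    (hQ : ∀ σ', Inv C [] 0 0 σ' → σ'.v .rm = 0 → σ'.v .hp = σ.v .hp → σ'.v .rem = σ.v .rem →
      σ'.m = σ.m → Q σ') :
    wp C.E Prog.initBudget Q σ := by
  have hnar := C.bound_lt
  obtain ⟨hb1, hb2, hb3⟩ := two_sz_le_bound C
  obtain ⟨hG1, hG2⟩ := C.le_G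
  have hTn := length_le_of_isTm (C.isTm C.T (by simp))
  have hmax : C.E.wide = 4 * C.maxBud := rfl
  simp (disch := omega) only [Prog.initBudget, wp_seq_iff, wp_op_iff, Op.Ok, Op.next, update_var,
    reduceCtorEq, if_false, true_and, ArithOp.eval, hL.zero, hL.tl, add_zero]
  and_intros <;> try omega
  refine wp_loop_of_invariant (N := C.T.length) (fun j σ₁ => ∃ i, i + j = C.T.length ∧ Lay C σ₁.v ∧
    σ₁.v .hp = σ.v .hp ∧ σ₁.v .rem = σ.v .rem ∧ σ₁.v .rm = 0 ∧ σ₁.v .cnt = 0 ∧ σ₁.v .j = j ∧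
    σ₁.v .bud = 16 * 2 ^ i ∧ σ₁.m = σ.m ∧ σ₁.gap ≤ 14 + C.G * i ∧ σ₁.words = σ.words) ?_ ?_ ?_
  · rintro j σ₁ ⟨i, g1, g2, g3, g4, g5, g6, g7, g8, g9, g10, g11⟩ h
    obtain rfl : i = C.T.length := by omega
    refine hQ _ ⟨g2, ⟨0, Nat.two_pow_pos _, ?_, ?_, ?_, ?_⟩, ?_, ?_, ?_⟩ g5 g3 g4 g9
    · simp only [Cfg.wait, g9]; exact hm
    · simp [Cfg.wait, g11, hw, Ctx.gray]
    · simp [Cfg.wait, g6]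
    · simp [Cfg.wait, g6, g8]
    · simp [Cfg.wait, g5, g8]
    · simp [Cfg.wait, g5]
    · simp only [Cfg.wait, g5, g6]
      rw [show C.G * (0 + 0 + C.T.length + 1) = C.G * C.T.length + C.G by ring]
      omega
  · rintro j σ₁ ⟨i, g1, g2, g3, g4, g5, g6, g7, g8, g9, g10, g11⟩ h
    have hpow : 16 * 2 ^ i ≤ C.maxBud :=
      Nat.mul_le_mul_left _ (Nat.pow_le_pow_right (by omega) (by omega))
    have hpow0 : 0 < 2 ^ i := Nat.two_pow_pos _
    have hGi : C.G * (i + 1) = C.G * i + C.G := by ring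
    refine ⟨j - 1, by omega, ?_⟩
    simp (disch := omega) only [wp_seq_iff, wp_op_iff, Op.Ok, Op.next, Cfg.wait, update_var,
      reduceCtorEq, if_false, if_true, ArithOp.eval, g2.one, g8]
    and_intros <;> try omega
    refine ⟨i + 1, by omega, g2.of_eq ?_, by simpa using g3, by simpa using g4, by simpa using g5,
      by simpa using g6, by omega, by rw [pow_succ]; ring, g9, by omega, g11⟩
    simp only [layVars, update_var]; simp
  · refine ⟨0, by omega, hL.of_eq ?_, by simp, by simp, by simp, by simp, by simp, by simp, rfl, ?_,
      rfl⟩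
    · simp only [layVars, update_var]; simp
    · simp only; omega

/-! ### The output -/

/-- The bit word `q` satisfies the term `l`. -/
def Sat (q : List ℕ) (l : Tm) : Prop := ∀ x ∈ l, q.getD x.1 0 = x.2

/-- The words of the Gray code, in the order of their output. -/
def Ctx.grayWords (C : Ctx) : List (List ℕ) := (List.range (2 ^ C.nf)).map fun i =>
  C.word (C.gray i).2

theorem Ctx.s₀_of_mem (C : Ctx) {x : ℕ × ℕ} (hx : x ∈ C.T) : C.s₀.2 x.1 = x.2 := by
  have hT := C.isTm C.T (by simp)
  have hx2 := (hT.2 x hx).2.2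
  have hnd : (C.T.map Prod.fst).Nodup := List.Pairwise.map _ (fun _ _ h => h.ne) hT.1
  simp only [Ctx.s₀]
  split_ifs with h
  · rw [← List.inj_on_of_nodup_map hnd h hx rfl]
  · by_contra h1
    exact h (by rwa [show (x.1, 1) = x from Prod.ext rfl (by simp only; omega)])

theorem Ctx.mem_free (C : Ctx) {a : ℕ} : a ∈ C.free ↔ a < C.n ∧ a ∉ C.T.map Prod.fst := by
  simp [Ctx.free]

theorem Ctx.forall_ps_ne (C : Ctx) {a : ℕ} : (∀ j < C.nf, C.ps j ≠ a) ↔ a ∉ C.free := by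
  constructor
  · intro h ha
    obtain ⟨j, hj, rfl⟩ := List.getElem_of_mem ha
    exact h j hj (by rw [Ctx.ps, List.getD_eq_getElem _ _ hj])
  · rintro h j hj rfl
    exact h (C.ps_mem hj)

theorem Ctx.gray_visits (C : Ctx) :
    (∀ i < 2 ^ C.nf, (∀ a ∉ C.free, (C.gray i).2 a = C.s₀.2 a) ∧ ∀ a, (C.gray i).2 a ≤ 1) ∧
    (∀ β : ℕ → ℕ, (∀ a ∉ C.free, β a = C.s₀.2 a) → (∀ a, β a ≤ 1) →
      ∃ i < 2 ^ C.nf, (C.gray i).2 = β) ∧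
    ∀ i < 2 ^ C.nf, ∀ j < 2 ^ C.nf, (C.gray i).2 = (C.gray j).2 → i = j := by
  have hbit : ∀ a, C.s₀.2 a ≤ 1 := fun a => by simp only [Ctx.s₀]; split_ifs <;> omega
  obtain ⟨h1, h2, h3⟩ := KDNF.gray_visits C.ps C.nf C.ps_inj C.s₀ (fun _ _ => rfl) fun _ _ => hbit _
  refine ⟨fun i hi => ?_, fun β h4 h5 => h2 β (fun a ha => h4 a (C.forall_ps_ne.1 ha))
    fun _ _ => h5 _,
    h3⟩
  have h4 : ∀ a ∉ C.free, (C.gray i).2 a = C.s₀.2 a := fun a ha =>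
    (h1 i hi).1 a (C.forall_ps_ne.2 ha)
  refine ⟨h4, fun a => ?_⟩
  by_cases ha : a ∈ C.free
  · obtain ⟨j, hj, rfl⟩ := List.getElem_of_mem ha
    have := (h1 i hi).2 j hj
    rwa [Ctx.ps, List.getD_eq_getElem _ _ hj] at this
  · rw [h4 a ha]; exact hbit a

theorem Ctx.getD_word (C : Ctx) (α : ℕ → ℕ) {i : ℕ} (hi : i < C.n) : (C.word α).getD i 0 = α i := by
  rw [List.getD_eq_getElem _ _ (by simpa [Ctx.word] using hi)]
  simp [Ctx.word]

theorem mem_leaves_nil {q : List ℕ} {m : ℕ} : q ∈ leaves [] m ↔ q.length = m ∧ ∀ b ∈ q, b ≤ 1 := by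
  rw [mem_leaves]
  exact ⟨fun ⟨r, h1, h2, h3⟩ => by rw [h3]; exact ⟨h1, h2⟩, fun h => ⟨q, h.1, h.2, rfl⟩⟩

theorem Ctx.mem_grayWords (C : Ctx) {q : List ℕ} :
    q ∈ C.grayWords ↔ q ∈ leaves [] C.n ∧ Sat q C.T := by
  have hT := C.isTm C.T (by simp)
  obtain ⟨h1, h2, -⟩ := C.gray_visits
  simp only [Ctx.grayWords, List.mem_map, List.mem_range, mem_leaves_nil]
  constructor
  · rintro ⟨i, hi, rfl⟩
    refine ⟨⟨by simp [Ctx.word], fun b hb => ?_⟩, fun x hx => ?_⟩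
    · obtain ⟨a, -, rfl⟩ := List.mem_map.1 hb
      exact (h1 i hi).2 a
    · have := hT.2 x hx
      rw [C.getD_word _ (by omega), (h1 i hi).1 _ fun h => (C.mem_free.1 h).2
        (List.mem_map_of_mem hx),
        C.s₀_of_mem hx]
  · rintro ⟨⟨h3, h4⟩, h5⟩
    have h7 : ∀ a ∉ C.free, q.getD a 0 = C.s₀.2 a := by
      intro a ha
      by_cases han : a ∈ C.T.map Prod.fst
      · obtain ⟨x, hx, rfl⟩ := List.mem_map.1 han
        rw [C.s₀_of_mem hx]
        exact h5 x hx
      · have hle : C.n ≤ a := by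
          by_contra h
          exact ha (C.mem_free.2 ⟨by omega, han⟩)
        rw [List.getD_eq_default _ _ (by omega)]
        simp only [Ctx.s₀]
        rw [if_neg fun h => han (List.mem_map_of_mem h)]
    have h8 : ∀ a, q.getD a 0 ≤ 1 := by
      intro a
      rcases Nat.lt_or_ge a q.length with h | h
      · rw [List.getD_eq_getElem _ _ h]
        exact h4 _ (List.getElem_mem h)
      · rw [List.getD_eq_default _ _ h]
        omega
    obtain ⟨i, hi, h6⟩ := h2 _ h7 h8
    refine ⟨i, hi, ?_⟩
    rw [h6]
    refine List.ext_getElem (by simp [Ctx.word, h3]) fun j hj1 hj2 => ?_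
    simp [Ctx.word, List.getElem?_eq_getElem hj2]

theorem Ctx.nodup_grayWords (C : Ctx) : C.grayWords.Nodup := by
  obtain ⟨h1, -, h3⟩ := C.gray_visits
  refine List.Nodup.map_on (fun i hi j hj h => ?_) List.nodup_range
  rw [List.mem_range] at hi hj
  refine h3 i hi j hj (funext fun a => ?_)
  rcases Nat.lt_or_ge a C.n with ha | ha
  · rw [← C.getD_word (C.gray i).2 ha, h, C.getD_word _ ha]
  · have hf : a ∉ C.free := fun h => by have := (C.mem_free.1 h).1; omega
    rw [(h1 i hi).1 a hf, (h1 j hj).1 a hf]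

open Classical in
/-- All words that are output. -/
noncomputable def Ctx.allWords (C : Ctx) : List (List ℕ) :=
  C.grayWords ++ (leaves [] C.n).filter C.IsExtra

theorem restrictAll_eq {C : Ctx} {l : Tm} (hl : l ∈ C.F) {q : List ℕ} (hq : q ∈ leaves [] C.n) :
    (restrictAll q l = some [] ↔ Sat q l) ∧ (restrictAll q l = none ↔ ¬ Sat q l) := by
  rcases restrictAll_full (C.isTm l hl) (mem_leaves_nil.1 hq).1 with ⟨h2, h3⟩ | ⟨h2, h3⟩
  · exact ⟨iff_of_true h3 h2, iff_of_false (by simp [h3]) (not_not.2 h2)⟩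
  · exact ⟨iff_of_false (by simp [h3]) h2, iff_of_true h3 h2⟩

theorem Ctx.mem_allWords (C : Ctx) {q : List ℕ} :
    q ∈ C.allWords ↔ q ∈ leaves [] C.n ∧ ∃ l ∈ C.F, Sat q l := by
  classical
  have hT : C.T ∈ C.F := by simp [Ctx.F]
  simp only [Ctx.allWords, List.mem_append, C.mem_grayWords, List.mem_filter, decide_eq_true_eq]
  constructor
  · rintro (⟨h1, h2⟩ | ⟨h1, -, l, hl, h2⟩)
    · exact ⟨h1, _, hT, h2⟩
    · exact ⟨h1, l, hl, (restrictAll_eq hl h1).1.1 h2⟩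
  · rintro ⟨h1, l, hl, h2⟩
    by_cases h3 : Sat q C.T
    · exact .inl ⟨h1, h3⟩
    · exact .inr ⟨h1, (restrictAll_eq hT h1).2.2 h3, l, hl, (restrictAll_eq hl h1).1.2 h2⟩

theorem Ctx.nodup_allWords (C : Ctx) : C.allWords.Nodup := by
  classical
  refine C.nodup_grayWords.append ((nodup_leaves _ _).filter _) fun q h1 h2 => ?_
  rw [List.mem_filter, decide_eq_true_eq] at h2
  exact (restrictAll_eq (by simp [Ctx.F]) h2.1).2.1 h2.2.1 (C.mem_grayWords.1 h1).2

/-! ### The whole program -/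

/-- After the search, whose extra models are `Bs`, the remaining words of the Gray code follow. -/
theorem wp_finish {C : Ctx} {Bs : List (List ℕ)} {e : ℕ} {σ : Cfg} {Q : Cfg → Prop}
    (h : Inv C Bs (2 ^ C.nf) e σ) (he : e ≤ C.G)
    (hQ : ∀ σ', σ'.words.Perm (C.grayWords ++ Bs) → σ'.gap + 50 ≤ C.E.later → Q σ') :
    wp C.E Prog.finish Q σ := by
  have hL := h.lay
  have hnar := C.bound_lt
  obtain ⟨hb1, hb2, hb3⟩ := two_sz_le_bound C
  obtain ⟨hG1, hG2⟩ := C.le_G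
  have hgap := h.gap_le le_rfl he
  have hnf := C.nf_le
  have hwne := h.words_ne
  obtain ⟨i, hi, hm, hw, -, -⟩ := h.gray
  have hle : ∀ i < 2 ^ C.nf, (C.gray i).1 0 ≤ C.nf := by
    intro i hi
    rcases Nat.lt_or_ge (i + 1) (2 ^ C.nf) with h1 | h1
    · exact (C.gray_lt h1).le
    · have : i = 2 ^ C.nf - 1 := by omega
      rw [this, C.gray_last]
  have hf0 : σ.m (64 + 2 * C.n) = (C.gray i).1 0 := hm.fo 0 (by omega)
  have hle0 := hle i hi
  simp (disch := omega) only [Prog.finish, wp_seq_iff, wp_op_iff, Op.Ok, Op.next, update_var,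
    reduceCtorEq, if_false, if_true, ArithOp.eval, hL.fo, hL.nf, hf0]
  and_intros <;> try omega
  refine wp_loop_of_invariant (N := 2 ^ C.nf - 1 - i) (fun N σ₁ => ∃ i, i + 1 + N = 2 ^ C.nf ∧
    Lay C σ₁.v ∧ GrayMem C (C.gray i) σ₁.m ∧
    σ₁.words.Perm ((List.range (i + 1)).map (fun j => C.word (C.gray j).2) ++ Bs) ∧ σ₁.words ≠ [] ∧
    σ₁.v .tj = (C.gray i).1 0 ∧ σ₁.v .tt = C.nf - (C.gray i).1 0 ∧ σ₁.gap + 100 ≤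
      C.E.later) ?_ ?_ ?_
  · rintro N σ₁ ⟨i, g1, g2, g3, g4, g5, g6, g7, g8⟩ h0
    have hend : ¬ i + 1 < 2 ^ C.nf := fun h1 => by have := C.gray_lt h1; omega
    have : i + 1 = 2 ^ C.nf := by omega
    rw [this] at g4
    exact hQ _ g4 (by simp only [Cfg.wait]; omega)
  · rintro N σ₁ ⟨i, g1, g2, g3, g4, g5, g6, g7, g8⟩ h0
    have hi1 : i + 1 < 2 ^ C.nf := by
      by_contra h1
      have : i = 2 ^ C.nf - 1 := by omega
      rw [this, C.gray_last] at g7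
      omega
    refine ⟨N - 1, by omega, ?_⟩
    rw [wp_seq_iff]
    refine wp_grayStep (σ := σ₁.wait 1) (s := C.gray i) g2 g3 g6 (C.gray_lt hi1) g5
      (by simp only [Cfg.wait]; omega) fun σ₂ k1 k2 k3 k4 k5 => ?_
    simp only [Cfg.wait] at k1 k2 k5
    have hL2 : Lay C σ₂.v := g2.of_eq (by simp only [layVars]; simp [k1])
    rw [← C.gray_succ] at k3 k5
    have hf2 : σ₂.m (64 + 2 * C.n) = (C.gray (i + 1)).1 0 := k3.fo 0 (by omega)
    have hle2 := hle (i + 1) hi1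
    simp (disch := omega) only [wp_seq_iff, wp_op_iff, Op.Ok, Op.next, Cfg.wait, update_var,
      reduceCtorEq, if_false, if_true, ArithOp.eval, hL2.fo, hL2.nf, hf2]
    and_intros <;> try omega
    refine ⟨i + 1, by omega, hL2.of_eq ?_, k3, ?_, ?_, rfl, rfl, by omega⟩
    · simp only [layVars, update_var]; simp
    · rw [k5, List.range_succ (n := i + 1), List.map_append]
      refine (g4.append_right _).trans ?_
      simp only [List.append_assoc]
      exact List.perm_append_comm.append_left _
    · rw [k5]; simp
  · refine ⟨i, by omega, hL.of_eq ?_, hm, hw, hwne, by simp, by simp, by simp only; omega⟩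
    simp only [layVars, update_var]; simp

/-- The program outputs all words, within the limits. -/
theorem wp_main (C : Ctx) : wp C.E Prog.main
    (fun σ => σ.words.Perm C.allWords ∧ σ.words ≠ [] ∧ σ.gap ≤ C.E.later) Cfg.init := by
  classical
  have hEx : C.E.x = C.x := rfl
  have hx0 : C.x.getD 0 0 = C.n := rfl
  have hx1 : C.x.getD 1 0 = C.F.length := rfl
  have hF : C.F.length ≠ 0 := by simp [Ctx.F]
  have hG := C.le_G
  have hfirst : C.E.first = 200 * (C.n + 1) := rfl
  simp (disch := omega) only [Prog.main, Cfg.init, wp_seq_iff, wp_op_iff, wp_ifz_iff,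
    Op.Ok, Op.next,
    Cfg.wait, update_var, reduceCtorEq, if_false, if_true, true_and, hEx, hx0, hx1, hF,
    false_imp_iff]
  intro _
  refine wp_layout (by simp) (by simp) (by simp) (by simp) fun σ₁ a1 a2 a3 a4 a5 a6 => ?_
  simp only at a4 a5 a6
  rw [wp_seq_iff]
  refine wp_readFirst a1 (fun a => by rw [a4]) fun σ₂ b1 b2 b3 b4 b5 b6 b7 => ?_
  rw [wp_seq_iff]
  refine wp_initGray b1 b2 b5 fun σ₃ c1 c2 c3 c4 c5 c6 c7 => ?_
  have hw3 : σ₃.words = [] := by rw [c7, b7, a6]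
  have hword : (List.range' 64 (63 + C.n + 1 - 64)).map σ₃.m = C.word C.s₀.2 :=
    word_eq (by omega) c4.va
  simp only [wp_seq_iff, wp_op_iff, Op.Ok, Op.next, c1.va, c1.ve, hw3, if_true, hword,
    List.nil_append]
  and_intros <;> try omega
  refine wp_initBudget c1 c4 rfl (by simp) fun σ₄ d1 d2 d3 d4 d5 => ?_
  simp only at d3 d4 d5
  rw [wp_seq_iff]
  refine wp_readTerms d1 (by omega) d2 (by rw [d3, c2, b3, a2]) (by rw [d4, c3, b4, a3])
    (fun a ha => by rw [d5]; exact c5 a ha) fun σ₅ S h5 => ?_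
  have hterms : ∀ l ∈ C.F, l.length ≤ σ₅.v .rm ∧ l ∈ S := by simpa using h5.terms
  -- a sixteenth of the words pays for the reading, and half of them for the search
  have hΦ : C.readCost + 2 ^ (C.n + σ₅.v .rm + 3) * C.unit (σ₅.v .rm) ≤ 2 ^ C.nf := by
    have h1 := C.readCost_le
    have h2 : (2 : ℚ) ^ (C.n + σ₅.v .rm + 3) * C.unit (σ₅.v .rm) = 2 ^ C.nf / 2 := by
      rw [← C.nf_add_length, Ctx.unit]
      simp only [pow_add]
      field_simp
      norm_num
    have h3 : (0 : ℚ) ≤ 2 ^ C.nf := by positivity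
    linarith
  rw [wp_seq_iff]
  refine wp_search (L := C.F.map some) h5.built.trie (fun l hl => (hterms l hl).2)
    (fun l hl => (hterms l hl).1) h5.inv (by omega) rfl h5.built.nodes h5.built.markBound ?_
    (by simpa using h5.seg) (by simpa using h5.lp) (by simp) h5.hp hΦ le_rfl fun σ₆ h6 => ?_
  · refine ⟨C.nodup.map (Option.some_injective _), fun o => ?_, ?_⟩
    · simp only [List.mem_map, restrictAll_nil]
      exact exists_congr fun l => and_congr_right fun _ => eq_comm
    · rw [restrictAll_nil]; rfl
  · refine wp_finish h6 (by omega) fun σ₇ h7 h8 => ?_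
    refine ⟨h7, fun h => ?_, by omega⟩
    have h9 := h7.length_eq
    have h10 := Nat.two_pow_pos C.nf
    simp only [h, List.length_nil, List.length_append, Ctx.grayWords, List.length_map,
      List.length_range] at h9
    omega

/-! ### Formulas and their encodings -/

/-- The term with the given literals, with numbers in place of variables and signs. -/
def ofListing {n : ℕ} (ls : List (Literal n)) : Tm := ls.map fun l => ((l.1 : ℕ), l.2.toNat)

theorem encTm_ofListing {n : ℕ} (ls : List (Literal n)) : encTm (ofListing ls) = encodeTerm ls := by
  simp [encTm, ofListing, encodeTerm, List.flatMap_map]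

theorem bool_toNat_injective : Function.Injective Bool.toNat := by decide

theorem ofListing_injective {n : ℕ} : Function.Injective (ofListing (n := n)) := by
  refine List.map_injective_iff.2 ?_
  rintro ⟨i, a⟩ ⟨j, b⟩ h
  simp only [Prod.mk.injEq] at h
  exact Prod.ext (Fin.ext h.1) (bool_toNat_injective h.2)

theorem isTm_ofListing {n : ℕ} {T : DNFTerm n} {ls : List (Literal n)} (h : T.IsListing ls) :
    IsTm 0 n (ofListing ls) := by
  refine ⟨List.pairwise_map.2 h.1, fun x hx => ?_⟩
  obtain ⟨l, -, rfl⟩ := List.mem_map.1 hx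
  exact ⟨Nat.zero_le _, by simp [l.1.2], Bool.toNat_le _⟩

theorem length_ofListing {n : ℕ} {T : DNFTerm n} {ls : List (Literal n)} (h : T.IsListing ls) :
    (ofListing ls).length = T.lits.card := by
  classical
  have hnd : ls.Nodup := h.1.imp fun h => by rintro rfl; exact lt_irrefl _ h
  rw [ofListing, List.length_map, ← List.toFinset_card_of_nodup hnd]
  congr 1
  ext l
  rw [List.mem_toFinset, h.2]

theorem sat_ofListing {n : ℕ} {T : DNFTerm n} {ls : List (Literal n)} (h : T.IsListing ls)
    (α : Fin n → Bool) : KDNF.Sat (encodeAssignment α) (ofListing ls) ↔ T.Sat α := by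
  have hget : ∀ i : Fin n, (encodeAssignment α).getD i 0 = (α i).toNat := fun i => by
    simp [encodeAssignment]
  simp only [KDNF.Sat, DNFTerm.Sat, ofListing, List.forall_mem_map, hget, ← h.2]
  exact forall₂_congr fun l _ => bool_toNat_injective.eq_iff

theorem eq_of_isListing {n : ℕ} {T T' : DNFTerm n} {ls : List (Literal n)} (h : T.IsListing ls)
    (h' : T'.IsListing ls) : T = T' :=
  DNFTerm.ext (Finset.ext fun l => by rw [← h.2, h'.2])

theorem nodup_of_forall₂ {n : ℕ} {ts : List (DNFTerm n)} {F : List (List (Literal n))}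
    (h : List.Forall₂ DNFTerm.IsListing ts F) (hts : ts.Nodup) : F.Nodup := by
  induction h with
  | nil => exact List.nodup_nil
  | @cons T ls ts F h1 h2 ih =>
    rw [List.nodup_cons] at hts ⊢
    refine ⟨fun hls => hts.1 ?_, ih hts.2⟩
    obtain ⟨T', hT', h3⟩ := (List.forall₂_iff_get.1 h2 |> fun ⟨e, g⟩ => by
      obtain ⟨i, hi, rfl⟩ := List.getElem_of_mem hls
      exact ⟨ts[i], List.getElem_mem _, g i (by omega) hi⟩ :
        ∃ T' ∈ ts, DNFTerm.IsListing T' ls)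
    rwa [eq_of_isListing h1 h3]

theorem forall₂_mem {α β : Type*} {R : α → β → Prop} {l : List α} {l' : List β}
    (h : List.Forall₂ R l l') : (∀ a ∈ l, ∃ b ∈ l', R a b) ∧ ∀ b ∈ l', ∃ a ∈ l, R a b := by
  induction h with
  | nil => simp
  | cons h1 _ ih => exact ⟨by simp_all, by simp_all⟩

theorem mem_leaves_iff_encode {n : ℕ} {q : List ℕ} :
    q ∈ leaves [] n ↔ ∃ α : Fin n → Bool, encodeAssignment α = q := by
  rw [mem_leaves_nil]
  constructor
  · rintro ⟨rfl, h⟩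
    refine ⟨fun i => decide (q[i] = 1), List.ext_getElem (by simp [encodeAssignment])
      fun i h1 h2 => ?_⟩
    have := h q[i] (List.getElem_mem h2)
    simp only [encodeAssignment, List.getElem_ofFn, Fin.getElem_fin]
    interval_cases h : q[i] <;> simp
  · rintro ⟨α, rfl⟩
    refine ⟨by simp [encodeAssignment], fun b hb => ?_⟩
    obtain ⟨i, rfl⟩ := (List.mem_ofFn' _ _).1 hb
    exact Bool.toNat_le _

/-- The context of a nonempty formula. -/
def ofFormula {n k : ℕ} (D : DNF n) (ls : List (Literal n)) (F : List (List (Literal n)))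
    (hk : D.IsKDNF k) (hF : D.IsListing (ls :: F)) : Ctx where
  n := n
  T := ofListing ls
  F' := F.map ofListing
  K := k
  isTm l hl := by
    obtain ⟨ts, h1, h2, h3⟩ := hF
    rw [← List.map_cons] at hl
    obtain ⟨l, h4, rfl⟩ := List.mem_map.1 hl
    obtain ⟨T, h5, h6⟩ := (forall₂_mem h3).2 l h4
    exact isTm_ofListing h6
  nodup := by
    obtain ⟨ts, h1, h2, h3⟩ := hF
    rw [← List.map_cons]
    exact (nodup_of_forall₂ h3 h1).map ofListing_injective
  length_le l hl := by
    obtain ⟨ts, h1, h2, h3⟩ := hF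
    rw [← List.map_cons] at hl
    obtain ⟨l, h4, rfl⟩ := List.mem_map.1 hl
    obtain ⟨T, h5, h6⟩ := (forall₂_mem h3).2 l h4
    rw [length_ofListing h6]
    exact hk T ((h2 T).1 h5)

theorem ofFormula_x {n k : ℕ} {D : DNF n} {ls : List (Literal n)} {F : List (List (Literal n))}
    (hk : D.IsKDNF k) (hF : D.IsListing (ls :: F)) :
    (ofFormula D ls F hk hF).x = encodeDNF (ls :: F) := by
  simp [ofFormula, Ctx.x, Ctx.F, encodeDNF, List.flatMap_map, encTm_ofListing]

theorem mem_allWords_ofFormula {n k : ℕ} {D : DNF n} {ls : List (Literal n)}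
    {F : List (List (Literal n))} (hk : D.IsKDNF k) (hF : D.IsListing (ls :: F)) {q : List ℕ} :
    q ∈ (ofFormula D ls F hk hF).allWords ↔ q ∈ encodeAssignment '' D.models := by
  have h0 : (ofFormula D ls F hk hF).F = (ls :: F).map ofListing := rfl
  obtain ⟨ts, h1, h2, h3⟩ := hF
  obtain ⟨h4, h5⟩ := forall₂_mem h3
  rw [Ctx.mem_allWords, h0]
  simp only [List.mem_map, Set.mem_image, DNF.models, Set.mem_ofPred_eq]
  constructor
  · rintro ⟨hq, -, ⟨l, hl, rfl⟩, hs⟩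
    obtain ⟨α, rfl⟩ := mem_leaves_iff_encode.1 hq
    obtain ⟨T, hT, hTl⟩ := h5 l hl
    exact ⟨α, ⟨T, (h2 T).1 hT, (sat_ofListing hTl α).1 hs⟩, rfl⟩
  · rintro ⟨α, ⟨T, hT, hs⟩, rfl⟩
    obtain ⟨l, hl, hTl⟩ := h4 T ((h2 T).2 hT)
    exact ⟨mem_leaves_iff_encode.2 ⟨α, rfl⟩, _, ⟨l, hl, rfl⟩, (sat_ofListing hTl α).2 hs⟩

/-! ### The limits -/

/-- The delay is even `O(k * 2 ^ (2 * k))`. -/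
theorem later_le (C : Ctx) (hK : 1 ≤ C.K) :
    ((17 * C.E.later : ℕ) : ℝ) ≤ 200000 * (C.K : ℝ) ^ (3 / 2 : ℝ) * 2 ^ (2 * C.K) := by
  have hK1 : (1 : ℝ) ≤ C.K := by exact_mod_cast hK
  have hT : C.T.length ≤ C.K := C.length_le _ (by simp)
  have h1 : C.maxBud ≤ 16 * 2 ^ (2 * C.K) :=
    Nat.mul_le_mul_left _ (Nat.pow_le_pow_right (by omega) (by omega))
  have h2 : 2 * C.K < 2 ^ (2 * C.K) := Nat.lt_two_pow_self
  have h3 : 2 ^ 2 ≤ 2 ^ (2 * C.K) := Nat.pow_le_pow_right (by omega) (by omega)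
  have hG : C.G ≤ 400 * C.K := by simp only [Ctx.G]; omega
  have hB : C.maxBud + 2 * C.K + 10 ≤ 28 * 2 ^ (2 * C.K) := by omega
  have h4 : C.E.later ≤ 400 * C.K * (28 * 2 ^ (2 * C.K)) := Nat.mul_le_mul hG hB
  have h5 : (C.K : ℝ) ≤ (C.K : ℝ) ^ (3 / 2 : ℝ) := by
    nth_rewrite 1 [← Real.rpow_one (C.K : ℝ)]
    exact Real.rpow_le_rpow_of_exponent_le hK1 (by norm_num)
  have h6 : 17 * C.E.later ≤ 200000 * C.K * 2 ^ (2 * C.K) := by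
    refine (Nat.mul_le_mul_left 17 h4).trans ?_
    have : 17 * (400 * C.K * (28 * 2 ^ (2 * C.K))) = 190400 * (C.K * 2 ^ (2 * C.K)) := by ring
    rw [this, mul_assoc]
    exact Nat.mul_le_mul_right _ (by omega)
  refine (Nat.cast_le.2 h6).trans ?_
  push_cast
  gcongr

/-- A formula without terms: the program halts after its first test. -/
theorem enumerates_empty {x : List ℕ} (hx : x.getD 1 0 = 0) {p d : ℝ} (hp : 136 ≤ p)
    (hd : 136 ≤ d) :
    EnumeratesWithin (Prog.main.compile 0) x ∅ p d := by
  have hE : (Env.mk x 0 0 0 8 8).Valid := ⟨by simp, by simp⟩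
  have h : wp (Env.mk x 0 0 0 8 8) Prog.main (fun σ => σ.words = [] ∧ σ.gap ≤ 8) Cfg.init := by
    simp only [Prog.main, Cfg.init, wp_seq_iff, wp_op_iff, wp_ifz_iff, wp_skip_iff, Op.Ok, Op.next,
      Cfg.wait, update_var, reduceCtorEq, if_false, if_true, true_and, hx]
    exact ⟨by simp, by simp⟩
  obtain ⟨σ, h1, h2, h3⟩ := h
  refine h1.enumerates hE (by simp [h2]) (by simp [h2]) ?_ ?_ ?_
  · rw [ite_self]; exact h3
  · norm_num; exact hp
  · norm_num; exact hd

end KDNF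

/-- One machine and one constant `C`, for all `n`, all `k ≥ 1` and all `k`-DNF formulas on `n`
variables: precomputation time at most `C (n + 1)`, delay at most `C k^{3/2} 2^{2k}`. -/
theorem theorem1 :
    ∃ (P : RAM.Program) (C : ℝ), ∀ (n k : ℕ) (D : DNF n) (F : List (List (Literal n))),
      1 ≤ k → D.IsKDNF k → D.IsListing F →
        RAM.EnumeratesWithin P (encodeDNF F) (encodeAssignment '' D.models)
          (C * ((n : ℝ) + 1)) (C * (k : ℝ) ^ (3 / 2 : ℝ) * 2 ^ (2 * k)) := by
  refine ⟨KDNF.Prog.main.compile 0, 200000, fun n k D F hk hD hF => ?_⟩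
  cases F with
  | nil =>
    have hS : encodeAssignment '' D.models = ∅ := by
      obtain ⟨ts, -, h1, h2⟩ := hF
      obtain rfl : ts = [] := List.forall₂_nil_right_iff.1 h2
      rw [Set.image_eq_empty]
      refine Set.eq_empty_of_forall_notMem fun α ⟨T, hT, _⟩ => ?_
      exact absurd ((h1 T).2 hT) List.not_mem_nil
    have hn : (0 : ℝ) ≤ n := Nat.cast_nonneg n
    have hk1 : (1 : ℝ) ≤ (k : ℝ) ^ (3 / 2 : ℝ) :=
      Real.one_le_rpow (by exact_mod_cast hk) (by norm_num)
    have h2 : (1 : ℝ) ≤ 2 ^ (2 * k) := one_le_pow₀ (by norm_num)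
    rw [hS]
    exact KDNF.enumerates_empty rfl (by linarith) (by nlinarith)
  | cons ls F =>
    have hx := KDNF.ofFormula_x hD hF
    have hmem := fun q => KDNF.mem_allWords_ofFormula hD hF (q := q)
    have hlater := KDNF.later_le (KDNF.ofFormula D ls F hD hF) hk
    obtain ⟨σ, h1, h2, h3, h4⟩ := KDNF.wp_main (KDNF.ofFormula D ls F hD hF)
    rw [← hx]
    refine h1.enumerates (KDNF.Ctx.valid _) (h2.nodup_iff.2 (KDNF.Ctx.nodup_allWords _))
      (fun q => h2.mem_iff.trans (hmem q)) ?_ ?_ hlater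
    · rwa [if_neg h3]
    · have h5 : (KDNF.ofFormula D ls F hD hF).E.first = 200 * (n + 1) := rfl
      rw [h5]
      push_cast
      have hn : (0 : ℝ) ≤ n := Nat.cast_nonneg n
      linarith
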